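/- **Theorem.** For a positive integer $k$, call $X$ a $k$-repeating subsequence of a string $S$ if $X$ and $X^k$ (the concatenation of $k$ copies of $X$) are (not necessarily contiguous) subsequences of $S$; it is maximal if no string $Y \neq X$ that contains $X$ as a subsequence is a $k$-repeating subsequence of $S$. There is an algorithm which, given a string $S$ of length $n \ge 0$ and an integer $k \ge 1$, computes a maximal $k$-repeating subsequence $Y$ of $S$ in $$O\!\left(k\binom{2k-1}{k}\, n\log n + 1\right)$$ time, where the implied constant is absolute. Moreover, $Y$ is the empty string $\varepsilon$ if no letter occurs at least $k$ times in $S$; otherwise $Y$ contains $\sigma^{\lfloor \ell/k\rfloor}$ as a subsequence, for some letter $\sigma$ that occurs $\ell \ge k$ times in $S$. In particular, for every fixed $k$ the running time of this algorithm is $O(n\log n + 1)$, with an implied constant that depends only on $k$. Here an algorithm is a single program for the word RAM, the same for all inputs and all word lengths: the letters of $S$ and $k$ are given as machine words of $w$ bits, $w \ge c\log_2(n+2)$ for an absolute constant $c$, memory is initially zero apart from the input, and each arithmetic operation on words (addition, subtraction cut off at $0$, multiplication, integer division, the results being reduced modulo $2^w$), each comparison, each read or write of a variable or of an array entry, and each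 test takes one step. -/

import Mathlib

/-! ### Maximal `k`-repeating subsequences (subsequence = `List.Sublist`, written `<+`) -/

/-- `X` is a `k`-repeating subsequence of `S`: both `X` and `X ^ k` (the concatenation of `k`
copies of `X`) are subsequences of `S`. -/
def IsKRepeating {α : Type*} (k : ℕ) (S X : List α) : Prop :=
  X.Sublist S ∧ (List.replicate k X).flatten.Sublist S

/-- `X` is a maximal `k`-repeating subsequence of `S`: no proper supersequence of `X` is
`k`-repeating in `S`. -/
def IsMaximalKRepeating {α : Type*} (k : ℕ) (S X : List α) : Prop :=
  IsKRepeating k S X ∧ ∀ Y : List α, X.Sublist Y → Y ≠ X → ¬ IsKRepeating k S Y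

/-! ### The word RAM

Words are the natural numbers below `2 ^ w`. A program is a finite structured command; it uses
finitely many variables (each holding one word) and finitely many arrays (indexed by words, each
entry holding one word). Every operation on words, memory access and test has unit cost. -/

namespace WordRAM

/-- Binary word operations. -/
inductive BinOp : Type
  | add | sub | mul | div | lt | eq

/-- Results are reduced modulo `2 ^ w`; subtraction is cut off at `0`; comparisons return `1`
for true and `0` for false. -/
def BinOp.eval (w : ℕ) : BinOp → ℕ → ℕ → ℕ
  | .add, x, y => (x + y) % 2 ^ w
  | .sub, x, y => (x - y) % 2 ^ w
  | .mul, x, y => (x * y) % 2 ^ w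
  | .div, x, y => (x / y) % 2 ^ w
  | .lt, x, y => (if x < y then 1 else 0) % 2 ^ w
  | .eq, x, y => (if x = y then 1 else 0) % 2 ^ w

/-- Expressions: a constant, a variable, the entry of an array at a computed index, or a binary
operation. -/
inductive Expr : Type
  | const (c : ℕ)
  | var (x : ℕ)
  | load (a : ℕ) (i : Expr)
  | bin (op : BinOp) (e₁ e₂ : Expr)

/-- Memory: `var x` is the value of variable `x`, and `arr a i` is entry `i` of array `a`. -/
structure Memory : Type where
  var : ℕ → ℕ
  arr : ℕ → ℕ → ℕ

/-- The value of an expression. -/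
def Expr.eval (w : ℕ) (s : Memory) : Expr → ℕ
  | .const c => c % 2 ^ w
  | .var x => s.var x
  | .load a i => s.arr a (i.eval w s)
  | .bin op e₁ e₂ => op.eval w (e₁.eval w s) (e₂.eval w s)

/-- The cost of evaluating an expression: one step for each of its nodes. -/
def Expr.cost : Expr → ℕ
  | .const _ => 1
  | .var _ => 1
  | .load _ i => i.cost + 1
  | .bin _ e₁ e₂ => e₁.cost + e₂.cost + 1

/-- Commands: do nothing, assign to a variable, write to an array entry, sequence, conditional
and loop (a test succeeds if its value is nonzero). -/
inductive Cmd : Type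
  | skip
  | assign (x : ℕ) (e : Expr)
  | store (a : ℕ) (i e : Expr)
  | seq (p q : Cmd)
  | cond (e : Expr) (p q : Cmd)
  | loop (e : Expr) (p : Cmd)

/-- The memory after writing `v` to variable `x`. -/
def Memory.setVar (s : Memory) (x v : ℕ) : Memory :=
  { s with var := Function.update s.var x v }

/-- The memory after writing `v` to entry `i` of array `a`. -/
def Memory.setArr (s : Memory) (a i v : ℕ) : Memory :=
  { s with arr := Function.update s.arr a (Function.update (s.arr a) i v) }

/-- `Exec w p s t s'`: with word length `w`, the command `p` started in memory `s` halts after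
exactly `t` steps in memory `s'`. -/
inductive Exec (w : ℕ) : Cmd → Memory → ℕ → Memory → Prop
  | skip (s : Memory) : Exec w .skip s 1 s
  | assign (s : Memory) (x : ℕ) (e : Expr) :
      Exec w (.assign x e) s (e.cost + 1) (s.setVar x (e.eval w s))
  | store (s : Memory) (a : ℕ) (i e : Expr) :
      Exec w (.store a i e) s (i.cost + e.cost + 1) (s.setArr a (i.eval w s) (e.eval w s))
  | seq {p q : Cmd} {s s' s'' : Memory} {t t' : ℕ} :
      Exec w p s t s' → Exec w q s' t' s'' → Exec w (.seq p q) s (t + t') s''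
  | condTrue {e : Expr} {p q : Cmd} {s s' : Memory} {t : ℕ} :
      e.eval w s ≠ 0 → Exec w p s t s' → Exec w (.cond e p q) s (e.cost + 1 + t) s'
  | condFalse {e : Expr} {p q : Cmd} {s s' : Memory} {t : ℕ} :
      e.eval w s = 0 → Exec w q s t s' → Exec w (.cond e p q) s (e.cost + 1 + t) s'
  | loopTrue {e : Expr} {p : Cmd} {s s' s'' : Memory} {t t' : ℕ} :
      e.eval w s ≠ 0 → Exec w p s t s' → Exec w (.loop e p) s' t' s'' →
        Exec w (.loop e p) s (e.cost + 1 + t + t') s''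
  | loopFalse {e : Expr} {p : Cmd} {s : Memory} :
      e.eval w s = 0 → Exec w (.loop e p) s (e.cost + 1) s

/-- The initial memory on input `(S, k)`: variable `0` holds the length of `S`, variable `1`
holds `k`, array `0` holds the letters of `S`, and everything else is `0`. -/
def input (S : List ℕ) (k : ℕ) : Memory where
  var x := if x = 0 then S.length else if x = 1 then k else 0
  arr a i := if a = 0 then S.getD i 0 else 0

/-- The string returned: variable `0` holds its length and array `1` holds its letters. -/
def Memory.output (s : Memory) : List ℕ :=
  (List.range (s.var 0)).map (s.arr 1)

end WordRAM

/-- The input `(S, k)` is admissible for word length `w`: `k` and the letters of `S` are words,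
and `w` is at least `c * log₂ (|S| + 2)`. -/
def FitsWords (c w k : ℕ) (S : List ℕ) : Prop :=
  (S.length + 2) ^ c ≤ 2 ^ w ∧ k < 2 ^ w ∧ ∀ a ∈ S, a < 2 ^ w

/-- With word length `w`, the program `P` on input `(S, k)` halts within `T` steps and returns a
maximal `k`-repeating subsequence `Y` of `S`. Moreover `Y` is empty if no letter occurs at least
`k` times in `S`, and otherwise `Y` extends `σ ^ ⌊ℓ / k⌋` for some letter `σ` that occurs
`ℓ ≥ k` times in `S`. -/
def FindsMaximalKRepeating (P : WordRAM.Cmd) (w k : ℕ) (S : List ℕ) (T : ℝ) : Prop :=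
  ∃ (t : ℕ) (s : WordRAM.Memory),
    WordRAM.Exec w P (WordRAM.input S k) t s ∧
    (t : ℝ) ≤ T ∧
    IsMaximalKRepeating k S s.output ∧
    ((∀ σ : ℕ, S.count σ < k) → s.output = []) ∧
    ((∃ σ : ℕ, k ≤ S.count σ) →
      ∃ σ : ℕ, k ≤ S.count σ ∧ (List.replicate (S.count σ / k) σ).Sublist s.output)

namespace WordRAM

/-! ### Running commands with a postcondition on time and memory -/

/-! If no letter occurs `k` times, only the empty string is `k`-repeating. Otherwise take a letter
`σ` with `ℓ ≥ k` occurrences, and put `m = ℓ / k`, `D = ℓ % k`. The string `σ ^ m` is `k`-repeating,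
and no `k`-repeating string has more than `m` copies of `σ`. So every `k`-repeating extension has
exactly `m` copies and splits at its first `σ` as `H ++ σ :: T` with `σ ∉ H`. In an embedding of its
`k`-th power, call the positions of these first `σ`s the cuts. Consecutive cuts are at least `m`
occurrences of `σ` apart, so cut `j + 1` is occurrence `j * m + r j + 1` for a monotone tuple `r`
with values at most `D` (`exists_valid`). There are `(D + k).choose k ≤ (2 * k - 1).choose k` such
tuples.

For fixed cuts the power embeds as soon as `H` fits before the first cut, `T ++ H` between
consecutive cuts and `T` after the last (`Valid`). A pair that admits no proper valid extension
keeps this property when it is enlarged (`Inextensible.mono`). One pass over all tuples, making the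
pair inextensible for each in turn, therefore ends with a maximal string (`isMaximalKRepeating`).

For one tuple the two halves decouple. With `H` fixed and placed as far right as possible, the
admissible `T` are the common subsequences of `k` intervals (`valid_iff_common_right`); with the
enlarged `T` fixed and placed as far left as possible, the same holds for `H`
(`valid_iff_common_left`). Enlarging `T` and then `H` to maximal common subsequences suffices: a
valid extension of the final pair is also one for the old `H`, hence has the same `T`, hence the
same `H`.

A common subsequence is enlarged by a left-to-right search (`Search`). It keeps a closed prefix `A`,
a suffix `B` with its rightmost embeddings on stacks, and a reached position in every interval. A
letter is inserted before `B` if it fits everywhere; otherwise it is skipped in one interval. When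
an interval has no room left before `B`, nothing can be inserted there and the head of `B` moves to
`A`. A step takes `k` binary searches up to a constant factor. The number of steps is linear in `n`,
since the intervals are disjoint (`runs_searchStep`, `runs_extend`). -/

/-- Whether a command contains an assignment to variable `x`. -/
def Cmd.writesVar (x : ℕ) : Cmd → Bool
  | .skip => false
  | .assign y _ => x == y
  | .store _ _ _ => false
  | .seq p q => p.writesVar x || q.writesVar x
  | .cond _ p q => p.writesVar x || q.writesVar x
  | .loop _ p => p.writesVar x

/-- Whether a command contains a write to array `a`. -/
def Cmd.writesArr (a : ℕ) : Cmd → Bool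
  | .skip => false
  | .assign _ _ => false
  | .store b _ _ => a == b
  | .seq p q => p.writesArr a || q.writesArr a
  | .cond _ p q => p.writesArr a || q.writesArr a
  | .loop _ p => p.writesArr a

/-- The memories `s` and `s'` agree on everything that `p` does not write. -/
structure Frame (p : Cmd) (s s' : Memory) : Prop where
  var : ∀ x, p.writesVar x = false → s'.var x = s.var x
  arr : ∀ a, p.writesArr a = false → s'.arr a = s.arr a

theorem Frame.refl (p : Cmd) (s : Memory) : Frame p s s := ⟨fun _ _ => rfl, fun _ _ => rfl⟩

theorem Frame.trans {p : Cmd} {s₁ s₂ s₃ : Memory} (h : Frame p s₁ s₂) (h' : Frame p s₂ s₃) :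
    Frame p s₁ s₃ :=
  ⟨fun x hx => (h'.var x hx).trans (h.var x hx), fun a ha => (h'.arr a ha).trans (h.arr a ha)⟩

theorem Frame.mono {p q : Cmd} {s s' : Memory}
    (hv : ∀ x, q.writesVar x = false → p.writesVar x = false)
    (ha : ∀ a, q.writesArr a = false → p.writesArr a = false) (h : Frame p s s') :
    Frame q s s' :=
  ⟨fun x hx => h.var x (hv x hx), fun a hx => h.arr a (ha a hx)⟩

@[simp] theorem setVar_var (s : Memory) (x v y : ℕ) :
    (s.setVar x v).var y = if y = x then v else s.var y := by
  simp [Memory.setVar, Function.update_apply]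

@[simp] theorem setVar_arr (s : Memory) (x v : ℕ) : (s.setVar x v).arr = s.arr := rfl

@[simp] theorem setArr_var (s : Memory) (a i v : ℕ) : (s.setArr a i v).var = s.var := rfl

@[simp] theorem setArr_arr (s : Memory) (a i v b : ℕ) :
    (s.setArr a i v).arr b = if b = a then Function.update (s.arr a) i v else s.arr b := by
  simp [Memory.setArr, Function.update_apply]

/-- The written variables and arrays are computed syntactically, so for concrete programs
preservation of everything else is settled by `rfl`. -/
theorem Exec.frame {w : ℕ} {p : Cmd} {s s' : Memory} {t : ℕ} (h : Exec w p s t s') :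
    Frame p s s' := by
  induction h with
  | skip s => exact Frame.refl _ _
  | assign s x e =>
    refine ⟨fun y hy => ?_, fun _ _ => rfl⟩
    simp only [Cmd.writesVar, beq_eq_false_iff_ne] at hy
    simp [hy]
  | store s a i e =>
    refine ⟨fun _ _ => rfl, fun b hb => ?_⟩
    simp only [Cmd.writesArr, beq_eq_false_iff_ne] at hb
    simp [hb]
  | seq _ _ h₁ h₂ =>
    refine Frame.trans (h₁.mono ?_ ?_) (h₂.mono ?_ ?_) <;>
      simp +contextual [Cmd.writesVar, Cmd.writesArr]
  | condTrue _ _ h =>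
    refine h.mono ?_ ?_ <;> simp +contextual [Cmd.writesVar, Cmd.writesArr]
  | condFalse _ _ h =>
    refine h.mono ?_ ?_ <;> simp +contextual [Cmd.writesVar, Cmd.writesArr]
  | loopTrue _ _ _ h₁ h₂ => exact Frame.trans ⟨h₁.var, h₁.arr⟩ h₂
  | loopFalse _ => exact Frame.refl _ _

/-! ### Rules for total correctness with running times -/

/-- The command `p` started in `s` halts, and the number of steps and the final memory
satisfy `Q`. -/
def Runs (w : ℕ) (p : Cmd) (s : Memory) (Q : ℕ → Memory → Prop) : Prop :=
  ∃ t s', Exec w p s t s' ∧ Q t s'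

variable {w : ℕ} {p q : Cmd} {s : Memory} {Q Q' : ℕ → Memory → Prop} {e : Expr}

theorem Runs.mono (h : Runs w p s Q) (hQ : ∀ t s', Frame p s s' → Q t s' → Q' t s') :
    Runs w p s Q' := by
  obtain ⟨t, s', he, hq⟩ := h
  exact ⟨t, s', he, hQ t s' he.frame hq⟩

theorem runs_skip (h : Q 1 s) : Runs w .skip s Q := ⟨_, _, .skip s, h⟩

theorem runs_assign {x : ℕ} (h : Q (e.cost + 1) (s.setVar x (e.eval w s))) :
    Runs w (.assign x e) s Q := ⟨_, _, .assign s x e, h⟩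

theorem runs_store {a : ℕ} {i : Expr}
    (h : Q (i.cost + e.cost + 1) (s.setArr a (i.eval w s) (e.eval w s))) :
    Runs w (.store a i e) s Q := ⟨_, _, .store s a i e, h⟩

theorem runs_seq (h : Runs w p s fun t s' => Runs w q s' fun t' s'' => Q (t + t') s'') :
    Runs w (.seq p q) s Q := by
  obtain ⟨t, s', he, t', s'', he', hq⟩ := h
  exact ⟨_, _, .seq he he', hq⟩

theorem runs_cond_true (he : e.eval w s ≠ 0)
    (h : Runs w p s fun t s' => Q (e.cost + 1 + t) s') : Runs w (.cond e p q) s Q := by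
  obtain ⟨t, s', hx, hq⟩ := h
  exact ⟨_, _, .condTrue he hx, hq⟩

theorem runs_cond_false (he : e.eval w s = 0)
    (h : Runs w q s fun t s' => Q (e.cost + 1 + t) s') : Runs w (.cond e p q) s Q := by
  obtain ⟨t, s', hx, hq⟩ := h
  exact ⟨_, _, .condFalse he hx, hq⟩

theorem runs_cond (h : e.eval w s ≠ 0 → Runs w p s fun t s' => Q (e.cost + 1 + t) s')
    (h' : e.eval w s = 0 → Runs w q s fun t s' => Q (e.cost + 1 + t) s') :
    Runs w (.cond e p q) s Q := by
  by_cases he : e.eval w s = 0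
  exacts [runs_cond_false he (h' he), runs_cond_true he (h he)]

/-- The rule for loops, with an invariant `I` and a potential `Φ` that pays for the steps. -/
theorem runs_loop (I : Memory → Prop) (Φ : Memory → ℕ) (hI : I s)
    (hstep : ∀ s', Frame p s s' → I s' → e.eval w s' ≠ 0 →
      Runs w p s' fun t s'' => I s'' ∧ e.cost + 1 + t + Φ s'' ≤ Φ s' ∧ Φ s'' < Φ s') :
    Runs w (.loop e p) s fun t s' => I s' ∧ e.eval w s' = 0 ∧ t + Φ s' ≤ Φ s + e.cost + 1 := by
  -- Strong induction on the potential: its strict decrease gives termination, and the weak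
  -- inequality accumulates the cost.
  have key : ∀ N s', Φ s' = N → Frame p s s' → I s' → Runs w (.loop e p) s' fun t s'' =>
      I s'' ∧ e.eval w s'' = 0 ∧ t + Φ s'' ≤ Φ s' + e.cost + 1 := by
    intro N
    induction N using Nat.strong_induction_on with
    | _ N ih =>
      intro s' hN hf hI
      by_cases he : e.eval w s' = 0
      · exact ⟨_, s', .loopFalse he, hI, he, by omega⟩
      · obtain ⟨t, s₁, hx, hI₁, ht, hlt⟩ := hstep s' hf hI he
        obtain ⟨t', s₂, hx', hI₂, he₂, ht'⟩ :=
          ih (Φ s₁) (hN ▸ hlt) s₁ rfl (hf.trans hx.frame) hI₁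
        exact ⟨_, s₂, .loopTrue he hx hx', hI₂, he₂, by omega⟩
  exact key _ s rfl (Frame.refl _ _) hI

/-- Run `p` for the values `lo, lo + 1, …` of variable `x` that are below variable `h`. -/
def Cmd.for (x lo h : ℕ) (p : Cmd) : Cmd :=
  .seq (.assign x (.const lo)) (.loop (.bin .lt (.var x) (.var h))
    (.seq p (.assign x (.bin .add (.var x) (.const 1)))))

/-- The rule for counting loops whose body takes at most `T` steps. -/
theorem runs_for {x lo h : ℕ} (I : ℕ → Memory → Prop) (T : ℕ) (hx : p.writesVar x = false)
    (hh : p.writesVar h = false) (hxh : x ≠ h) (hlo : lo ≤ s.var h) (hw : s.var h < 2 ^ w)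
    (hI : I lo (s.setVar x lo))
    (hstep : ∀ i s', lo ≤ i → i < s.var h → s'.var x = i →
      Frame (.seq p (.assign x (.const 0))) s s' → I i s' →
      Runs w p s' fun t s'' => I (i + 1) (s''.setVar x (i + 1)) ∧ t ≤ T) :
    Runs w (.for x lo h p) s fun t s' =>
      I (s.var h) s' ∧ t ≤ (s.var h - lo) * (T + 8) + 6 := by
  have h1w : 1 < 2 ^ w ∨ s.var h = 0 := by omega
  refine runs_seq (runs_assign ?_)
  have hlo' : lo % 2 ^ w = lo := Nat.mod_eq_of_lt (by omega)
  simp only [Expr.eval, hlo']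
  refine Runs.mono (runs_loop (fun s' => ∃ i, lo ≤ i ∧ i ≤ s.var h ∧ s'.var x = i ∧ I i s')
    (fun s' => (s.var h - s'.var x) * (T + 8)) ⟨lo, le_rfl, hlo, by simp, hI⟩ ?_) ?_
  · rintro s' hf ⟨i, hi, hi', hxi, hIi⟩ he
    -- The assigned constant is a dummy: a frame depends only on what is written, here the targets
    -- of the body and the counter.
    have hfr : Frame (.seq p (.assign x (.const 0))) s s' := by
      refine ⟨fun y hy => ?_, fun a ha => ?_⟩
      · rw [hf.var y (by simpa [Cmd.writesVar] using hy)]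
        simp [Cmd.writesVar] at hy
        simp [hy.2]
      · rw [hf.arr a (by simpa [Cmd.writesArr] using ha)]
        simp
    have hhv : s'.var h = s.var h := hfr.var h (by simp [Cmd.writesVar, hh, Ne.symm hxh])
    have hlt : i < s.var h := by
      by_contra hcon
      simp [Expr.eval, BinOp.eval, hxi, hhv, hcon] at he
    refine runs_seq ((hstep i s' hi hlt hxi hfr hIi).mono ?_)
    rintro t s'' hf' ⟨hI', ht⟩
    have hxi' : s''.var x = i := (hf'.var x hx).trans hxi
    have hw1 : 1 % 2 ^ w = 1 := Nat.mod_eq_of_lt (by omega)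
    have hw2 : (i + 1) % 2 ^ w = i + 1 := Nat.mod_eq_of_lt (by omega)
    refine runs_assign ?_
    simp only [Expr.eval, BinOp.eval, hxi', hw1, hw2, Expr.cost, setVar_var, if_true, hxi]
    obtain ⟨r, hr⟩ : ∃ r, s.var h - i = r + 1 := ⟨s.var h - i - 1, by omega⟩
    have hr' : s.var h - (i + 1) = r := by omega
    rw [hr, hr', Nat.add_mul]
    exact ⟨⟨i + 1, by omega, by omega, rfl, hI'⟩, by omega, by omega⟩
  · rintro t s' hf ⟨⟨i, hi, hi', hxi, hIi⟩, he, ht⟩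
    have hhv : s'.var h = s.var h := by
      rw [hf.var h (by simp [Cmd.writesVar, hh, Ne.symm hxh])]
      simp [Ne.symm hxh]
    have : ¬ i < s.var h := by
      intro hlt
      have hw1 : 1 % 2 ^ w = 1 := Nat.mod_eq_of_lt (by omega)
      simp [Expr.eval, BinOp.eval, hxi, hhv, hlt, hw1] at he
    obtain rfl : i = s.var h := by omega
    refine ⟨hIi, ?_⟩
    simp [Expr.cost] at ht ⊢
    omega

end WordRAM

section

/-! ### Embeddings of strings into open intervals of positions -/

/-- The letter of `S` at position `p` (positions start at `1`) is `c`. -/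
def At (S : List ℕ) (p c : ℕ) : Prop := 1 ≤ p ∧ S[p - 1]? = some c

instance (S : List ℕ) (p c : ℕ) : Decidable (At S p c) := by unfold At; infer_instance

/-- The last position before `R` that holds the letter `c`, or `0` if there is none. -/
def lastBefore (S : List ℕ) (c R : ℕ) : ℕ := Nat.findGreatest (fun p => At S p c) (R - 1)

/-- The position of the first letter of the rightmost embedding of a string before `e`. -/
def rightmost (S : List ℕ) (e : ℕ) (X : List ℕ) : ℕ := X.foldr (lastBefore S) e

/-- The string `X` embeds into the part of `S` strictly between positions `a` and `e`. -/
def Emb (S : List ℕ) : List ℕ → ℕ → ℕ → Prop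
  | [], a, e => a < e
  | c :: X, a, e => ∃ p, a < p ∧ At S p c ∧ Emb S X p e

variable {S : List ℕ}

theorem At.unique {p c d : ℕ} (h : At S p c) (h' : At S p d) : c = d :=
  Option.some.inj (h.2.symm.trans h'.2)

theorem At.le {p c : ℕ} (h : At S p c) : p ≤ S.length := by
  obtain ⟨h, h'⟩ := h
  have := (List.getElem?_eq_some_iff.1 h').1
  omega

theorem at_getD {q : ℕ} (h : q < S.length) : At S (q + 1) (S.getD q 0) :=
  ⟨by omega, by simp [h]⟩

theorem At.getD {p c : ℕ} (h : At S p c) : S.getD (p - 1) 0 = c := by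
  simp [List.getD, h.2]

/-- Positions start at `1`, so the default value `0` lies above no left end and the absence of an
occurrence needs no separate case. -/
theorem lt_lastBefore {a c R : ℕ} : a < lastBefore S c R ↔ ∃ p, a < p ∧ p < R ∧ At S p c := by
  constructor
  · intro h
    refine ⟨_, h, ?_, ?_⟩
    · have : lastBefore S c R ≤ R - 1 := Nat.findGreatest_le _
      omega
    · exact Nat.findGreatest_of_ne_zero (P := fun p => At S p c) rfl
        (Nat.ne_of_gt ((Nat.zero_le a).trans_lt h))
  · rintro ⟨p, hp, hR, hat⟩
    exact hp.trans_le (Nat.le_findGreatest (by omega) hat)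

theorem lastBefore_eq {c R p : ℕ} (h : p = 0 ∨ (At S p c ∧ p < R))
    (h' : ∀ q, p < q → q < R → ¬ At S q c) : lastBefore S c R = p := by
  refine le_antisymm (not_lt.1 fun hlt => ?_) (not_lt.1 fun hlt => ?_)
  · obtain ⟨q, hq, hqR, hat⟩ := lt_lastBefore.1 hlt
    exact h' q hq hqR hat
  · rcases h with rfl | h
    · omega
    · exact lt_irrefl _ (hlt.trans_le (not_lt.1 fun hh => absurd (lt_lastBefore.2
        ⟨p, hh, h.2, h.1⟩) (lt_irrefl _)))

theorem lastBefore_spec {c R : ℕ} (h : 0 < lastBefore S c R) :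
    At S (lastBefore S c R) c ∧ lastBefore S c R < R := by
  obtain ⟨p, hp, hpR, hat⟩ := lt_lastBefore.1 (show lastBefore S c R - 1 < lastBefore S c R by omega)
  have h2 : p = lastBefore S c R :=
    le_antisymm (Nat.le_findGreatest (by omega) hat) (by omega)
  exact h2 ▸ ⟨hat, hpR⟩

theorem Emb.lt {X : List ℕ} {a e : ℕ} (h : Emb S X a e) : a < e := by
  induction X generalizing a with
  | nil => exact h
  | cons c X ih => obtain ⟨p, hp, -, h⟩ := h; exact hp.trans (ih h)

/-- The greedy embedding from the right starts as late as possible. Embeddability thus becomes one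
comparison with a stored number, which is what the program tests. -/
theorem emb_iff {X : List ℕ} {a e : ℕ} : Emb S X a e ↔ a < rightmost S e X := by
  induction X generalizing a with
  | nil => rfl
  | cons c X ih =>
    simp only [Emb, ih]
    rw [show rightmost S e (c :: X) = lastBefore S c (rightmost S e X) from rfl, lt_lastBefore]
    exact exists_congr fun p => by tauto

theorem rightmost_append {e : ℕ} {X Y : List ℕ} :
    rightmost S e (X ++ Y) = rightmost S (rightmost S e Y) X := by
  simp [rightmost]

theorem rightmost_le {X : List ℕ} {e : ℕ} : rightmost S e X ≤ e := by
  by_contra h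
  exact lt_irrefl _ (emb_iff.2 (not_le.1 h)).lt

theorem Emb.mono {X : List ℕ} {a a' e : ℕ} (h : Emb S X a e) (ha : a' ≤ a) : Emb S X a' e :=
  emb_iff.2 (ha.trans_lt (emb_iff.1 h))

theorem Emb.mono_right {X : List ℕ} {a e e' : ℕ} (h : Emb S X a e) (he : e ≤ e') :
    Emb S X a e' := by
  induction X generalizing a with
  | nil => exact lt_of_lt_of_le h he
  | cons c X ih => obtain ⟨p, hp, hat, h⟩ := h; exact ⟨p, hp, hat, ih h⟩

theorem Emb.sublist {X Y : List ℕ} {a e : ℕ} (h : Emb S Y a e) (hXY : X.Sublist Y) :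
    Emb S X a e := by
  induction hXY generalizing a with
  | slnil => exact h
  | cons c _ ih => obtain ⟨p, hp, -, h⟩ := h; exact (ih h).mono hp.le
  | cons_cons c _ ih => obtain ⟨p, hp, hat, h⟩ := h; exact ⟨p, hp, hat, ih h⟩

/-- The split `m` may itself be the last position used by `X`, whence the right end `m + 1`; `Y`
starts strictly after `m`. -/
theorem emb_append {X Y : List ℕ} {a e : ℕ} :
    Emb S (X ++ Y) a e ↔ ∃ m, Emb S X a (m + 1) ∧ Emb S Y m e := by
  induction X generalizing a with
  | nil =>
    exact ⟨fun h => ⟨a, Nat.lt_succ_self a, h⟩, fun ⟨m, h, h'⟩ => h'.mono (Nat.le_of_lt_succ h)⟩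
  | cons c X ih =>
    simp only [List.cons_append, Emb, ih]
    constructor
    · rintro ⟨p, hp, hat, m, h, h'⟩
      exact ⟨m, ⟨p, hp, hat, h⟩, h'⟩
    · rintro ⟨m, ⟨p, hp, hat, h⟩, h'⟩
      exact ⟨p, hp, hat, m, h, h'⟩

theorem emb_snoc {X : List ℕ} {c a e : ℕ} :
    Emb S (X ++ [c]) a e ↔ ∃ p, p < e ∧ At S p c ∧ Emb S X a p := by
  rw [emb_append]
  constructor
  · rintro ⟨m, h, p, hp, hat, hpe⟩
    exact ⟨p, hpe, hat, h.mono_right (by omega)⟩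
  · rintro ⟨p, hp, hat, h⟩
    have := hat.1
    exact ⟨p - 1, h.mono_right (by omega), p, by omega, hat, hp⟩

theorem emb_length_add {X : List ℕ} {a e : ℕ} (h : Emb S X a e) : X.length + a < e := by
  induction X generalizing a with
  | nil => simpa using h.lt
  | cons c X ih =>
    obtain ⟨p, hp, -, h⟩ := h
    have := ih h
    simp only [List.length_cons]
    omega

theorem emb_drop_iff {X : List ℕ} {a : ℕ} :
    Emb S X a (S.length + 1) ↔ a ≤ S.length ∧ X.Sublist (S.drop a) := by
  induction X generalizing a with
  | nil => simp [Emb]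
  | cons c X ih =>
    simp only [Emb, ih, List.cons_sublist_iff]
    constructor
    · rintro ⟨p, hp, hat, hpl, h⟩
      refine ⟨by omega, (S.drop a).take (p - a), (S.drop a).drop (p - a),
        (List.take_append_drop _ _).symm, ?_, ?_⟩
      · refine List.mem_of_getElem? (i := p - 1 - a) ?_
        rw [List.getElem?_take_of_lt (by omega), List.getElem?_drop]
        rw [show a + (p - 1 - a) = p - 1 by omega]
        exact hat.2
      · rw [List.drop_drop, show a + (p - a) = p by omega]
        exact h
    · rintro ⟨ha, r₁, r₂, hr, hc, h⟩
      obtain ⟨i, hi, hic⟩ := List.getElem_of_mem hc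
      have hlen := congrArg List.length hr
      simp only [List.length_drop, List.length_append] at hlen
      have hr2 : r₂ = S.drop (a + r₁.length) := by
        rw [← List.drop_drop, hr, List.drop_left]
      refine ⟨a + i + 1, by omega, ⟨by omega, ?_⟩, by omega, h.trans ?_⟩
      · rw [show a + i + 1 - 1 = a + i by omega, ← List.getElem?_drop, hr,
          List.getElem?_append_left hi, List.getElem?_eq_getElem hi, hic]
      · rw [hr2, show a + r₁.length = a + i + 1 + (r₁.length - i - 1) by omega, ← List.drop_drop]
        exact List.drop_sublist _ _

theorem emb_zero_iff {X : List ℕ} : Emb S X 0 (S.length + 1) ↔ X.Sublist S := by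
  simp [emb_drop_iff]

/-! ### Extending a common subsequence of several intervals -/

/-- Being a common subsequence passes to subsequences, so maximality only has to be tested against
insertions of a single letter. -/
theorem exists_insertion {X Y : List ℕ} (h : X.Sublist Y) (hne : Y ≠ X) :
    ∃ A B c, X = A ++ B ∧ (A ++ c :: B).Sublist Y := by
  induction h with
  | slnil => exact absurd rfl hne
  | @cons X Y c h ih => exact ⟨[], X, c, rfl, h.cons_cons c⟩
  | @cons_cons X Y c h ih =>
    obtain ⟨A, B, d, rfl, hs⟩ := ih fun h => hne (by rw [h])
    exact ⟨c :: A, B, d, rfl, hs.cons_cons c⟩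

/-- `X` embeds into each of the intervals `(a i, e i)`, `i ∈ I`. -/
def Common (S : List ℕ) (I : Finset ℕ) (a e : ℕ → ℕ) (X : List ℕ) : Prop :=
  ∀ i ∈ I, Emb S X (a i) (e i)

theorem Common.sublist {I : Finset ℕ} {a e : ℕ → ℕ} {X Y : List ℕ} (h : Common S I a e Y)
    (hXY : X.Sublist Y) : Common S I a e X := fun i hi => (h i hi).sublist hXY

/-- The state of the left-to-right search for a maximal common subsequence: the string is
`A ++ B`, no letter can be inserted into `A`, and position `L i` of the `i`-th interval has been
reached. At the end of the string the search runs through the interval `j₀`. -/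
structure Search (S : List ℕ) (I : Finset ℕ) (a e : ℕ → ℕ) (j₀ : ℕ) (A B : List ℕ)
    (L : ℕ → ℕ) : Prop where
  left : ∀ i ∈ I, Emb S A (a i) (L i + 1)
  right : ∀ i ∈ I, Emb S B (L i) (e i)
  closed : ∀ A₁ A₂ c, A = A₁ ++ A₂ → A₂ ≠ [] → ¬ Common S I a e (A₁ ++ c :: (A₂ ++ B))
  reached : ∀ x, Common S I a e (A ++ x :: B) ∨ B.head? = some x →
    ∀ i ∈ I, ¬ Emb S (A ++ [x]) (a i) (L i + 1)
  leftmost : B = [] → ∀ i ∈ I, i ≠ j₀ → ∀ m, Emb S A (a i) (m + 1) → L i ≤ m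

namespace Search

variable {I : Finset ℕ} {a e : ℕ → ℕ} {j₀ : ℕ} {A B : List ℕ} {L : ℕ → ℕ}

theorem start (h : Common S I a e B) : Search S I a e j₀ [] B a where
  left _ _ := Nat.lt_succ_self _
  right := h
  closed A₁ A₂ c hA hne := by simp_all
  reached x _ i _ := by
    rintro ⟨p, hp, -, h⟩
    have := h.lt
    omega
  leftmost _ i _ _ m hm := Nat.le_of_lt_succ hm

theorem common (h : Search S I a e j₀ A B L) : Common S I a e (A ++ B) :=
  fun i hi => emb_append.2 ⟨L i, h.left i hi, h.right i hi⟩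

/-- By `reached`, an insertable `c` placed after `A` must lie beyond `L i` in every interval. So
insertion is decided by `B` and the remaining windows, without looking back at `A`. -/
theorem common_insert_iff (h : Search S I a e j₀ A B L) {c : ℕ} :
    Common S I a e (A ++ c :: B) ↔ ∀ i ∈ I, Emb S (c :: B) (L i) (e i) := by
  refine ⟨fun hc i hi => ?_, fun hc i hi => emb_append.2 ⟨L i, h.left i hi, hc i hi⟩⟩
  have hc' := hc i hi
  rw [show A ++ c :: B = (A ++ [c]) ++ B by simp] at hc'
  obtain ⟨m, h₁, h₂⟩ := emb_append.1 hc'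
  obtain ⟨p, hp, hat, h₃⟩ := emb_snoc.1 h₁
  refine ⟨p, ?_, hat, h₂.mono (by omega)⟩
  by_contra hpL
  exact h.reached c (.inl hc) i hi (emb_snoc.2 ⟨p, by omega, hat, h₃⟩)

theorem push (h : Search S I a e j₀ A B L) {c : ℕ}
    (hc : ∀ i ∈ I, Emb S (c :: B) (L i) (e i)) : Search S I a e j₀ A (c :: B) L where
  left := h.left
  right := hc
  closed A₁ A₂ d hA hne hC := h.closed A₁ A₂ d hA hne (hC.sublist (by simp))
  reached x hx := by
    refine h.reached x ?_
    rcases hx with hx | hx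
    · exact .inl (hx.sublist (by simp))
    · obtain rfl : c = x := by simpa using hx
      exact .inl (h.common_insert_iff.2 hc)
  leftmost h := by simp at h

/-- Passing over `c` loses nothing: it cannot be inserted by `hc`, and it is not the head `b` of
`B`, since otherwise `b` followed by `B` would fit in interval `j`, against `hb`. For empty `B` only
interval `j₀` moves, so the other reached positions stay leftmost. -/
theorem skip (h : Search S I a e j₀ A B L) {j c : ℕ} (hj : j ∈ I)
    (hb : ∀ b ∈ B.head?, ¬ Emb S (b :: B) (L j) (e j)) (hj₀ : B = [] → j = j₀)
    (hlt : Emb S B (L j + 1) (e j)) (hat : At S (L j + 1) c)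
    (hc : ¬ ∀ i ∈ I, Emb S (c :: B) (L i) (e i)) :
    Search S I a e j₀ A B (Function.update L j (L j + 1)) where
  left i hi := by
    by_cases hij : i = j
    · subst hij; simpa using (h.left i hi).mono_right (by omega)
    · simpa [hij] using h.left i hi
  right i hi := by
    by_cases hij : i = j
    · subst hij; simpa using hlt
    · simpa [hij] using h.right i hi
  closed := h.closed
  reached x hx i hi := by
    by_cases hij : i = j
    · subst hij
      rw [Function.update_self]
      intro hE
      obtain ⟨p, hp, hat', hA⟩ := emb_snoc.1 hE
      have hp' : p = L i + 1 := by
        by_contra hne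
        exact h.reached x hx i hi (emb_snoc.2 ⟨p, by omega, hat', hA⟩)
      subst hp'
      obtain rfl := hat.unique hat'
      rcases hx with hx | hx
      · exact hc (h.common_insert_iff.1 hx)
      · exact hb c hx ⟨_, by omega, hat, hlt⟩
    · rw [Function.update_of_ne hij]
      exact h.reached x hx i hi
  leftmost hB i hi hij := by
    rw [Function.update_of_ne (hj₀ hB ▸ hij)]
    exact h.leftmost hB i hi hij

theorem not_common_insert (h : Search S I a e j₀ A B L) {j : ℕ} (hj : j ∈ I)
    (hend : ¬ Emb S B (L j + 1) (e j)) (c : ℕ) : ¬ Common S I a e (A ++ c :: B) := by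
  intro hc
  obtain ⟨p, hp, -, hE⟩ := h.common_insert_iff.1 hc j hj
  exact hend (hE.mono hp)

/-- Since `A ++ [b]` did not embed up to `L i`, the next occurrence `L' i` of `b` is the end of its
leftmost embedding. This gives both `reached` and `leftmost` for the new state. -/
theorem emit {b : ℕ} (h : Search S I a e j₀ A (b :: B) L) {j : ℕ} (hj : j ∈ I)
    (hend : ¬ Emb S (b :: B) (L j + 1) (e j)) {L' : ℕ → ℕ}
    (hL : ∀ i ∈ I, L i < L' i ∧ At S (L' i) b ∧ ∀ p, L i < p → p < L' i → ¬ At S p b) :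
    Search S I a e j₀ (A ++ [b]) B L' where
  left i hi := emb_snoc.2 ⟨L' i, by omega, (hL i hi).2.1,
    (h.left i hi).mono_right (Nat.succ_le_of_lt (hL i hi).1)⟩
  right i hi := by
    obtain ⟨p, hp, hat, hE⟩ := h.right i hi
    exact hE.mono (not_lt.1 fun hlt => (hL i hi).2.2 p hp hlt hat)
  closed A₁ A₂ c hA hne := by
    rcases List.eq_nil_or_concat A₂ with rfl | ⟨A₃, d, rfl⟩
    · exact absurd rfl hne
    simp only [List.concat_eq_append, ← List.append_assoc] at hA
    obtain ⟨rfl, hd⟩ := List.append_inj' hA rfl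
    obtain rfl : b = d := by simpa using hd
    -- Inserting immediately before the emitted `b` means inserting between `A` and `b :: B`, which
    -- the exhausted interval `j` forbids; insertions further left were excluded before.
    by_cases hA₃ : A₃ = []
    · subst hA₃
      simpa using h.not_common_insert hj hend c
    · simpa using h.closed A₁ A₃ c rfl hA₃
  reached y _ i hi hE := by
    obtain ⟨p, hp, -, hE'⟩ := emb_snoc.1 hE
    obtain ⟨p', hp', hat', hA⟩ := emb_snoc.1 hE'
    refine h.reached b (.inr rfl) i hi (emb_snoc.2 ⟨p', ?_, hat', hA⟩)
    by_contra hlt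
    exact (hL i hi).2.2 p' (by omega) (by omega) hat'
  leftmost _ i hi _ m hE := by
    obtain ⟨p, hp, hat, hA⟩ := emb_snoc.1 hE
    by_contra hlt
    have : p ≤ L i := not_lt.1 fun hh => (hL i hi).2.2 p hh (by omega) hat
    exact h.reached b (.inr rfl) i hi (emb_snoc.2 ⟨p, by omega, hat, hA⟩)

theorem maximal (h : Search S I a e j₀ A [] L) {j : ℕ} (hj : j ∈ I)
    (hend : ¬ Emb S [] (L j + 1) (e j)) {Y : List ℕ} (hY : A.Sublist Y)
    (hC : Common S I a e Y) : Y = A := by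
  by_contra hne
  obtain ⟨A₁, A₂, c, rfl, hs⟩ := exists_insertion hY hne
  have hC' := hC.sublist hs
  by_cases hA : A₂ = []
  · subst hA
    have := h.not_common_insert hj hend c
    simp_all
  · exact h.closed A₁ A₂ c rfl hA (by simpa using hC')

end Search

end

section

/-! ### Enumerating monotone tuples in colexicographic order -/

/-- `r 0 ≤ r 1 ≤ ⋯ ≤ r (k - 1) ≤ D`. -/
def IsTuple (k D : ℕ) (r : ℕ → ℕ) : Prop :=
  (∀ i j, i ≤ j → j < k → r i ≤ r j) ∧ ∀ j < k, r j ≤ D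

/-- The number of monotone tuples before `r` in the colexicographic order. -/
def tupleRank (k : ℕ) (r : ℕ → ℕ) : ℕ := ∑ j ∈ Finset.range k, (r j + j).choose (j + 1)

theorem IsTuple.of_succ {k D : ℕ} {r : ℕ → ℕ} (h : IsTuple (k + 1) D r) : IsTuple k (r k) r :=
  ⟨fun i j hij hj => h.1 i j hij (by omega), fun j hj => h.1 j k hj.le (by omega)⟩

/-- The earlier entries are bounded by the last one, so induction bounds their contribution by `(r k
+ k).choose k`, and Pascal's rule adds the last term. -/
theorem tupleRank_lt {k D : ℕ} {r : ℕ → ℕ} (h : IsTuple k D r) :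
    tupleRank k r < (D + k).choose k := by
  induction k generalizing D with
  | zero => simp [tupleRank]
  | succ k ih =>
    have h₁ := ih h.of_succ
    have h₂ : (r k + (k + 1)).choose (k + 1) ≤ (D + (k + 1)).choose (k + 1) :=
      Nat.choose_le_choose _ (Nat.add_le_add_right (h.2 k (by omega)) _)
    rw [← Nat.add_assoc (r k), Nat.choose_succ_succ'] at h₂
    simp only [tupleRank, Finset.sum_range_succ] at h₁ ⊢
    omega

theorem tupleRank_lt_of_last_lt {k D : ℕ} {r r' : ℕ → ℕ} (h : IsTuple (k + 1) D r)
    (hlt : r k < r' k) : tupleRank (k + 1) r < tupleRank (k + 1) r' := by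
  refine (tupleRank_lt (show IsTuple (k + 1) (r k) r from ⟨h.1, fun j hj => h.1 j k (by omega)
    (by omega)⟩)).trans_le ?_
  refine (Nat.choose_le_choose _ (show r k + (k + 1) ≤ r' k + k by omega)).trans ?_
  simp only [tupleRank, Finset.sum_range_succ]
  exact Nat.le_add_left _ _

theorem tupleRank_injective {k D : ℕ} {r r' : ℕ → ℕ} (h : IsTuple k D r) (h' : IsTuple k D r')
    (heq : tupleRank k r = tupleRank k r') : ∀ j < k, r j = r' j := by
  induction k generalizing D with
  | zero => simp
  | succ k ih =>
    have hk : r k = r' k := by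
      rcases lt_trichotomy (r k) (r' k) with hlt | hk | hlt
      · exact absurd heq (tupleRank_lt_of_last_lt h hlt).ne
      · exact hk
      · exact absurd heq (tupleRank_lt_of_last_lt h' hlt).ne'
    have heq' : tupleRank k r = tupleRank k r' := by
      simp only [tupleRank, Finset.sum_range_succ, hk] at heq ⊢
      omega
    intro j hj
    rcases Nat.lt_succ_iff_lt_or_eq.1 hj with hj | rfl
    · exact ih h.of_succ (hk ▸ h'.of_succ) heq' j hj
    · exact hk

/-- This is the equality case of `tupleRank_lt`: a constant tuple is the last one with its bound. -/
theorem tupleRank_const (i v : ℕ) {r : ℕ → ℕ} (h : ∀ j < i, r j = v) :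
    tupleRank i r + 1 = (v + i).choose i := by
  induction i with
  | zero => simp [tupleRank]
  | succ i ih =>
    have h₁ := ih fun j hj => h j (by omega)
    simp only [tupleRank, Finset.sum_range_succ] at h₁ ⊢
    rw [h i (by omega), ← Nat.add_assoc v, Nat.choose_succ_succ']
    omega

/-- The tuple after `r`, where `i` is the first index with `r i < r (i + 1)`. -/
def nextTuple (i : ℕ) (r : ℕ → ℕ) (j : ℕ) : ℕ :=
  if j < i then 0 else if j = i then r i + 1 else r j

/-- Entry `k` is a sentinel equal to the bound, so that the last proper entry is compared with its
successor like all others. -/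
theorem IsTuple.next {k D i : ℕ} {r : ℕ → ℕ} (h : IsTuple k D r) (hD : r k = D) (hi : i < k)
    (hlt : r i < r (i + 1)) : IsTuple k D (nextTuple i r) := by
  have hle : ∀ j, i < j → j < k → r i + 1 ≤ r j := fun j hj hjk =>
    hlt.trans_le (h.1 _ _ hj hjk)
  have hiD : r i < D := by
    rcases (show i + 1 = k ∨ i + 1 < k by omega) with hk | hk
    · rw [← hD, ← hk]; exact hlt
    · exact hlt.trans_le (h.2 _ hk)
  refine ⟨fun a b hab hb => ?_, fun j hj => ?_⟩
  · unfold nextTuple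
    have h₁ := h.1 a b hab hb
    have h₂ := hle b
    split_ifs <;> subst_vars <;> omega
  · unfold nextTuple
    have := h.2 j hj
    split_ifs <;> omega

/-- The block of equal entries up to `i` has rank one less than `(r i + i + 1).choose (i + 1)`,
which is exactly the rank of the new block of zeros followed by `r i + 1`. Hence the enumeration
misses no tuple. -/
theorem tupleRank_next {k i : ℕ} {r : ℕ → ℕ} (hi : i < k) (hc : ∀ j < i, r j = r i) :
    tupleRank k (nextTuple i r) = tupleRank k r + 1 := by
  induction k, hi using Nat.le_induction with
  | base =>
    have h₁ := tupleRank_const (i + 1) (r i) (r := r) fun j hj => by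
      rcases Nat.lt_succ_iff_lt_or_eq.1 hj with hj | rfl
      exacts [hc j hj, rfl]
    rw [h₁]
    have h₀ : tupleRank i (nextTuple i r) = 0 := Finset.sum_eq_zero fun j hj => by
      simp [nextTuple, Finset.mem_range.1 hj]
    simp only [tupleRank, Nat.succ_eq_add_one, Finset.sum_range_succ] at h₀ ⊢
    rw [h₀]
    simp only [nextTuple, lt_irrefl, if_true, if_false, zero_add]
    congr 1
    omega
  | succ k hk ih =>
    simp only [tupleRank, Finset.sum_range_succ] at ih ⊢
    rw [ih]
    have h₁ : ¬ k < i := by omega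
    have h₂ : k ≠ i := by omega
    simp only [nextTuple, h₁, h₂, if_false]
    omega

/-! ### From `k`-repeating subsequences to common subsequences -/

/-- `pos q` is the position of the `q`-th occurrence of `c` in `S`, and `pos 0 = 0`. -/
def IsOccTable (S : List ℕ) (c : ℕ) (pos : ℕ → ℕ) : Prop :=
  pos 0 = 0 ∧ ∀ q, 1 ≤ q → q ≤ S.count c → At S (pos q) c ∧ (S.take (pos q)).count c = q

variable {S : List ℕ}

theorem count_take_mono {c p q : ℕ} (h : p ≤ q) : (S.take p).count c ≤ (S.take q).count c :=
  (List.take_sublist_take_left h).count_le c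

theorem At.count_take {p c : ℕ} (h : At S p c) :
    (S.take p).count c = (S.take (p - 1)).count c + 1 := by
  obtain ⟨h, h'⟩ := h
  obtain ⟨p, rfl⟩ : ∃ q, p = q + 1 := ⟨p - 1, by omega⟩
  rw [List.take_add_one]
  simp only [Nat.add_sub_cancel] at h' ⊢
  simp [h']

theorem At.count_lt {p q c : ℕ} (h : At S q c) (hpq : p < q) :
    (S.take p).count c < (S.take q).count c := by
  rw [h.count_take, Nat.lt_succ_iff]
  exact count_take_mono (by omega)

theorem At.eq_of_count {p q c : ℕ} (h : At S p c) (h' : At S q c)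
    (hc : (S.take p).count c = (S.take q).count c) : p = q := by
  rcases lt_trichotomy p q with hlt | rfl | hlt
  · exact absurd hc (h'.count_lt hlt).ne
  · rfl
  · exact absurd hc (h.count_lt hlt).ne'

theorem Emb.count_le {X : List ℕ} {a e c : ℕ} (h : Emb S X a e) :
    (S.take a).count c + X.count c ≤ (S.take (e - 1)).count c := by
  induction X generalizing a with
  | nil => simpa using count_take_mono (Nat.le_sub_one_of_lt h)
  | cons d X ih =>
    obtain ⟨p, hp, hat, h⟩ := h
    have h₁ := ih h
    rw [List.count_cons]
    split_ifs with hd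
    · obtain rfl : d = c := by simpa using hd
      have := hat.count_lt hp
      omega
    · have := count_take_mono (S := S) (c := c) hp.le
      omega

theorem IsOccTable.lt {c : ℕ} {pos : ℕ → ℕ} (h : IsOccTable S c pos) {q q' : ℕ} (hq : q < q')
    (hq' : q' ≤ S.count c) : pos q < pos q' := by
  have h₁ := h.2 q' (by omega) hq'
  rcases Nat.eq_zero_or_pos q with rfl | h0
  · rw [h.1]; exact h₁.1.1
  · by_contra hlt
    have h₂ := h.2 q h0 (by omega)
    have := count_take_mono (S := S) (c := c) (not_lt.1 hlt)
    omega

/-! ### Cuts, valid pairs and their extensions -/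

/-- The cuts of `S` at the occurrences of a letter that are chosen by `r`: cut `j + 1` is
occurrence number `j * m + r j + 1`. -/
def cuts (S : List ℕ) (pos : ℕ → ℕ) (k m : ℕ) (r : ℕ → ℕ) (j : ℕ) : ℕ :=
  if j = 0 then 0 else if j ≤ k then pos ((j - 1) * m + r (j - 1) + 1) else S.length + 1

/-- With the letters before the copies of `T` placed at the cuts `P 1, …, P k`, the strings `H`
and `T` embed into the parts between the cuts. -/
def Valid (S : List ℕ) (k : ℕ) (P : ℕ → ℕ) (H T : List ℕ) : Prop :=
  Emb S H 0 (P 1) ∧ (∀ j, 1 ≤ j → j < k → Emb S (T ++ H) (P j) (P (j + 1))) ∧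
    Emb S T (P k) (S.length + 1)

/-- No proper extension of `(H, T)` is valid for the cuts `P`. -/
def Inextensible (S : List ℕ) (k : ℕ) (P : ℕ → ℕ) (H T : List ℕ) : Prop :=
  ∀ H' T', H.Sublist H' → T.Sublist T' → Valid S k P H' T' → H' = H ∧ T' = T

theorem Valid.sublist {k : ℕ} {P : ℕ → ℕ} {H T H' T' : List ℕ} (h : Valid S k P H' T')
    (hH : H.Sublist H') (hT : T.Sublist T') : Valid S k P H T :=
  ⟨h.1.sublist hH, fun j hj hjk => (h.2.1 j hj hjk).sublist (hT.append hH), h.2.2.sublist hT⟩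

/-- A valid extension of the larger pair also extends the smaller one, hence equals it, and the
larger pair is squeezed in between. Tuples already processed therefore never need a second visit. -/
theorem Inextensible.mono {k : ℕ} {P : ℕ → ℕ} {H T H' T' : List ℕ} (h : Inextensible S k P H T)
    (hH : H.Sublist H') (hT : T.Sublist T') : Inextensible S k P H' T' := by
  intro H₁ T₁ hH₁ hT₁ hv
  obtain ⟨rfl, rfl⟩ := h H₁ T₁ (hH.trans hH₁) (hT.trans hT₁) hv
  exact ⟨hH.antisymm hH₁, hT.antisymm hT₁⟩

theorem inextensible_of_not_valid {k : ℕ} {P : ℕ → ℕ} {H T : List ℕ} (h : ¬ Valid S k P H T) :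
    Inextensible S k P H T := fun _ _ hH hT hv => absurd (hv.sublist hH hT) h

/-- Placing `H` as far right as possible before the next cut leaves the largest window for `X`;
after the last cut no `H` follows. -/
theorem valid_iff_common_right {k : ℕ} {P : ℕ → ℕ} {H X : List ℕ} {e : ℕ → ℕ} (hk : 1 ≤ k)
    (hH : Emb S H 0 (P 1)) (he : ∀ j, 1 ≤ j → j < k → e j = rightmost S (P (j + 1)) H)
    (hek : e k = S.length + 1) :
    Valid S k P H X ↔ Common S (Finset.Ico 1 (1 + k)) P e X := by
  have key : ∀ j, 1 ≤ j → j < k → (Emb S (X ++ H) (P j) (P (j + 1)) ↔ Emb S X (P j) (e j)) := by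
    intro j hj hjk
    rw [he j hj hjk, emb_iff, rightmost_append, ← emb_iff]
  constructor
  · rintro ⟨-, h₁, h₂⟩ j hj
    rw [Finset.mem_Ico] at hj
    rcases (show j = k ∨ j < k by omega) with rfl | hjk
    · rwa [hek]
    · exact (key j hj.1 hjk).1 (h₁ j hj.1 hjk)
  · intro h
    refine ⟨hH, fun j hj hjk => (key j hj hjk).2 (h j (Finset.mem_Ico.2 ⟨hj, by omega⟩)), ?_⟩
    rw [← hek]
    exact h k (Finset.mem_Ico.2 ⟨hk, by omega⟩)

/-- The mirror image: `L j` is the end of the leftmost embedding of `T` after cut `j`. Leftmost ends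
are needed only for `1 ≤ j < k`, since `X` never follows the last cut and nothing precedes it before
the first. -/
theorem valid_iff_common_left {k : ℕ} {P L : ℕ → ℕ} {X T : List ℕ} (hk : 1 ≤ k)
    (hL₀ : L 0 = 0) (hL : ∀ j, 1 ≤ j → j < k → Emb S T (P j) (L j + 1))
    (hL' : ∀ j, 1 ≤ j → j < k → ∀ m, Emb S T (P j) (m + 1) → L j ≤ m)
    (hT : Emb S T (P k) (S.length + 1)) :
    Valid S k P X T ↔ Common S (Finset.Ico 0 (0 + k)) L (fun j => P (j + 1)) X := by
  constructor
  · rintro ⟨h₁, h₂, -⟩ j hj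
    rw [Finset.mem_Ico] at hj
    rcases (show j = 0 ∨ 1 ≤ j by omega) with rfl | hj'
    · rwa [hL₀]
    · obtain ⟨m, hm, hE⟩ := emb_append.1 (h₂ j hj' (by omega))
      exact hE.mono (hL' j hj' (by omega) m hm)
  · intro h
    refine ⟨?_, fun j hj hjk => emb_append.2 ⟨L j, hL j hj hjk,
      h j (Finset.mem_Ico.2 ⟨by omega, by omega⟩)⟩, hT⟩
    rw [← hL₀]
    exact h 0 (Finset.mem_Ico.2 ⟨le_rfl, by omega⟩)

/-- The pieces are glued at the cuts, from the last copy back to the first. -/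
theorem Valid.sublist_power {k σ : ℕ} {P : ℕ → ℕ} {H T : List ℕ} (hk : 1 ≤ k)
    (h : Valid S k P H T) (hσ : ∀ j, 1 ≤ j → j ≤ k → At S (P j) σ) :
    (List.replicate k (H ++ σ :: T)).flatten.Sublist S := by
  have key : ∀ i, i < k → Emb S (T ++ (List.replicate i (H ++ σ :: T)).flatten) (P (k - i))
      (S.length + 1) := by
    intro i
    induction i with
    | zero => intro _; simpa using h.2.2
    | succ i ih =>
      intro hi
      have h₁ := ih (by omega)
      have hat := hσ (k - i) (by omega) (by omega)
      have h₂ := h.2.1 (k - (i + 1)) (by omega) (by omega)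
      rw [show k - (i + 1) + 1 = k - i by omega] at h₂
      have := hat.1
      rw [List.replicate_succ, List.flatten_cons,
        show T ++ ((H ++ σ :: T) ++ (List.replicate i (H ++ σ :: T)).flatten) =
          (T ++ H) ++ σ :: (T ++ (List.replicate i (H ++ σ :: T)).flatten) by simp]
      exact emb_append.2 ⟨P (k - i) - 1, h₂.mono_right (by omega), P (k - i), by omega, hat, h₁⟩
  have h₁ := key (k - 1) (by omega)
  rw [show k - (k - 1) = 1 by omega] at h₁
  have hat := hσ 1 le_rfl hk
  have := hat.1
  rw [← emb_zero_iff, show k = (k - 1) + 1 by omega, List.replicate_succ, List.flatten_cons,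
    show ∀ Z, (H ++ σ :: T) ++ Z = H ++ σ :: (T ++ Z) by simp]
  exact emb_append.2 ⟨P 1 - 1, h.1.mono_right (by omega), P 1, by omega, hat, h₁⟩

theorem exists_cuts {σ i a : ℕ} {H T : List ℕ}
    (h : Emb S (T ++ (List.replicate i (H ++ σ :: T)).flatten) a (S.length + 1)) :
    ∃ P : ℕ → ℕ, P 0 = a ∧ (∀ j < i, Emb S (T ++ H) (P j) (P (j + 1)) ∧ At S (P (j + 1)) σ) ∧
      Emb S T (P i) (S.length + 1) := by
  induction i generalizing a with
  | zero => exact ⟨fun _ => a, rfl, by simp, by simpa using h⟩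
  | succ i ih =>
    rw [List.replicate_succ, List.flatten_cons,
      show T ++ ((H ++ σ :: T) ++ (List.replicate i (H ++ σ :: T)).flatten) =
        (T ++ H) ++ σ :: (T ++ (List.replicate i (H ++ σ :: T)).flatten) by simp] at h
    obtain ⟨m, h₁, p, hp, hat, h₂⟩ := emb_append.1 h
    obtain ⟨P, hP₀, hP, hPi⟩ := ih h₂
    refine ⟨fun j => if j = 0 then a else P (j - 1), by simp, fun j hj => ?_, by simpa using hPi⟩
    rcases Nat.eq_zero_or_pos j with rfl | hj0
    · simp only [if_true, zero_add, Nat.sub_self, hP₀, one_ne_zero, if_false]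
      exact ⟨h₁.mono_right (by omega), hat⟩
    · obtain ⟨j, rfl⟩ : ∃ q, j = q + 1 := ⟨j - 1, by omega⟩
      simpa using hP j (by omega)

/-- From one distinguished `σ` to the next the occurrence number grows by at least `m`, and `m - 1`
further occurrences must follow the last one. Subtracting `j * m + 1` from the `j`-th number leaves
a monotone tuple bounded by the number of spare occurrences. -/
theorem exists_valid {σ k m : ℕ} {pos : ℕ → ℕ} {H T : List ℕ} (hk : 1 ≤ k)
    (hpos : IsOccTable S σ pos) (hH : σ ∉ H) (hT : T.count σ + 1 = m)
    (h : (List.replicate k (H ++ σ :: T)).flatten.Sublist S) :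
    ∃ r, IsTuple k (S.count σ - k * m) r ∧ Valid S k (cuts S pos k m r) H T := by
  rw [← emb_zero_iff, show k = (k - 1) + 1 by omega, List.replicate_succ, List.flatten_cons,
    show ∀ Z, (H ++ σ :: T) ++ Z = H ++ σ :: (T ++ Z) by simp] at h
  obtain ⟨m₀, h₁, p, hp, hat, h₂⟩ := emb_append.1 h
  obtain ⟨P, hP₀, hP, hPk⟩ := exists_cuts h₂
  have hatP : ∀ j < k, At S (P j) σ := by
    intro j hj
    rcases Nat.eq_zero_or_pos j with rfl | hj0
    · rwa [hP₀]
    · have := (hP (j - 1) (by omega)).2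
      rwa [show j - 1 + 1 = j by omega] at this
  -- The occurrence number of the first `σ` of copy `j`, with copies counted from `0`.
  let q : ℕ → ℕ := fun j => (S.take (P j)).count σ
  have hq₀ : 1 ≤ q 0 := by
    have := (hatP 0 hk).count_take
    simp only [q]
    omega
  have hH0 : H.count σ = 0 := List.count_eq_zero.2 hH
  have hq : ∀ j, j + 1 < k → q j + m ≤ q (j + 1) := by
    intro j hj
    obtain ⟨h₃, h₄⟩ := hP j (by omega)
    have h₅ := h₃.count_le (c := σ)
    have h₆ := h₄.count_take
    simp only [List.count_append, hH0, q] at h₅ ⊢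
    omega
  have hqk : q (k - 1) + m ≤ S.count σ + 1 := by
    have := hPk.count_le (c := σ)
    simp only [Nat.add_sub_cancel, List.take_length] at this
    simp only [q]
    omega
  have hlow : ∀ d j, j + d < k → q j + d * m ≤ q (j + d) := by
    intro d j
    induction d with
    | zero => simp
    | succ d ih =>
      intro hd
      have h₃ := ih (by omega)
      have h₄ := hq (j + d) (by omega)
      rw [Nat.add_mul, one_mul]
      rw [show j + (d + 1) = j + d + 1 by omega]
      omega
  have hlow' : ∀ j < k, j * m + 1 ≤ q j := by
    intro j hj
    have := hlow j 0 (by omega)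
    rw [Nat.zero_add] at this
    omega
  have hle : ∀ j < k, q j ≤ S.count σ := fun j _ => (List.take_sublist _ _).count_le σ
  refine ⟨fun j => q j - j * m - 1, ⟨fun i j hij hj => ?_, fun j hj => ?_⟩, ?_⟩
  · obtain ⟨d, rfl⟩ := Nat.exists_eq_add_of_le hij
    have h₃ := hlow d i hj
    have h₄ := hlow' i (by omega)
    have h₅ := hlow' (i + d) hj
    simp only [Nat.add_mul] at h₅ ⊢
    omega
  · have h₃ := hlow (k - 1 - j) j (by omega)
    rw [show j + (k - 1 - j) = k - 1 by omega] at h₃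
    have h₄ := hlow' j hj
    have h₅ : k * m = j * m + (k - 1 - j) * m + m := by
      rw [← Nat.add_mul, ← Nat.succ_mul]
      congr 1
      omega
    simp only
    omega
  · have hcut : ∀ j, j < k → cuts S pos k m (fun j => q j - j * m - 1) (j + 1) = P j := by
      intro j hj
      have h₃ := hlow' j hj
      simp only [cuts, Nat.add_sub_cancel, Nat.succ_ne_zero, if_false, Nat.succ_le_of_lt hj, if_true]
      rw [show j * m + (q j - j * m - 1) + 1 = q j by omega]
      have h₄ := hpos.2 (q j) (by omega) (hle j hj)
      exact h₄.1.eq_of_count (hatP j hj) h₄.2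
    refine ⟨?_, fun j hj hjk => ?_, ?_⟩
    · rw [hcut 0 hk, hP₀]
      exact h₁.mono_right (by omega)
    · obtain ⟨j, rfl⟩ : ∃ i, j = i + 1 := ⟨j - 1, by omega⟩
      rw [hcut j (by omega), hcut (j + 1) hjk]
      exact (hP j (by omega)).1
    · have := hcut (k - 1) (by omega)
      rw [show k - 1 + 1 = k by omega] at this
      rwa [this]

theorem cuts_lt {σ k D m : ℕ} {pos r : ℕ → ℕ} (hpos : IsOccTable S σ pos)
    (hr : IsTuple k D r) (hm : 1 ≤ m) (hD : k * m + D ≤ S.count σ) {j : ℕ} (hj : j ≤ k) :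
    cuts S pos k m r j < cuts S pos k m r (j + 1) ∧
      (1 ≤ j → At S (cuts S pos k m r j) σ) := by
  have hb : ∀ i < k, i * m + r i + 1 ≤ S.count σ := by
    intro i hi
    have h₁ := hr.2 i hi
    have h₂ : (i + 1) * m ≤ k * m := Nat.mul_le_mul_right m hi
    rw [Nat.add_mul] at h₂
    omega
  have hat : 1 ≤ j → At S (cuts S pos k m r j) σ := by
    intro hj1
    simp only [cuts, show j ≠ 0 by omega, hj, if_false, if_true]
    exact (hpos.2 _ (by omega) (hb (j - 1) (by omega))).1
  refine ⟨?_, hat⟩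
  rcases (show j = k ∨ j < k by omega) with rfl | hjk
  · have h₀ : cuts S pos j m r (j + 1) = S.length + 1 := by simp [cuts]
    rw [h₀]
    rcases Nat.eq_zero_or_pos j with rfl | hj0
    · simp [cuts]
    · exact Nat.lt_succ_of_le (hat hj0).le
  · have h₀ : cuts S pos k m r (j + 1) = pos (j * m + r j + 1) := by
      simp [cuts, Nat.succ_le_of_lt hjk]
    rw [h₀]
    rcases Nat.eq_zero_or_pos j with rfl | hj0
    · have := hpos.lt (q := 0) (q' := 0 * m + r 0 + 1) (by omega) (hb 0 hjk)
      rwa [hpos.1] at this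
    · obtain ⟨j, rfl⟩ : ∃ i, j = i + 1 := ⟨j - 1, by omega⟩
      simp only [cuts, Nat.succ_ne_zero, if_false, hj, if_true, Nat.add_sub_cancel]
      refine hpos.lt ?_ (hb _ hjk)
      have := hr.1 j (j + 1) (by omega) hjk
      rw [Nat.add_mul]
      omega

/-! ### From inextensible pairs to maximal strings -/

theorem count_mul_le_of_power_sublist {X : List ℕ} {k : ℕ}
    (h : (List.replicate k X).flatten.Sublist S) (c : ℕ) : k * X.count c ≤ S.count c := by
  have := h.count_le c
  simpa [List.count_flatten] using this

theorem isKRepeating_of_power {X : List ℕ} {k : ℕ} (hk : 1 ≤ k)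
    (h : (List.replicate k X).flatten.Sublist S) : IsKRepeating k S X := by
  refine ⟨List.Sublist.trans ?_ h, h⟩
  rw [show k = (k - 1) + 1 by omega, List.replicate_succ, List.flatten_cons]
  exact List.sublist_append_left _ _

/-- A string with the maximal number of copies of `σ` that cannot be extended for any choice of
cuts is maximal. -/
theorem isMaximalKRepeating {σ k : ℕ} {pos : ℕ → ℕ} {H T : List ℕ} (hk : 1 ≤ k)
    (hpos : IsOccTable S σ pos) (hcount : k ≤ S.count σ)
    (hT : (List.replicate (S.count σ / k - 1) σ).Sublist T)
    (hX : (List.replicate k (H ++ σ :: T)).flatten.Sublist S)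
    (hmax : ∀ r, IsTuple k (S.count σ % k) r →
      Inextensible S k (cuts S pos k (S.count σ / k) r) H T) :
    IsMaximalKRepeating k S (H ++ σ :: T) := by
  have hm : 1 ≤ S.count σ / k := Nat.div_pos hcount (by omega)
  have hTc : S.count σ / k - 1 ≤ T.count σ := by simpa using hT.count_le σ
  refine ⟨isKRepeating_of_power hk hX, fun Y hXY hne hY => hne ?_⟩
  have hYc : Y.count σ ≤ S.count σ / k :=
    (Nat.le_div_iff_mul_le (by omega)).2 (by
      rw [Nat.mul_comm]; exact count_mul_le_of_power_sublist hY.2 σ)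
  have hXc := hXY.count_le σ
  simp only [List.count_append, List.count_cons_self] at hXc
  -- All `m` copies that `Y` may contain are already used by the middle `σ` and by `T`.
  have hH0 : σ ∉ H := List.count_eq_zero.1 (by omega)
  obtain ⟨l₁, l₂, rfl, hs₁, hs₂⟩ := List.append_sublist_iff.1 hXY
  have hc₂ := hs₂.count_le σ
  simp only [List.count_append, List.count_cons_self] at hc₂ hYc
  have hl₁ : σ ∉ l₁ := List.count_eq_zero.1 (by omega)
  obtain ⟨l₃, l₄, rfl, hσ₃, hs₃⟩ := List.cons_sublist_iff.1 hs₂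
  -- `Y` must be split at its first `σ`, which lies in `l₃` because `l₁` has none; then `H` embeds
  -- before it and `T` after it.
  obtain ⟨u, v, rfl, hu⟩ := List.eq_append_cons_of_mem hσ₃
  have hc₃ := hs₃.count_le σ
  simp only [List.count_append, List.count_cons_self] at hYc
  have hu0 : u.count σ = 0 := List.count_eq_zero.2 hu
  have heq : l₁ ++ (u ++ σ :: v ++ l₄) = (l₁ ++ u) ++ σ :: (v ++ l₄) := by simp
  rw [heq] at hY ⊢
  obtain ⟨r, hr, hv⟩ := exists_valid (pos := pos) (m := S.count σ / k) hk hpos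
    (by simp [hl₁, hu]) (by simp only [List.count_append]; omega) hY.2
  have hD : S.count σ - k * (S.count σ / k) = S.count σ % k := by
    have := Nat.div_add_mod (S.count σ) k
    omega
  obtain ⟨h₁, h₂⟩ := hmax r (hD ▸ hr) _ _ (hs₁.trans (List.sublist_append_left _ _))
    (hs₃.trans (List.sublist_append_right _ _)) hv
  rw [h₁, h₂]

theorem isMaximalKRepeating_nil {k : ℕ} (h : ∀ c, S.count c < k) :
    IsMaximalKRepeating k S [] := by
  refine ⟨⟨List.nil_sublist _, by simp⟩, fun Y _ hne hY => ?_⟩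
  obtain ⟨c, Y', rfl⟩ := List.exists_cons_of_ne_nil hne
  have h₁ := count_mul_le_of_power_sublist hY.2 c
  have h₂ := h c
  have h₃ : k * 1 ≤ k * (c :: Y').count c := Nat.mul_le_mul_left k (by simp)
  omega

theorem replicate_power_sublist (σ k : ℕ) :
    (List.replicate k (List.replicate (S.count σ / k) σ)).flatten.Sublist S := by
  rw [List.flatten_replicate_replicate]
  exact List.replicate_sublist_iff.2 (Nat.mul_div_le _ _)

end

namespace WordRAM

/-! ### Notation for programs -/

infixl:65 " +ₑ " => Expr.bin BinOp.add
infixl:65 " -ₑ " => Expr.bin BinOp.sub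
infixl:70 " *ₑ " => Expr.bin BinOp.mul
infixl:70 " /ₑ " => Expr.bin BinOp.div
infix:50 " <ₑ " => Expr.bin BinOp.lt
infix:50 " =ₑ " => Expr.bin BinOp.eq
infixr:30 " ;; " => Cmd.seq

notation "vN" => (0 : ℕ)
notation "vK" => (1 : ℕ)
notation "vK1" => (2 : ℕ)
notation "vW" => (3 : ℕ)
notation "vC" => (4 : ℕ)
notation "vR" => (5 : ℕ)
notation "vId" => (6 : ℕ)
notation "vBase" => (7 : ℕ)
notation "vLo" => (8 : ℕ)
notation "vHi" => (9 : ℕ)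
notation "vMid" => (10 : ℕ)
notation "vRes" => (11 : ℕ)
notation "vI" => (12 : ℕ)
notation "vFail" => (13 : ℕ)
notation "vJ" => (14 : ℕ)
notation "vD" => (15 : ℕ)
notation "vX" => (16 : ℕ)
notation "vGo" => (17 : ℕ)
notation "vQ" => (18 : ℕ)
notation "vJJ" => (19 : ℕ)
notation "vE" => (20 : ℕ)
notation "vHl" => (21 : ℕ)
notation "vTl" => (22 : ℕ)
notation "vSig" => (23 : ℕ)
notation "vFound" => (24 : ℕ)
notation "vM" => (25 : ℕ)
notation "vMore" => (27 : ℕ)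
notation "vZ" => (28 : ℕ)
notation "vT" => (29 : ℕ)
notation "vP" => (30 : ℕ)

notation "aS" => (0 : ℕ)
notation "aOut" => (1 : ℕ)
notation "aF" => (2 : ℕ)
notation "aCn" => (3 : ℕ)
notation "aOc" => (4 : ℕ)
notation "aR" => (5 : ℕ)
notation "aL" => (6 : ℕ)
notation "aH" => (7 : ℕ)
notation "aT" => (8 : ℕ)
notation "aP" => (9 : ℕ)
notation "aTup" => (10 : ℕ)

/-! ### Preprocessed input and predecessor search -/

/-- The memory holds the input and the table of occurrences: `aF c` is a number for the letter
`c`, `aCn` counts the occurrences of each letter, and row `aF c` of `aOc` (rows have length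
`|S| + 2`) lists the positions of `c`. -/
structure Env (S : List ℕ) (k : ℕ) (s : Memory) : Prop where
  len : s.var vN = S.length
  pow : s.var vK = k
  width : s.var vW = S.length + 2
  str : s.arr aS = fun i => S.getD i 0
  num_le : ∀ c, s.arr aF c ≤ S.length
  count : ∀ c, s.arr aCn (s.arr aF c) = S.count c
  table : ∀ c, IsOccTable S c fun q => s.arr aOc (s.arr aF c * (S.length + 2) + q)

theorem Env.frame {S : List ℕ} {k : ℕ} {s s' : Memory} (h : Env S k s)
    (hv : s'.var vN = s.var vN ∧ s'.var vK = s.var vK ∧ s'.var vW = s.var vW)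
    (ha : s'.arr aS = s.arr aS ∧ s'.arr aF = s.arr aF ∧ s'.arr aCn = s.arr aCn ∧
      s'.arr aOc = s.arr aOc) : Env S k s' := by
  obtain ⟨h₁, h₂, h₃⟩ := hv
  obtain ⟨h₄, h₅, h₆, h₇⟩ := ha
  constructor
  · rw [h₁, h.len]
  · rw [h₂, h.pow]
  · rw [h₃, h.width]
  · rw [h₄, h.str]
  · rw [h₅]; exact h.num_le
  · rw [h₅, h₆]; exact h.count
  · rw [h₅, h₇]; exact h.table

/-- Two-dimensional tables are stored row by row with row length `n + 2`. Their indices must be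
words, which is why the word length is assumed to be at least `2 * log₂ (n + 2)`. -/
theorem index_lt {n w i d : ℕ} (hw : (n + 2) * (n + 2) ≤ 2 ^ w) (hi : i ≤ n) (hd : d ≤ n + 1) :
    i * (n + 2) + d < 2 ^ w := by
  have h₁ : i * (n + 2) ≤ n * (n + 2) := Nat.mul_le_mul_right _ hi
  have h₂ : (n + 2) * (n + 2) = n * (n + 2) + (2 * n + 4) := by ring
  omega

theorem small_lt {n w i : ℕ} (hw : (n + 2) * (n + 2) ≤ 2 ^ w) (hi : i ≤ 2 * n + 3) :
    i < 2 ^ w := by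
  have h₂ : (n + 2) * (n + 2) = n * (n + 2) + (2 * n + 4) := by ring
  omega

theorem test_eq_zero {w : ℕ} (h : 1 < 2 ^ w) (p : Prop) [Decidable p] :
    (if p then 1 else 0) % 2 ^ w = 0 ↔ ¬ p := by
  split_ifs with hp <;> simp [hp, Nat.mod_eq_of_lt h]

/-- The bound on the number of rounds of a binary search. -/
def lg (n : ℕ) : ℕ := Nat.clog 2 (n + 1) + 1

/-- Binary search for the last occurrence of the letter `vC` before position `vR`. -/
def findLast : Cmd :=
  .assign vId (.load aF (.var vC)) ;;
  .assign vBase (.var vId *ₑ .var vW) ;;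
  .assign vLo (.const 0) ;;
  .assign vHi (.load aCn (.var vId) +ₑ .const 1) ;;
  .loop (.const 1 <ₑ (.var vHi -ₑ .var vLo))
    (.assign vMid ((.var vLo +ₑ .var vHi) /ₑ .const 2) ;;
     .cond (.load aOc (.var vBase +ₑ .var vMid) <ₑ .var vR)
       (.assign vLo (.var vMid)) (.assign vHi (.var vMid))) ;;
  .assign vRes (.load aOc (.var vBase +ₑ .var vLo))

/-- Either part of a bisected gap has at most half its length, rounded up, so `Nat.clog` of the gap
pays for one round of the binary search. -/
theorem clog_half {g h : ℕ} (hg : 1 < g) (h2 : 2 * h ≤ g + 1) :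
    Nat.clog 2 h + 1 ≤ Nat.clog 2 g := by
  rw [Nat.clog_of_two_le (by omega) hg]
  exact Nat.succ_le_succ (Nat.clog_mono_right 2 (by omega))

/-- Besides the position, its index in the occurrence table is returned in `vLo`: `advance` finds
the next occurrence one entry further. -/
theorem runs_findLast {S : List ℕ} {k w : ℕ} {s : Memory}
    (hw : (S.length + 2) * (S.length + 2) ≤ 2 ^ w) (he : Env S k s) :
    Runs w findLast s fun t s' =>
      s'.var vRes = lastBefore S (s.var vC) (s.var vR) ∧
      s'.var vBase = s.arr aF (s.var vC) * (S.length + 2) ∧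
      s'.var vLo ≤ S.count (s.var vC) ∧
      s.arr aOc (s.arr aF (s.var vC) * (S.length + 2) + s'.var vLo) =
        lastBefore S (s.var vC) (s.var vR) ∧
      (∀ q, s'.var vLo < q → q ≤ S.count (s.var vC) →
        s.var vR ≤ s.arr aOc (s.arr aF (s.var vC) * (S.length + 2) + q)) ∧
      t ≤ 50 * lg S.length := by
  set c := s.var vC with hc
  set R := s.var vR with hR
  set pos : ℕ → ℕ := fun q => s.arr aOc (s.arr aF c * (S.length + 2) + q) with hpos
  have htab : IsOccTable S c pos := he.table c
  have hcnt : S.count c ≤ S.length := List.count_le_length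
  have hidx : ∀ d, d ≤ S.length + 1 → s.arr aF c * (S.length + 2) + d < 2 ^ w :=
    fun d hd => index_lt hw (he.num_le c) hd
  have hb : s.arr aF c * (S.length + 2) < 2 ^ w := hidx 0 (by omega)
  have hit := fun p [Decidable p] => test_eq_zero (small_lt (i := 1) hw (by omega)) p
  have hone : 1 % 2 ^ w = 1 := Nat.mod_eq_of_lt (small_lt hw (by omega))
  have htwo : 2 % 2 ^ w = 2 := Nat.mod_eq_of_lt (small_lt hw (by omega))
  unfold findLast
  refine runs_seq (runs_assign (runs_seq (runs_assign (runs_seq (runs_assign (runs_seq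
    (runs_assign ?_)))))))
  have hcnt' : (S.count c + 1) % 2 ^ w = S.count c + 1 :=
    Nat.mod_eq_of_lt (small_lt hw (by omega))
  simp [Expr.eval, BinOp.eval, Expr.cost, he.width, he.count, ← hc, Nat.mod_eq_of_lt hb, hone,
    hcnt']
  -- Entry `vLo` is the sentinel or lies before `R`, and all entries from `vHi` on lie at or after
  -- `R`.
  refine runs_seq ((runs_loop
    (fun s' => s'.var vLo < s'.var vHi ∧ s'.var vHi ≤ S.count c + 1 ∧
      (s'.var vLo = 0 ∨ pos (s'.var vLo) < R) ∧
      ∀ q, s'.var vHi ≤ q → q ≤ S.count c → R ≤ pos q)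
    (fun s' => 25 * Nat.clog 2 (s'.var vHi - s'.var vLo)) ?_ ?_).mono ?_)
  · simp
    intro q h₁ h₂
    omega
  · rintro s' hf ⟨h₁, h₂, h₃, h₄⟩ hgt
    have fb := hf.var vBase rfl
    have fR := hf.var vR rfl
    have fa := hf.arr aOc rfl
    simp at fb fR fa
    have hm₁ : (s'.var vHi - s'.var vLo) % 2 ^ w = s'.var vHi - s'.var vLo :=
      Nat.mod_eq_of_lt (small_lt hw (by omega))
    simp only [Expr.eval, BinOp.eval, hm₁, hone, ne_eq, hit, not_not] at hgt
    have hgap : 1 < s'.var vHi - s'.var vLo := hgt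
    have hm₂ : (s'.var vLo + s'.var vHi) % 2 ^ w = s'.var vLo + s'.var vHi :=
      Nat.mod_eq_of_lt (small_lt hw (by omega))
    have hm₃ : (s'.var vLo + s'.var vHi) / 2 % 2 ^ w = (s'.var vLo + s'.var vHi) / 2 :=
      Nat.mod_eq_of_lt (small_lt hw (by omega))
    set mid := (s'.var vLo + s'.var vHi) / 2 with hmid
    have hlow : Nat.clog 2 (s'.var vHi - mid) + 1 ≤ Nat.clog 2 (s'.var vHi - s'.var vLo) :=
      clog_half hgap (by omega)
    have hhigh : Nat.clog 2 (mid - s'.var vLo) + 1 ≤ Nat.clog 2 (s'.var vHi - s'.var vLo) :=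
      clog_half hgap (by omega)
    have hev : s'.arr aOc (s'.var vBase + mid) = pos mid := by rw [fb, fa]
    have hm₄ := Nat.mod_eq_of_lt (hidx mid (by omega))
    refine runs_seq (runs_assign (runs_cond (fun hlt => runs_assign ?_)
      (fun hlt => runs_assign ?_)))
    · simp [Expr.eval, BinOp.eval, htwo, hm₂, hm₃, fb, fR, fa, hm₄, ← hmid, hit] at hlt
      simp [Expr.eval, BinOp.eval, htwo, hm₂, hm₃, ← hmid, Expr.cost]
      refine ⟨⟨by omega, h₂, .inr ?_, h₄⟩, by omega, by omega⟩
      exact hlt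
    · simp [Expr.eval, BinOp.eval, htwo, hm₂, hm₃, fb, fR, fa, hm₄, ← hmid, hit] at hlt
      simp [Expr.eval, BinOp.eval, htwo, hm₂, hm₃, ← hmid, Expr.cost]
      refine ⟨⟨by omega, by omega, h₃, fun q hq hqc => ?_⟩, by omega, by omega⟩
      rcases Nat.eq_or_lt_of_le hq with rfl | hq
      · exact hlt
      · exact hlt.trans (htab.lt hq hqc).le
  · rintro t s' hf ⟨⟨h₁, h₂, h₃, h₄⟩, hend, ht⟩
    have fb := hf.var vBase rfl
    have fa := hf.arr aOc rfl
    simp at fb fa ht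
    have hm₁ : (s'.var vHi - s'.var vLo) % 2 ^ w = s'.var vHi - s'.var vLo :=
      Nat.mod_eq_of_lt (small_lt hw (by omega))
    simp only [Expr.eval, BinOp.eval, hm₁, hone, hit] at hend
    have hm₂ := Nat.mod_eq_of_lt (hidx (s'.var vLo) (by omega))
    refine runs_assign ?_
    simp [Expr.eval, BinOp.eval, fb, fa, hm₂, Expr.cost]
    have hres : pos (s'.var vLo) = lastBefore S c R := by
      refine (lastBefore_eq ?_ ?_).symm
      · rcases Nat.eq_zero_or_pos (s'.var vLo) with h0 | h0
        · rw [h0]; exact .inl htab.1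
        · exact .inr ⟨(htab.2 _ h0 (by omega)).1, h₃.resolve_left (by omega)⟩
      · intro p hp hpR hat
        set q := (S.take p).count c with hq
        have hq1 : q ≤ S.count c := (List.take_sublist _ _).count_le c
        have hq0 : 1 ≤ q := by have := hat.count_take; omega
        have hpq : pos q = p := (htab.2 q hq0 hq1).1.eq_of_count hat (htab.2 q hq0 hq1).2
        have hlt : ¬ s'.var vHi ≤ q := fun hh => by
          have := h₄ q hh hq1
          omega
        rcases Nat.lt_or_ge q (s'.var vLo) with hlt' | hge
        · have := htab.lt hlt' (by omega)
          omega
        · have : q = s'.var vLo := by omega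
          rw [← this] at hp
          omega
    refine ⟨hres, by omega, hres, fun q hq hqc => h₄ q (by omega) hqc, ?_⟩
    have : Nat.clog 2 (S.count c + 1) ≤ Nat.clog 2 (S.length + 1) :=
      Nat.clog_mono_right 2 (by omega)
    simp only [Expr.cost, lg] at ht ⊢
    omega

end WordRAM

namespace WordRAM

/-! ### Extending the stored right-to-left embeddings by a letter -/

/-- The first interval of the pass over the string after (`true`) or before (`false`) the
distinguished letter. -/
def firstIdx : Bool → ℕ
  | true => 1
  | false => 0

/-- The variable holding the end of the range of intervals of a pass. -/
def endVar : Bool → ℕ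
  | true => vK1
  | false => vK

/-- The memory is prepared for the main phase. -/
structure Ctx (S : List ℕ) (k w : ℕ) (s : Memory) : Prop extends Env S k s where
  succ : s.var vK1 = k + 1
  word : (S.length + 2) * (S.length + 2) ≤ 2 ^ w
  pos : 1 ≤ k
  le : k ≤ S.length

/-- The variables and arrays that the main phase must not change. -/
def Cmd.keepsCtx (p : Cmd) : Bool :=
  !(p.writesVar vN || p.writesVar vK || p.writesVar vW || p.writesVar vK1 ||
    p.writesArr aS || p.writesArr aF || p.writesArr aCn || p.writesArr aOc)

theorem Ctx.frame {S : List ℕ} {k w : ℕ} {s s' : Memory} {p : Cmd} (h : Ctx S k w s)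
    (hp : p.keepsCtx = true) (hf : Frame p s s') : Ctx S k w s' := by
  simp only [Cmd.keepsCtx, Bool.not_eq_true', Bool.or_eq_false_iff] at hp
  obtain ⟨⟨⟨⟨⟨⟨⟨h₁, h₂⟩, h₃⟩, h₄⟩, h₅⟩, h₆⟩, h₇⟩, h₈⟩ := hp
  refine ⟨h.toEnv.frame ⟨hf.var _ h₁, hf.var _ h₂, hf.var _ h₃⟩
    ⟨hf.arr _ h₅, hf.arr _ h₆, hf.arr _ h₇, hf.arr _ h₈⟩, ?_, h.word, h.pos, h.le⟩
  rw [hf.var _ h₄, h.succ]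

theorem Ctx.setVar {S : List ℕ} {k w x v : ℕ} {s : Memory} (h : Ctx S k w s) (hx : 4 ≤ x) :
    Ctx S k w (s.setVar x v) := by
  refine ⟨h.toEnv.frame ⟨?_, ?_, ?_⟩ ⟨rfl, rfl, rfl, rfl⟩, ?_, h.word, h.pos, h.le⟩
  · rw [setVar_var, if_neg (by omega)]
  · rw [setVar_var, if_neg (by omega)]
  · rw [setVar_var, if_neg (by omega)]
  · rw [setVar_var, if_neg (by omega), h.succ]

theorem Ctx.setArr {S : List ℕ} {k w a i v : ℕ} {s : Memory} (h : Ctx S k w s)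
    (ha : a = 1 ∨ 5 ≤ a) : Ctx S k w (s.setArr a i v) := by
  refine ⟨h.toEnv.frame ⟨rfl, rfl, rfl⟩ ⟨?_, ?_, ?_, ?_⟩, h.succ, h.word, h.pos, h.le⟩ <;>
    rw [setArr_arr, if_neg (by omega)]

theorem Ctx.endVar {S : List ℕ} {k w : ℕ} {s : Memory} (h : Ctx S k w s) (o : Bool) :
    s.var (endVar o) = firstIdx o + k := by
  cases o
  · simp [WordRAM.endVar, firstIdx, h.pow]
  · simp [WordRAM.endVar, firstIdx, h.succ, Nat.add_comm]

theorem Ctx.one_mod {S : List ℕ} {k w : ℕ} {s : Memory} (h : Ctx S k w s) :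
    1 % 2 ^ w = 1 := Nat.mod_eq_of_lt (small_lt h.word (by omega))

theorem Ctx.small {S : List ℕ} {k w : ℕ} {s : Memory} (h : Ctx S k w s) {i : ℕ}
    (hi : i ≤ 2 * S.length + 3) : i % 2 ^ w = i := Nat.mod_eq_of_lt (small_lt h.word hi)

theorem Ctx.test {S : List ℕ} {k w : ℕ} {s : Memory} (h : Ctx S k w s) (p : Prop)
    [Decidable p] : (if p then 1 else 0) % 2 ^ w = 0 ↔ ¬ p :=
  test_eq_zero (small_lt h.word (by omega)) p

/-- The index in array `aR` of entry `t` of the stack of interval `i`. -/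
def cell (S : List ℕ) (i t : ℕ) : ℕ := i * (S.length + 2) + t

theorem cell_inj {S : List ℕ} {i i' t t' : ℕ} (ht : t ≤ S.length + 1) (ht' : t' ≤ S.length + 1) :
    cell S i t = cell S i' t' ↔ i = i' ∧ t = t' := by
  constructor
  · intro h
    unfold cell at h
    have h₁ := congrArg (· % (S.length + 2)) h
    have h₂ := congrArg (· / (S.length + 2)) h
    simp only [Nat.mul_add_mod_self_right, Nat.mod_eq_of_lt (show t < S.length + 2 by omega),
      Nat.mod_eq_of_lt (show t' < S.length + 2 by omega)] at h₁
    subst h₁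
    refine ⟨?_, rfl⟩
    have h₃ : i * (S.length + 2) = i' * (S.length + 2) := by omega
    exact Nat.eq_of_mul_eq_mul_right (by omega) h₃
  · rintro ⟨rfl, rfl⟩; rfl

theorem Ctx.cell_lt {S : List ℕ} {k w : ℕ} {s : Memory} (h : Ctx S k w s) {i t : ℕ}
    (hi : i ≤ k) (ht : t ≤ S.length + 1) : cell S i t < 2 ^ w :=
  index_lt h.word (hi.trans h.le) ht

/-- The expression for the index of the stack entry of interval `x` at depth `e`. -/
def cellExpr (x e : Expr) : Expr := x *ₑ .var vW +ₑ e

theorem Ctx.cellExpr_eval {S : List ℕ} {k w : ℕ} {s : Memory} (h : Ctx S k w s) {x e : Expr}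
    (hi : x.eval w s ≤ k) (ht : e.eval w s ≤ S.length + 1) :
    (cellExpr x e).eval w s = cell S (x.eval w s) (e.eval w s) := by
  have h₁ := h.cell_lt hi ht
  have h₂ := h.cell_lt (t := 0) hi (by omega)
  simp only [cell, Nat.add_zero] at h₁ h₂
  simp [cellExpr, Expr.eval, BinOp.eval, h.width, cell, Nat.mod_eq_of_lt h₁, Nat.mod_eq_of_lt h₂]

/-- The stacks in memory hold the rightmost embeddings of the suffixes of `B` that end before
`e i`, `i ∈ I`. -/
structure Stack (S : List ℕ) (I : Finset ℕ) (e : ℕ → ℕ) (B : List ℕ) (s : Memory) : Prop where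
  depth : s.var vD = B.length
  entry : ∀ i ∈ I, ∀ t ≤ B.length,
    s.arr aR (cell S i t) = rightmost S (e i) (B.drop (B.length - t))

theorem Stack.top {S : List ℕ} {I : Finset ℕ} {e : ℕ → ℕ} {B : List ℕ} {s : Memory}
    (h : Stack S I e B s) {i : ℕ} (hi : i ∈ I) :
    s.arr aR (cell S i B.length) = rightmost S (e i) B := by
  simpa using h.entry i hi B.length le_rfl

/-- The range of intervals of a pass. -/
def range (o : Bool) (k : ℕ) : Finset ℕ := Finset.Ico (firstIdx o) (firstIdx o + k)

theorem mem_range {o : Bool} {k i : ℕ} :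
    i ∈ range o k ↔ firstIdx o ≤ i ∧ i < firstIdx o + k := Finset.mem_Ico

theorem le_of_mem_range {o : Bool} {k i : ℕ} (h : i ∈ range o k) : i ≤ k := by
  have := (mem_range.1 h).2
  cases o <;> simp [firstIdx] at this <;> omega

/-- Push the letter `vC` onto all stacks if it occurs in all current windows; otherwise set
`vFail` to `1` and `vJ` to an interval without an occurrence. -/
def tryPush (o : Bool) : Cmd :=
  .assign vFail (.const 0) ;;
  .for vI (firstIdx o) (endVar o)
    (.assign vR (.load aR (cellExpr (.var vI) (.var vD))) ;;
     findLast ;;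
     .store aR (cellExpr (.var vI) (.var vD +ₑ .const 1)) (.var vRes) ;;
     .cond (.load aL (.var vI) <ₑ .var vRes) .skip
       (.assign vFail (.const 1) ;; .assign vJ (.var vI))) ;;
  .cond (.var vFail) .skip (.assign vD (.var vD +ₑ .const 1))

theorem one_le_lg (n : ℕ) : 1 ≤ lg n := Nat.le_add_left _ _

/-- The candidate entries are written just above the tops of the stacks in any case. They count only
once the depth is raised, so a failed attempt needs no undoing. -/
theorem runs_tryPush_aux {S : List ℕ} {k w : ℕ} {s : Memory} (h : Ctx S k w s) (o : Bool)
    (hd : s.var vD ≤ S.length) :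
    Runs w (tryPush o) s fun t s' =>
      (∀ i ∈ range o k, s'.arr aR (cell S i (s.var vD + 1)) =
        lastBefore S (s.var vC) (s.arr aR (cell S i (s.var vD)))) ∧
      (∀ i t, t ≤ S.length + 1 → (i ∈ range o k → t ≠ s.var vD + 1) →
        s'.arr aR (cell S i t) = s.arr aR (cell S i t)) ∧
      ((s'.var vFail = 0 ∧ s'.var vD = s.var vD + 1 ∧ ∀ i ∈ range o k,
          s.arr aL i < lastBefore S (s.var vC) (s.arr aR (cell S i (s.var vD)))) ∨
        (s'.var vFail = 1 ∧ s'.var vD = s.var vD ∧ s'.var vJ ∈ range o k ∧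
          ¬ s.arr aL (s'.var vJ) <
            lastBefore S (s.var vC) (s.arr aR (cell S (s'.var vJ) (s.var vD))))) ∧
      t ≤ 120 * (k * lg S.length) := by
  set d := s.var vD with hd'
  set c := s.var vC with hc
  have hlen := h.le
  have h1 := h.one_mod
  unfold tryPush
  refine runs_seq (runs_assign (runs_seq ((runs_for (fun i s' =>
      (∀ j, firstIdx o ≤ j → j < i → s'.arr aR (cell S j (d + 1)) =
        lastBefore S c (s.arr aR (cell S j d))) ∧
      (∀ j t, t ≤ S.length + 1 → ((firstIdx o ≤ j ∧ j < i) → t ≠ d + 1) →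
        s'.arr aR (cell S j t) = s.arr aR (cell S j t)) ∧
      ((s'.var vFail = 0 ∧ ∀ j, firstIdx o ≤ j → j < i →
          s.arr aL j < lastBefore S c (s.arr aR (cell S j d))) ∨
        (s'.var vFail = 1 ∧ (firstIdx o ≤ s'.var vJ ∧ s'.var vJ < i) ∧
          ¬ s.arr aL (s'.var vJ) < lastBefore S c (s.arr aR (cell S (s'.var vJ) d)))))
      (50 * lg S.length + 25) rfl (by cases o <;> rfl) (by cases o <;> decide) ?_ ?_ ?_ ?_).mono ?_)))
  · rw [setVar_var, if_neg (by cases o <;> decide), h.endVar]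
    omega
  · rw [setVar_var, if_neg (by cases o <;> decide), h.endVar]
    exact small_lt h.word (by cases o <;> simp [firstIdx] <;> omega)
  · exact ⟨fun j h₁ h₂ => by omega, fun j t _ _ => rfl,
      .inl ⟨by simp [Expr.eval], fun j h₁ h₂ => by omega⟩⟩
  · rw [setVar_var, if_neg (by cases o <;> decide), h.endVar]
    rintro i s' hi hik hxi hf ⟨i₁, i₂, i₃⟩
    have hik' : i ≤ k := le_of_mem_range (mem_range.2 ⟨hi, hik⟩)
    have hctx : Ctx S k w s' := (h.setVar (by omega)).frame rfl hf
    have fC := hf.var vC rfl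
    have fD := hf.var vD rfl
    have fL := hf.arr aL rfl
    simp [← hc, ← hd'] at fC fD fL
    refine runs_seq (runs_assign (runs_seq ?_))
    rw [Expr.eval, hctx.cellExpr_eval (by simp [Expr.eval]; omega) (by simp [Expr.eval, fD]; omega)]
    simp only [Expr.eval, hxi, fD]
    have hctx₂ : Ctx S k w (s'.setVar vR (s'.arr aR (cell S i d))) :=
      hctx.setVar (by omega)
    refine (runs_findLast h.word hctx₂.toEnv).mono ?_
    rintro t s'' hf'' ⟨hres, -, -, -, -, ht⟩
    have hctx₃ := hctx₂.frame rfl hf''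
    have gI := hf''.var vI rfl
    have gD := hf''.var vD rfl
    have gF := hf''.var vFail rfl
    have gJ := hf''.var vJ rfl
    have gL := hf''.arr aL rfl
    have gR := hf''.arr aR rfl
    simp [hxi, fD, fL] at gI gD gF gJ gL gR
    simp [fC] at hres
    rw [i₂ i d (by omega) (by omega)] at hres
    have hd1 := hctx.small (i := d + 1) (by omega)
    have hev1 : (Expr.var vD +ₑ Expr.const 1).eval w s'' = d + 1 := by
      simp [Expr.eval, BinOp.eval, gD, h1, hd1]
    refine runs_seq (runs_store ?_)
    rw [hctx₃.cellExpr_eval (by simp [Expr.eval]; omega) (by rw [hev1]; omega), hev1]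
    simp only [Expr.eval, gI]
    have hcost : (cellExpr (.var vI) (Expr.var vD +ₑ Expr.const 1)).cost = 7 := rfl
    have hcost' : (cellExpr (.var vI) (Expr.var vD)).cost = 5 := rfl
    have new₁ : ∀ j, firstIdx o ≤ j → j < i + 1 →
        Function.update (s''.arr aR) (cell S i (d + 1)) (s''.var vRes) (cell S j (d + 1)) =
          lastBefore S c (s.arr aR (cell S j d)) := by
      intro j hj hji
      by_cases hij : j = i
      · subst hij
        rw [Function.update_self, hres]
      · rw [Function.update_of_ne
          (by rw [Ne, cell_inj (by omega) (by omega)]; exact fun h => hij h.1), gR]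
        exact i₁ j hj (by omega)
    have new₂ : ∀ j t, t ≤ S.length + 1 → ((firstIdx o ≤ j ∧ j < i + 1) → t ≠ d + 1) →
        Function.update (s''.arr aR) (cell S i (d + 1)) (s''.var vRes) (cell S j t) =
          s.arr aR (cell S j t) := by
      intro j t htn hjt
      rw [Function.update_of_ne, gR]
      · exact i₂ j t htn fun hj => hjt ⟨hj.1, by omega⟩
      · rw [Ne, cell_inj (by omega) (by omega)]
        rintro ⟨rfl, rfl⟩
        exact hjt ⟨hi, by omega⟩ rfl
    refine runs_cond (fun hlt => runs_skip ?_) (fun hlt => runs_seq (runs_assign (runs_assign ?_)))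
    · simp [Expr.eval, BinOp.eval, gI, gL, hres, h.test] at hlt
      simp only [setVar_var, setVar_arr, setArr_var, setArr_arr, if_true, gF, gJ]
      refine ⟨⟨?_, ?_, ?_⟩, ?_⟩
      · simpa using new₁
      · simpa using new₂
      · simp
        rcases i₃ with ⟨e₁, e₂⟩ | ⟨e₁, e₂, e₃⟩
        · refine .inl ⟨e₁, fun j hj hji => ?_⟩
          rcases Nat.lt_or_eq_of_le hji with hji | rfl
          exacts [e₂ j hj hji, hlt]
        · exact .inr ⟨e₁, ⟨e₂.1, by omega⟩, not_lt.1 e₃⟩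
      · simp [Expr.cost, hcost, hcost']
        omega
    · simp [Expr.eval, BinOp.eval, gI, gL, hres, h.test] at hlt
      simp only [Expr.eval, h1, setVar_var, setVar_arr, setArr_var, setArr_arr, if_true, gI]
      refine ⟨⟨?_, ?_, ?_⟩, ?_⟩
      · simpa using new₁
      · simpa using new₂
      · simp
        exact ⟨hi, hlt⟩
      · simp [Expr.cost, hcost, hcost']
        omega
  · rw [setVar_var, if_neg (by cases o <;> decide), h.endVar]
    rintro t s' hf ⟨⟨i₁, i₂, i₃⟩, ht⟩
    have fD := hf.var vD rfl
    simp [← hd'] at fD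
    have hd1 := h.small (i := d + 1) (by omega)
    have ht' : t ≤ 83 * (k * lg S.length) + 6 := by
      have e₁ : k * (50 * lg S.length + 25 + 8) = 50 * (k * lg S.length) + 33 * k := by ring
      have e₂ : k ≤ k * lg S.length := Nat.le_mul_of_pos_right _ (one_le_lg _)
      rw [Nat.add_sub_cancel_left, e₁] at ht
      omega
    have hkl : 1 ≤ k * lg S.length := Nat.mul_pos h.pos (one_le_lg _)
    refine runs_cond (fun hne => runs_skip ?_) (fun heq => runs_assign ?_)
    · simp only [Expr.eval] at hne
      refine ⟨fun i hi => ?_, fun i t ht hit => ?_, .inr ?_, by simp [Expr.cost]; omega⟩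
      · rw [mem_range] at hi
        exact i₁ i hi.1 hi.2
      · exact i₂ i t ht fun hi => hit (mem_range.2 hi)
      · rcases i₃ with ⟨e₁, e₂⟩ | ⟨e₁, e₂, e₃⟩
        · exact absurd e₁ hne
        · exact ⟨e₁, fD, mem_range.2 e₂, e₃⟩
    · simp only [Expr.eval] at heq
      simp only [Expr.eval, BinOp.eval, h1, fD, hd1, setVar_var, setVar_arr]
      refine ⟨fun i hi => ?_, fun i t ht hit => ?_, .inl ?_, by simp [Expr.cost]; omega⟩
      · rw [mem_range] at hi
        exact i₁ i hi.1 hi.2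
      · exact i₂ i t ht fun hi => hit (mem_range.2 hi)
      · rcases i₃ with ⟨e₁, e₂⟩ | ⟨e₁, e₂, e₃⟩
        · refine ⟨by simpa using e₁, by simp, fun i hi => ?_⟩
          rw [mem_range] at hi
          exact e₂ i hi.1 hi.2
        · omega

theorem runs_tryPush {S : List ℕ} {k w : ℕ} {s : Memory} (h : Ctx S k w s) (o : Bool)
    {e : ℕ → ℕ} {B : List ℕ} (hB : Stack S (range o k) e B s) (hlen : B.length ≤ S.length) :
    Runs w (tryPush o) s fun t s' =>
      ((s'.var vFail = 0 ∧ Stack S (range o k) e (s.var vC :: B) s' ∧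
          ∀ i ∈ range o k, Emb S (s.var vC :: B) (s.arr aL i) (e i)) ∨
        (s'.var vFail = 1 ∧ Stack S (range o k) e B s' ∧ s'.var vJ ∈ range o k ∧
          ¬ Emb S (s.var vC :: B) (s.arr aL (s'.var vJ)) (e (s'.var vJ)))) ∧
      (∀ i ∉ range o k, ∀ t ≤ S.length + 1,
        s'.arr aR (cell S i t) = s.arr aR (cell S i t)) ∧
      t ≤ 120 * (k * lg S.length) := by
  have hd := hB.depth
  refine (runs_tryPush_aux h o (by omega)).mono ?_
  rintro t s' hf ⟨h₁, h₂, h₃, ht⟩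
  rw [hd] at h₁ h₂ h₃
  have hold : ∀ i, ∀ t ≤ B.length, s'.arr aR (cell S i t) = s.arr aR (cell S i t) :=
    fun i t ht => h₂ i t (by omega) fun _ => by omega
  have htop : ∀ i ∈ range o k, lastBefore S (s.var vC) (s.arr aR (cell S i B.length)) =
      rightmost S (e i) (s.var vC :: B) := by
    intro i hi
    rw [hB.top hi]
    rfl
  refine ⟨?_, fun i hi t ht => h₂ i t ht fun hi' => absurd hi' hi, ht⟩
  rcases h₃ with ⟨e₁, e₂, e₃⟩ | ⟨e₁, e₂, e₃, e₄⟩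
  · refine .inl ⟨e₁, ⟨by simp [e₂], fun i hi t ht => ?_⟩, fun i hi => ?_⟩
    · simp only [List.length_cons] at ht ⊢
      rcases Nat.lt_or_eq_of_le ht with hlt | rfl
      · rw [hold i t (by omega), hB.entry i hi t (by omega),
          show B.length + 1 - t = (B.length - t) + 1 by omega, List.drop_succ_cons]
      · rw [h₁ i hi, htop i hi, Nat.sub_self, List.drop_zero]
    · rw [emb_iff, ← htop i hi]
      exact e₃ i hi
  · refine .inr ⟨e₁, ⟨e₂, fun i hi t ht => ?_⟩, e₃, ?_⟩
    · rw [hold i t ht, hB.entry i hi t ht]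
    · rw [emb_iff, ← htop _ e₃]
      exact e₄

end WordRAM

namespace WordRAM

/-! ### Loading a string onto the stacks, and moving the windows past a letter -/

/-- The array that stores the string of a pass. -/
def strArr : Bool → ℕ
  | true => aT
  | false => aH

/-- The variable that stores the length of the string of a pass. -/
def lenVar : Bool → ℕ
  | true => vTl
  | false => vHl

/-- The string `X` is stored in array `a`, its length in variable `x`. -/
structure Holds (x a : ℕ) (X : List ℕ) (s : Memory) : Prop where
  len : s.var x = X.length
  get : ∀ i (h : i < X.length), s.arr a i = X[i]

/-- Push the stored string onto the empty stacks, from its last letter to its first one. -/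
def loadStr (o : Bool) : Cmd :=
  .assign vD (.const 0) ;; .assign vFail (.const 0) ;; .assign vX (.var (lenVar o)) ;;
  .loop (.var vX)
    (.assign vX (.var vX -ₑ .const 1) ;; .assign vC (.load (strArr o) (.var vX)) ;;
     tryPush o ;; .cond (.var vFail) (.assign vX (.const 0)) .skip)

/-- The suffixes are tested from the shortest on; a suffix that fails in some interval shows that
the whole string is not common. -/
theorem runs_loadStr {S : List ℕ} {k w : ℕ} {s : Memory} (h : Ctx S k w s) (o : Bool)
    {e : ℕ → ℕ} {X : List ℕ} (hX : Holds (lenVar o) (strArr o) X s) (hlen : X.length ≤ S.length)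
    (he : ∀ i ∈ range o k, s.arr aR (cell S i 0) = e i ∧ s.arr aL i < e i) :
    Runs w (loadStr o) s fun t s' =>
      ((s'.var vFail = 0 ∧ Stack S (range o k) e X s' ∧
          Common S (range o k) (s.arr aL) e X) ∨
        (s'.var vFail = 1 ∧ ¬ Common S (range o k) (s.arr aL) e X)) ∧
      (∀ i ∉ range o k, ∀ t ≤ S.length + 1,
        s'.arr aR (cell S i t) = s.arr aR (cell S i t)) ∧
      t ≤ (X.length + 1) * (150 * (k * lg S.length)) := by
  have hkl : 1 ≤ k * lg S.length := Nat.mul_pos h.pos (one_le_lg _)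
  have hw0 : 0 % 2 ^ w = 0 := Nat.zero_mod _
  unfold loadStr
  refine runs_seq (runs_assign (runs_seq (runs_assign (runs_seq (runs_assign ?_)))))
  have hlv : ((s.setVar vD ((Expr.const 0).eval w s)).setVar vFail ((Expr.const 0).eval w
      (s.setVar vD ((Expr.const 0).eval w s)))).var (lenVar o) = X.length := by
    rw [← hX.len]
    cases o <;> simp [lenVar]
  simp only [Expr.eval] at hlv
  simp only [hw0] at hlv
  simp only [Expr.eval, hw0, hlv, Expr.cost]
  refine (runs_loop (fun s' =>
      ((s'.var vFail = 0 ∧ s'.var vX ≤ X.length ∧ Stack S (range o k) e (X.drop (s'.var vX)) s' ∧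
          Common S (range o k) (s.arr aL) e (X.drop (s'.var vX))) ∨
        (s'.var vFail = 1 ∧ s'.var vX = 0 ∧ ¬ Common S (range o k) (s.arr aL) e X)) ∧
      (∀ i ∉ range o k, ∀ t ≤ S.length + 1,
        s'.arr aR (cell S i t) = s.arr aR (cell S i t)))
    (fun s' => s'.var vX * (140 * (k * lg S.length))) ?_ ?_).mono ?_
  · refine ⟨.inl ⟨by simp, by simp, ⟨by simp, fun i hi t ht => ?_⟩, fun i hi => ?_⟩, ?_⟩
    · simp at ht ⊢
      subst ht
      simpa [rightmost] using (he i hi).1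
    · simpa [Emb] using (he i hi).2
    · intros; rfl
  · rintro s' hf ⟨h₁, h₂⟩ hne
    simp only [Expr.eval] at hne
    rcases h₁ with ⟨i₁, i₂, i₃, i₄⟩ | ⟨i₁, i₂, i₃⟩
    swap
    · exact absurd i₂ hne
    have hctx : Ctx S k w s' := (((h.setVar (by omega)).setVar (by omega)).setVar
      (by omega)).frame (by cases o <;> rfl) hf
    have fa := hf.arr (strArr o) (by cases o <;> rfl)
    have fL := hf.arr aL (by cases o <;> rfl)
    simp at fa fL
    set x := s'.var vX with hx
    have hx1 := hctx.small (i := x - 1) (by omega)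
    have h1 := hctx.one_mod
    refine runs_seq (runs_assign (runs_seq (runs_assign (runs_seq ?_))))
    simp only [Expr.eval, BinOp.eval, ← hx, h1, hx1, setVar_var, if_true, setVar_arr, fa,
      hX.get (x - 1) (by omega), Expr.cost]
    refine (runs_tryPush (e := e) (B := X.drop x)
      ((hctx.setVar (by omega)).setVar (by omega)) o ⟨?_, ?_⟩ ?_).mono ?_
    · simpa using i₃.depth
    · simpa using i₃.entry
    · simp; omega
    have hdrop : X[x - 1] :: X.drop x = X.drop (x - 1) := by
      rw [List.drop_eq_getElem_cons (show x - 1 < X.length by omega),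
        show x - 1 + 1 = x by omega]
    have hΦ : ∀ y, y < x → y * (140 * (k * lg S.length)) + 140 * (k * lg S.length) ≤
        x * (140 * (k * lg S.length)) := by
      intro y hy
      rw [← Nat.succ_mul]
      exact Nat.mul_le_mul_right _ hy
    rintro t s'' hf'' ⟨h₃, h₄, ht⟩
    have gX := hf''.var vX (by cases o <;> rfl)
    simp at gX
    simp only [setVar_var, setVar_arr, if_true, hdrop, fL] at h₃
    have hout : ∀ i ∉ range o k, ∀ t ≤ S.length + 1,
        s''.arr aR (cell S i t) = s.arr aR (cell S i t) := by
      intro i hi t ht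
      rw [h₄ i hi t ht]
      exact h₂ i hi t ht
    rcases h₃ with ⟨j₁, j₂, j₃⟩ | ⟨j₁, j₂, j₃, j₄⟩
    · refine runs_cond_false (by simpa [Expr.eval] using j₁) (runs_skip ⟨⟨.inl ?_, hout⟩, ?_⟩)
      · rw [gX]
        exact ⟨j₁, by omega, j₂, j₃⟩
      · rw [gX]
        have := hΦ (x - 1) (by omega)
        simp only [Expr.cost]
        omega
    · refine runs_cond_true (by simp [Expr.eval, j₁]) (runs_assign ⟨⟨.inr ?_, ?_⟩, ?_⟩)
      · simp only [setVar_var, Expr.eval, hw0]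
        refine ⟨by simpa using j₁, by simp, fun hC => j₄ ?_⟩
        exact (hC _ j₃).sublist (List.drop_sublist _ _)
      · simpa using hout
      · simp only [setVar_var, Expr.eval, hw0, Expr.cost, if_true]
        have := hΦ 0 (by omega)
        omega
  · rintro t s' hf ⟨⟨h₁, h₂⟩, hend, ht⟩
    simp only [Expr.eval] at hend
    refine ⟨?_, h₂, ?_⟩
    · rcases h₁ with ⟨i₁, i₂, i₃, i₄⟩ | ⟨i₁, i₂, i₃⟩
      · rw [hend, List.drop_zero] at i₃ i₄
        exact .inl ⟨i₁, i₃, i₄⟩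
      · exact .inr ⟨i₁, i₃⟩
    · simp [Expr.cost] at ht ⊢
      rw [Nat.add_mul]
      have : X.length * (140 * (k * lg S.length)) ≤ X.length * (150 * (k * lg S.length)) :=
        Nat.mul_le_mul_left _ (by omega)
      omega

/-- Read the letter on top of the stacks. -/
def topLetter (o : Bool) : Cmd :=
  .assign vC (.load aS (.load aR (cellExpr (.const (firstIdx o)) (.var vD)) -ₑ .const 1))

/-- The stacks store positions only; the head letter is recovered by looking up `S` at the top of
the first stack, which is a genuine position because the string embeds there. -/
theorem runs_topLetter {S : List ℕ} {k w : ℕ} {s : Memory} (h : Ctx S k w s) (o : Bool)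
    {e : ℕ → ℕ} {b : ℕ} {B : List ℕ} (hB : Stack S (range o k) e (b :: B) s)
    (hlen : B.length < S.length) (hE : Common S (range o k) (s.arr aL) e (b :: B))
    {Q : ℕ → Memory → Prop} (hQ : Q 10 (s.setVar vC b)) : Runs w (topLetter o) s Q := by
  have hi : firstIdx o ∈ range o k := mem_range.2 ⟨le_rfl, by have := h.pos; omega⟩
  have htop := hB.top hi
  have hlt := emb_iff.1 (hE _ hi)
  obtain ⟨hat, -⟩ := lastBefore_spec (show 0 < lastBefore S b (rightmost S (e (firstIdx o)) B) from
    (Nat.zero_le _).trans_lt hlt)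
  have hfm : firstIdx o % 2 ^ w = firstIdx o := h.small (by cases o <;> simp [firstIdx])
  have hcell : (cellExpr (.const (firstIdx o)) (.var vD)).eval w s =
      cell S (firstIdx o) (B.length + 1) := by
    have := hB.depth
    rw [List.length_cons] at this
    rw [h.cellExpr_eval]
    · simp [Expr.eval, hfm, this]
    · simpa [Expr.eval, hfm] using le_of_mem_range hi
    · simp [Expr.eval, this]; omega
  refine runs_assign ?_
  have hval : (Expr.load aS (.load aR (cellExpr (.const (firstIdx o)) (.var vD)) -ₑ
      .const 1)).eval w s = b := by
    rw [List.length_cons] at htop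
    have hle := hat.le
    have hr : rightmost S (e (firstIdx o)) (b :: B) =
      lastBefore S b (rightmost S (e (firstIdx o)) B) := rfl
    simp only [Expr.eval, BinOp.eval, hcell, htop, h.one_mod, h.str]
    rw [hr, h.small (by omega), hat.getD]
  rw [hval]
  exact hQ

/-- If entry `q` is the last one not beyond `L`, then entry `q + 1` is the first one beyond it; `hp`
ensures that it exists. -/
theorem IsOccTable.next {S : List ℕ} {c L q : ℕ} {pos : ℕ → ℕ} (h : IsOccTable S c pos)
    (hq' : ∀ q', q < q' → q' ≤ S.count c → L < pos q')
    (hqc : q ≤ S.count c) (hle : pos q ≤ L) (hp : ∃ p, L < p ∧ At S p c) :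
    q + 1 ≤ S.count c ∧ L < pos (q + 1) ∧ At S (pos (q + 1)) c ∧
      ∀ p, L < p → p < pos (q + 1) → ¬ At S p c := by
  have key : ∀ p, L < p → At S p c → ∃ i, q < i ∧ i ≤ S.count c ∧ pos i = p := by
    intro p hpL hat
    have hc := hat.count_take
    have hle' : (S.take p).count c ≤ S.count c := (List.take_sublist _ _).count_le c
    have h₁ := h.2 ((S.take p).count c) (by omega) hle'
    have h₂ : pos ((S.take p).count c) = p := h₁.1.eq_of_count hat h₁.2
    refine ⟨_, ?_, hle', h₂⟩
    by_contra hcon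
    rcases Nat.lt_or_eq_of_le (not_lt.1 hcon) with hlt | heq
    · have := h.lt hlt hqc
      omega
    · rw [heq] at h₂
      omega
  obtain ⟨p, hpL, hat⟩ := hp
  obtain ⟨i, hi, hic, -⟩ := key p hpL hat
  have hq1 : q + 1 ≤ S.count c := by omega
  refine ⟨hq1, hq' _ (by omega) hq1, (h.2 _ (by omega) hq1).1, fun p' hp' hlt hat' => ?_⟩
  obtain ⟨j, hj, hjc, rfl⟩ := key p' hp' hat'
  rcases Nat.lt_or_eq_of_le (show q + 1 ≤ j from hj) with hlt' | heq
  · have := h.lt hlt' hjc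
    omega
  · rw [← heq] at hlt
    exact lt_irrefl _ hlt

/-- Move each `aL i` to the next occurrence of the letter `vC`. -/
def advance (o : Bool) : Cmd :=
  .for vE (firstIdx o) (endVar o)
    (.assign vR (.load aL (.var vE) +ₑ .const 1) ;;
     findLast ;;
     .store aL (.var vE) (.load aOc (.var vBase +ₑ (.var vLo +ₑ .const 1))))

theorem runs_advance {S : List ℕ} {k w : ℕ} {s : Memory} (h : Ctx S k w s) (o : Bool)
    (hL : ∀ i ∈ range o k, ∃ p, s.arr aL i < p ∧ At S p (s.var vC)) :
    Runs w (advance o) s fun t s' =>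
      (∀ i ∈ range o k, s.arr aL i < s'.arr aL i ∧ At S (s'.arr aL i) (s.var vC) ∧
        ∀ p, s.arr aL i < p → p < s'.arr aL i → ¬ At S p (s.var vC)) ∧
      (∀ i ∉ range o k, s'.arr aL i = s.arr aL i) ∧
      t ≤ 90 * (k * lg S.length) := by
  have hlen := h.le
  set c := s.var vC with hc
  refine (runs_for (fun i s' =>
      (∀ j, firstIdx o ≤ j → j < i → s.arr aL j < s'.arr aL j ∧ At S (s'.arr aL j) c ∧
        ∀ p, s.arr aL j < p → p < s'.arr aL j → ¬ At S p c) ∧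
      (∀ j, ¬ (firstIdx o ≤ j ∧ j < i) → s'.arr aL j = s.arr aL j))
      (50 * lg S.length + 25) rfl (by cases o <;> rfl) (by cases o <;> decide) ?_ ?_ ?_ ?_).mono ?_
  · rw [h.endVar]; omega
  · rw [h.endVar]
    exact small_lt h.word (by cases o <;> simp [firstIdx] <;> omega)
  · exact ⟨fun j h₁ h₂ => by omega, fun j _ => rfl⟩
  · rw [h.endVar]
    rintro i s' hi hik hxi hf ⟨i₁, i₂⟩
    have hctx : Ctx S k w s' := h.frame rfl hf
    have fC := hf.var vC rfl
    have fO := hf.arr aOc rfl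
    have fF := hf.arr aF rfl
    rw [← hc] at fC
    have hLi := i₂ i (by omega)
    obtain ⟨p, hp, hat⟩ := hL i (mem_range.2 ⟨hi, hik⟩)
    have hpl := hat.le
    have h1 := h.one_mod
    have hL1 := h.small (i := s.arr aL i + 1) (by omega)
    refine runs_seq (runs_assign (runs_seq ?_))
    simp only [Expr.eval, BinOp.eval, hxi, hLi, h1, hL1, Expr.cost]
    refine (runs_findLast h.word (hctx.setVar (by omega)).toEnv).mono ?_
    rintro t s'' hf'' ⟨-, hbase, hlo, hres, hnext, ht⟩
    have gE := hf''.var vE rfl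
    have gO := hf''.arr aOc rfl
    have gL := hf''.arr aL rfl
    simp only [setVar_var, setVar_arr, fC, fO, fF, if_true] at gE gO gL hbase hlo hres hnext
    simp [hxi] at gE hbase hlo hres hnext
    have hle : lastBefore S c (s.arr aL i + 1) ≤ s.arr aL i := by
      by_contra hcon
      obtain ⟨p, hp, hp', -⟩ := lt_lastBefore.1 (not_le.1 hcon)
      omega
    obtain ⟨n₁, n₂, n₃, n₄⟩ := IsOccTable.next (h.table c)
      (L := s.arr aL i) (q := s''.var vLo) (fun q' hq' hq'' => hnext q' hq' hq'') hlo
      (by show s.arr aOc _ ≤ _; rw [hres]; exact hle) ⟨p, hp, hat⟩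
    have hcnt : S.count c ≤ S.length := List.count_le_length
    have hev : (Expr.load aOc (.var vBase +ₑ (.var vLo +ₑ .const 1))).eval w s'' =
        s.arr aOc (s.arr aF c * (S.length + 2) + (s''.var vLo + 1)) := by
      have hm₁ := h.small (i := s''.var vLo + 1) (by omega)
      have hm₂ := Nat.mod_eq_of_lt (index_lt h.word (h.num_le c)
        (show s''.var vLo + 1 ≤ S.length + 1 by omega))
      simp only [Expr.eval, BinOp.eval, h1, hm₁, hbase, hm₂, gO]
    refine runs_store ?_
    rw [hev]
    simp only [Expr.eval, gE]
    refine ⟨⟨fun j hj hji => ?_, fun j hj => ?_⟩, by simp [Expr.cost]; omega⟩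
    · simp only [setVar_arr, setArr_arr, if_true]
      by_cases hij : j = i
      · subst hij
        rw [Function.update_self]
        exact ⟨n₂, n₃, n₄⟩
      · rw [Function.update_of_ne hij, gL]
        exact i₁ j hj (by omega)
    · simp only [setVar_arr, setArr_arr, if_true]
      rw [Function.update_of_ne (by rintro rfl; omega), gL]
      exact i₂ j (by omega)
  · rw [h.endVar]
    rintro t s' hf ⟨⟨i₁, i₂⟩, ht⟩
    refine ⟨fun i hi => ?_, fun i hi => ?_, ?_⟩
    · rw [mem_range] at hi
      exact i₁ i hi.1 hi.2
    · rw [mem_range] at hi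
      exact i₂ i hi
    · have e₁ : k * (50 * lg S.length + 25 + 8) = 50 * (k * lg S.length) + 33 * k := by ring
      have e₂ : k ≤ k * lg S.length := Nat.le_mul_of_pos_right _ (one_le_lg _)
      rw [Nat.add_sub_cancel_left, e₁] at ht
      have hkl : 1 ≤ k * lg S.length := Nat.mul_pos h.pos (one_le_lg _)
      omega

end WordRAM

namespace WordRAM

/-! ### Extending a common subsequence to a maximal one -/

/-- The interval that is searched at the end of the string. -/
def lastIdx (k : ℕ) : Bool → ℕ
  | true => k
  | false => 0

/-- The expression for the interval that is searched at the end of the string. -/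
def lastExpr : Bool → Expr
  | true => .var vK
  | false => .const 0

/-- Try to push the letter on top of the stacks once more. -/
def probe (o : Bool) : Cmd :=
  .cond (.var vD) (topLetter o ;; tryPush o)
    (.assign vFail (.const 1) ;; .assign vJ (lastExpr o))

/-- Try to push the next letter of the window `vJJ`, or else skip it. -/
def scan (o : Bool) : Cmd :=
  .assign vC (.load aS (.var vQ)) ;; tryPush o ;;
  .cond (.var vFail) (.store aL (.var vJJ) (.var vQ +ₑ .const 1)) .skip

/-- Move the letter on top of the stacks to the end of the output. -/
def emit (o : Bool) : Cmd :=
  topLetter o ;; advance o ;;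
  .store (strArr o) (.var (lenVar o)) (.var vC) ;;
  .assign (lenVar o) (.var (lenVar o) +ₑ .const 1) ;;
  .assign vD (.var vD -ₑ .const 1)

/-- One step of the search for a maximal common subsequence. -/
def searchStep (o : Bool) : Cmd :=
  probe o ;;
  .cond (.var vFail)
    (.assign vQ (.load aL (.var vJ)) ;; .assign vJJ (.var vJ) ;;
     .cond (.var vQ +ₑ .const 1 <ₑ .load aR (cellExpr (.var vJ) (.var vD)))
       (scan o)
       (.cond (.var vD) (emit o) (.assign vGo (.const 0))))
    .skip

/-- Replace the string on the stacks by a maximal common subsequence that extends it. -/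
def extend (o : Bool) : Cmd :=
  .assign vGo (.const 1) ;; .assign (lenVar o) (.const 0) ;; .loop (.var vGo) (searchStep o)

/-- The memory holds a state of the search. -/
structure SearchMem (S : List ℕ) (k : ℕ) (o : Bool) (a e : ℕ → ℕ) (A B : List ℕ) (s : Memory) :
    Prop where
  holds : Holds (lenVar o) (strArr o) A s
  stack : Stack S (range o k) e B s
  search : Search S (range o k) a e (lastIdx k o) A B (s.arr aL)

variable {S : List ℕ} {k w : ℕ} {s : Memory} {o : Bool} {a e : ℕ → ℕ} {A B : List ℕ}

theorem Holds.frame {x a : ℕ} {X : List ℕ} {s s' : Memory} (h : Holds x a X s)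
    (hx : s'.var x = s.var x) (ha : s'.arr a = s.arr a) : Holds x a X s' :=
  ⟨hx.trans h.len, fun i hi => by rw [ha, h.get i hi]⟩

theorem Stack.frame {I : Finset ℕ} {s s' : Memory} (h : Stack S I e B s)
    (hx : s'.var vD = s.var vD) (ha : s'.arr aR = s.arr aR) : Stack S I e B s' :=
  ⟨hx.trans h.depth, fun i hi t ht => by rw [ha, h.entry i hi t ht]⟩

theorem SearchMem.frame {s' : Memory} (h : SearchMem S k o a e A B s)
    (h₁ : s'.var (lenVar o) = s.var (lenVar o)) (h₂ : s'.arr (strArr o) = s.arr (strArr o))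
    (h₃ : s'.var vD = s.var vD) (h₄ : s'.arr aR = s.arr aR) (h₅ : s'.arr aL = s.arr aL) :
    SearchMem S k o a e A B s' :=
  ⟨h.holds.frame h₁ h₂, h.stack.frame h₃ h₄, h₅ ▸ h.search⟩

theorem SearchMem.setVar {x v : ℕ} (h : SearchMem S k o a e A B s) (h₁ : x ≠ lenVar o)
    (h₂ : x ≠ vD) : SearchMem S k o a e A B (s.setVar x v) :=
  h.frame (by rw [setVar_var, if_neg (Ne.symm h₁)]) rfl
    (by rw [setVar_var, if_neg (Ne.symm h₂)]) rfl rfl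

theorem firstIdx_mem_range (hk : 1 ≤ k) : firstIdx o ∈ range o k :=
  mem_range.2 ⟨le_rfl, by omega⟩

theorem lastIdx_mem_range (hk : 1 ≤ k) : lastIdx k o ∈ range o k := by
  cases o <;> simp [mem_range, lastIdx, firstIdx] <;> omega

theorem length_le_of_common {X : List ℕ} (hk : 1 ≤ k)
    (he : ∀ i ∈ range o k, e i ≤ S.length + 1) (h : Common S (range o k) a e X) :
    X.length ≤ S.length := by
  have h₁ := emb_length_add (h _ (firstIdx_mem_range hk))
  have h₂ := he (firstIdx o) (firstIdx_mem_range hk)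
  omega

theorem SearchMem.length_le (h : SearchMem S k o a e A B s) (hk : 1 ≤ k)
    (he : ∀ i ∈ range o k, e i ≤ S.length + 1) : A.length + B.length ≤ S.length := by
  simpa using length_le_of_common hk he h.search.common

/-- Doubling the head of `B` either enlarges the string or exhibits an interval where it does not
fit. The latter is the hypothesis that makes it safe to skip letters there. For empty `B` the
interval is the prescribed last one. -/
theorem runs_probe (hc : Ctx S k w s) (he : ∀ i ∈ range o k, e i ≤ S.length + 1)
    (h : SearchMem S k o a e A B s) :
    Runs w (probe o) s fun t s' => s'.arr aL = s.arr aL ∧ t ≤ 140 * (k * lg S.length) ∧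
      ((s'.var vFail = 0 ∧ ∃ b, SearchMem S k o a e A (b :: B) s') ∨
        (s'.var vFail = 1 ∧ SearchMem S k o a e A B s' ∧ s'.var vJ ∈ range o k ∧
          (∀ b ∈ B.head?, ¬ Emb S (b :: B) (s.arr aL (s'.var vJ)) (e (s'.var vJ))) ∧
          (B = [] → s'.var vJ = lastIdx k o))) := by
  have hkl : 1 ≤ k * lg S.length := Nat.mul_pos hc.pos (one_le_lg _)
  have hlen := h.length_le hc.pos he
  refine runs_cond (fun hne => runs_seq ?_) (fun heq => runs_seq (runs_assign (runs_assign ?_)))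
  · simp only [Expr.eval, h.stack.depth] at hne
    obtain ⟨b, B', rfl⟩ := List.exists_cons_of_length_pos (Nat.pos_of_ne_zero hne)
    simp only [List.length_cons] at hlen
    refine runs_topLetter hc o h.stack (by omega) h.search.right ?_
    have h' : SearchMem S k o a e A (b :: B') (s.setVar vC b) :=
      h.setVar (by cases o <;> decide) (by decide)
    refine (runs_tryPush (hc.setVar (by omega)) o h'.stack (by simp; omega)).mono ?_
    rintro t s' hf ⟨h₁, -, ht⟩
    have fL := hf.arr aL (by cases o <;> rfl)
    have fh := h'.holds.frame (hf.var _ (by cases o <;> rfl)) (hf.arr _ (by cases o <;> rfl))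
    simp only [setVar_var, if_true] at h₁
    refine ⟨fL, by simp [Expr.cost]; omega, ?_⟩
    rcases h₁ with ⟨e₁, e₂, e₃⟩ | ⟨e₁, e₂, e₃, e₄⟩
    · exact .inl ⟨e₁, b, fh, e₂, fL ▸ h'.search.push e₃⟩
    · refine .inr ⟨e₁, ⟨fh, e₂, fL ▸ h'.search⟩, e₃, fun c hbc => ?_, by simp⟩
      obtain rfl : b = c := by simpa using hbc
      exact e₄
  · simp only [Expr.eval, h.stack.depth] at heq
    obtain rfl := List.length_eq_zero_iff.1 heq
    have hj : (lastExpr o).eval w (s.setVar vFail ((Expr.const 1).eval w s)) = lastIdx k o := by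
      cases o <;> simp [lastExpr, lastIdx, Expr.eval, hc.pow]
    have hcost : (lastExpr o).cost = 1 := by cases o <;> rfl
    rw [hj, hcost]
    refine ⟨rfl, by simp [Expr.cost]; omega, .inr ⟨?_, ?_, ?_, by simp, fun _ => by simp⟩⟩
    · simp [Expr.eval, hc.one_mod]
    · exact (h.setVar (by cases o <;> decide) (by decide)).setVar
        (by cases o <;> decide) (by decide)
    · simpa using lastIdx_mem_range hc.pos

theorem runs_scan (hc : Ctx S k w s) (he : ∀ i ∈ range o k, e i ≤ S.length + 1)
    (h : SearchMem S k o a e A B s) {j : ℕ} (hj : j ∈ range o k) (hjj : s.var vJJ = j)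
    (hq : s.var vQ = s.arr aL j)
    (hb : ∀ b ∈ B.head?, ¬ Emb S (b :: B) (s.arr aL j) (e j)) (hB : B = [] → j = lastIdx k o)
    (hlt : Emb S B (s.arr aL j + 1) (e j)) :
    Runs w (scan o) s fun t s' => t ≤ 140 * (k * lg S.length) ∧
      ((s'.arr aL = s.arr aL ∧ ∃ c, SearchMem S k o a e A (c :: B) s') ∨
        (s'.arr aL = Function.update (s.arr aL) j (s.arr aL j + 1) ∧
          SearchMem S k o a e A B s')) := by
  have hkl : 1 ≤ k * lg S.length := Nat.mul_pos hc.pos (one_le_lg _)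
  have hlen := h.length_le hc.pos he
  have hLn : s.arr aL j < S.length := by
    have h₁ := hlt.lt
    have h₂ := he j hj
    omega
  have hat := at_getD hLn
  set c := S.getD (s.arr aL j) 0 with hcdef
  refine runs_seq (runs_assign (runs_seq ?_))
  simp only [Expr.eval, hq, hc.str, ← hcdef]
  have h' : SearchMem S k o a e A B (s.setVar vC c) :=
    h.setVar (by cases o <;> decide) (by decide)
  refine (runs_tryPush (hc.setVar (by omega)) o h'.stack (by omega)).mono ?_
  rintro t s' hf ⟨h₁, -, ht⟩
  have fL := hf.arr aL (by cases o <;> rfl)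
  have fQ := hf.var vQ (by cases o <;> rfl)
  have fJ := hf.var vJJ (by cases o <;> rfl)
  have fh := h'.holds.frame (hf.var _ (by cases o <;> rfl)) (hf.arr _ (by cases o <;> rfl))
  simp only [setVar_var, setVar_arr, if_true] at h₁ fL fQ fJ
  simp [hq, hjj] at fQ fJ
  rcases h₁ with ⟨e₁, e₂, e₃⟩ | ⟨e₁, e₂, e₃, e₄⟩
  · refine runs_cond_false (by simpa [Expr.eval] using e₁) (runs_skip ⟨?_, ?_⟩)
    · simp [Expr.cost]; omega
    · exact .inl ⟨fL, c, fh, e₂, fL ▸ h.search.push e₃⟩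
  · refine runs_cond_true (by simp [Expr.eval, e₁]) (runs_store ⟨?_, ?_⟩)
    · simp [Expr.cost]; omega
    · have hm := hc.small (i := s.arr aL j + 1) (by omega)
      simp only [Expr.eval, BinOp.eval, fQ, fJ, hc.one_mod, hm]
      have hup : (s'.setArr aL j (s.arr aL j + 1)).arr aL =
          Function.update (s.arr aL) j (s.arr aL j + 1) := by simp [fL]
      refine .inr ⟨hup, fh.frame rfl ?_, e₂.frame rfl ?_, ?_⟩
      · cases o <;> simp [strArr]
      · simp
      · rw [hup]
        exact h.search.skip hj hb hB hlt hat fun hcon => e₄ (hcon _ e₃)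

theorem runs_emit {b : ℕ} (hc : Ctx S k w s) (he : ∀ i ∈ range o k, e i ≤ S.length + 1)
    (h : SearchMem S k o a e A (b :: B) s) {j : ℕ} (hj : j ∈ range o k)
    (hend : ¬ Emb S (b :: B) (s.arr aL j + 1) (e j)) :
    Runs w (emit o) s fun t s' => t ≤ 140 * (k * lg S.length) ∧
      SearchMem S k o a e (A ++ [b]) B s' ∧ (∀ i ∈ range o k, s.arr aL i ≤ s'.arr aL i) ∧
      ∀ i ∉ range o k, s'.arr aL i = s.arr aL i := by
  have hkl : 1 ≤ k * lg S.length := Nat.mul_pos hc.pos (one_le_lg _)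
  have hlen := h.length_le hc.pos he
  simp only [List.length_cons] at hlen
  refine runs_seq (runs_topLetter hc o h.stack (by omega) h.search.right (runs_seq ?_))
  have h' : SearchMem S k o a e A (b :: B) (s.setVar vC b) :=
    h.setVar (by cases o <;> decide) (by decide)
  refine (runs_advance (hc.setVar (by omega)) o fun i hi => ?_).mono ?_
  · obtain ⟨p, hp, hat, -⟩ := h.search.right i hi
    exact ⟨p, by simpa using hp, by simpa using hat⟩
  rintro t s' hf ⟨h₁, h₂, ht⟩
  simp only [setVar_var, setVar_arr, if_true] at h₁ h₂
  have fC := hf.var vC (by cases o <;> rfl)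
  have fR := hf.arr aR (by cases o <;> rfl)
  have fD := hf.var vD (by cases o <;> rfl)
  have fh := h'.holds.frame (hf.var _ (by cases o <;> rfl)) (hf.arr _ (by cases o <;> rfl))
  have fst := h'.stack.frame fD fR
  simp at fC
  have hdep : s'.var vD = B.length + 1 := by simpa using fst.depth
  have hm₁ := hc.small (i := A.length + 1) (by omega)
  have hm₂ := hc.small (i := B.length) (by omega)
  refine runs_seq (runs_store (runs_seq (runs_assign (runs_assign ?_))))
  simp only [Expr.eval, BinOp.eval, fh.len, setArr_var, hc.one_mod, hm₁, fC]
  have hneD : vD ≠ lenVar o := by cases o <;> decide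
  simp only [setVar_var, if_neg hneD, setArr_var, hdep, Nat.add_sub_cancel, hm₂]
  refine ⟨by simp [Expr.cost]; omega, ⟨⟨?_, fun i hi => ?_⟩, ⟨?_, fun i hi t ht => ?_⟩, ?_⟩,
    fun i hi => ?_, fun i hi => ?_⟩
  · simp [Ne.symm hneD]
  · simp only [setVar_arr, setArr_arr, if_true]
    by_cases hiA : i < A.length
    · rw [Function.update_of_ne hiA.ne, fh.get i hiA, List.getElem_append_left hiA]
    · simp only [List.length_append, List.length_singleton] at hi
      obtain rfl : i = A.length := by omega
      simp
  · simp
  · have hent := fst.entry i hi t (by simp; omega)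
    have hneR : aR ≠ strArr o := by cases o <;> decide
    simp only [setVar_arr, setArr_arr, if_neg hneR]
    rw [hent, List.length_cons, show B.length + 1 - t = B.length - t + 1 by omega,
      List.drop_succ_cons]
  · have hneL : aL ≠ strArr o := by cases o <;> decide
    simp only [setVar_arr, setArr_arr, if_neg hneL]
    exact h.search.emit hj hend h₁
  · have hneL : aL ≠ strArr o := by cases o <;> decide
    simp only [setVar_arr, setArr_arr, if_neg hneL]
    exact (h₁ i hi).1.le
  · have hneL : aL ≠ strArr o := by cases o <;> decide
    simp only [setVar_arr, setArr_arr, if_neg hneL]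
    exact h₂ i hi

/-- A bound on the number of remaining steps of the search. -/
def searchBound (S : List ℕ) (k : ℕ) (o : Bool) (e L : ℕ → ℕ) (lenA lenB : ℕ) : ℕ :=
  ∑ i ∈ range o k, (e i - L i) + 2 * (S.length - (lenA + lenB)) + lenB

/-- The bound drops in every non-final step: an insertion lowers the doubled term by `2` and raises
the length of `B` by `1`; a skip shortens a window; an emission keeps the total length and shortens
`B`. -/
theorem runs_searchStep (hc : Ctx S k w s) (he : ∀ i ∈ range o k, e i ≤ S.length + 1)
    (h : SearchMem S k o a e A B s) :
    Runs w (searchStep o) s fun t s' => t ≤ 400 * (k * lg S.length) ∧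
      ∃ A' B', SearchMem S k o a e A' B' s' ∧ (A ++ B).Sublist (A' ++ B') ∧
        (∀ i ∉ range o k, s'.arr aL i = s.arr aL i) ∧
        ((s'.var vGo = s.var vGo ∧ searchBound S k o e (s'.arr aL) A'.length B'.length <
            searchBound S k o e (s.arr aL) A.length B.length) ∨
          (s'.var vGo = 0 ∧ s'.arr aL = s.arr aL ∧ A' = A ∧ B' = [] ∧ B = [] ∧
            ∃ j ∈ range o k, ¬ Emb S [] (s'.arr aL j + 1) (e j))) := by
  have hkl : 1 ≤ k * lg S.length := Nat.mul_pos hc.pos (one_le_lg _)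
  refine runs_seq ((runs_probe hc he h).mono ?_)
  rintro t s₁ hf ⟨fL, ht, hcase⟩
  have hc₁ : Ctx S k w s₁ := hc.frame (by cases o <;> rfl) hf
  have fG := hf.var vGo (by cases o <;> rfl)
  rcases hcase with ⟨e₁, b, hb⟩ | ⟨e₁, h₁, hj, hb, hlast⟩
  · refine runs_cond_false (by simpa [Expr.eval] using e₁) (runs_skip ⟨by simp [Expr.cost]; omega,
      A, b :: B, hb, by simp, fun i _ => by rw [fL], .inl ⟨fG, ?_⟩⟩)
    have := hb.length_le hc.pos he
    simp only [List.length_cons] at this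
    simp only [fL, searchBound, List.length_cons]
    omega
  refine runs_cond_true (by simp [Expr.eval, e₁]) (runs_seq (runs_assign (runs_seq
    (runs_assign ?_))))
  set j := s₁.var vJ with hjdef
  set s₂ := (s₁.setVar vQ ((Expr.load aL (.var vJ)).eval w s₁)).setVar vJJ
    ((Expr.var vJ).eval w (s₁.setVar vQ ((Expr.load aL (.var vJ)).eval w s₁))) with hs₂
  have hc₂ : Ctx S k w s₂ := (hc₁.setVar (by omega)).setVar (by omega)
  have h₂ : SearchMem S k o a e A B s₂ := (h₁.setVar (by cases o <;> decide) (by decide)).setVar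
    (by cases o <;> decide) (by decide)
  have gJ : s₂.var vJ = j := by simp [hs₂, hjdef]
  have gJJ : s₂.var vJJ = j := by simp [hs₂, hjdef, Expr.eval]
  have gQ : s₂.var vQ = s.arr aL j := by simp [hs₂, hjdef, Expr.eval, fL]
  have gL : s₂.arr aL = s.arr aL := by simp [hs₂, fL]
  have gG : s₂.var vGo = s.var vGo := by simp [hs₂, fG]
  clear_value s₂
  have hlen := h.length_le hc.pos he
  have hright := h.search.right j hj
  have hLn : s.arr aL j ≤ S.length := by
    have h₁ := hright.lt
    have h₂ := he j hj
    omega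
  have htop : (Expr.load aR (cellExpr (.var vJ) (.var vD))).eval w s₂ = rightmost S (e j) B := by
    rw [Expr.eval, hc₂.cellExpr_eval (by simpa [Expr.eval, gJ] using le_of_mem_range hj)
      (by simp [Expr.eval, h₂.stack.depth]; omega)]
    simp only [Expr.eval, gJ, h₂.stack.depth]
    exact h₂.stack.top hj
  have hm := hc.small (i := s.arr aL j + 1) (by omega)
  have hcost : (cellExpr (.var vJ) (.var vD)).cost = 5 := rfl
  refine runs_cond (fun hlt => ?_) (fun hge => ?_)
  · rw [Expr.eval, htop] at hlt
    simp only [Expr.eval, BinOp.eval, gQ, hc.one_mod, hm, ne_eq, hc.test, not_not] at hlt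
    refine (runs_scan hc₂ he h₂ hj gJJ (by rw [gQ, gL]) (by rw [gL]; exact hb) hlast
      (by rw [gL]; exact emb_iff.2 hlt)).mono ?_
    rintro t' s₃ hf₃ ⟨ht', hcase⟩
    have kG := hf₃.var vGo (by cases o <;> rfl)
    refine ⟨by simp [Expr.cost, hcost]; omega, ?_⟩
    rcases hcase with ⟨kL, c, h₃⟩ | ⟨kL, h₃⟩
    · refine ⟨A, c :: B, h₃, by simp, fun i _ => by rw [kL, gL], .inl ⟨kG.trans gG, ?_⟩⟩
      have := h₃.length_le hc.pos he
      simp only [List.length_cons] at this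
      simp only [kL, gL, searchBound, List.length_cons]
      omega
    · refine ⟨A, B, h₃, List.Sublist.refl _, fun i hi => ?_, .inl ⟨kG.trans gG, ?_⟩⟩
      · rw [kL, Function.update_of_ne (by rintro rfl; exact hi hj), gL]
      · have hsum : ∑ i ∈ range o k, (e i - s₃.arr aL i) <
            ∑ i ∈ range o k, (e i - s.arr aL i) := by
          refine Finset.sum_lt_sum (fun i hi => ?_) ⟨j, hj, ?_⟩
          · rw [kL, gL]
            by_cases hij : i = j
            · subst hij; simp; omega
            · rw [Function.update_of_ne hij]
          · rw [kL, gL, Function.update_self]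
            have := hright.lt
            omega
        simp only [searchBound]
        omega
  · rw [Expr.eval, htop] at hge
    simp only [Expr.eval, BinOp.eval, gQ, hc.one_mod, hm, hc.test] at hge
    have hend : ¬ Emb S B (s₂.arr aL j + 1) (e j) := by rw [gL, emb_iff]; exact hge
    refine runs_cond (fun hne => ?_) (fun heq => runs_assign ?_)
    · simp only [Expr.eval, h₂.stack.depth] at hne
      obtain ⟨b, B', rfl⟩ := List.exists_cons_of_length_pos (Nat.pos_of_ne_zero hne)
      refine (runs_emit hc₂ he h₂ hj hend).mono ?_
      rintro t' s₃ hf₃ ⟨ht', h₃, kL, kL'⟩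
      have kG := hf₃.var vGo (by cases o <;> rfl)
      refine ⟨by simp [Expr.cost, hcost]; omega, A ++ [b], B', h₃, by simp,
        fun i hi => by rw [kL' i hi, gL], .inl ⟨kG.trans gG, ?_⟩⟩
      have hsum : ∑ i ∈ range o k, (e i - s₃.arr aL i) ≤
          ∑ i ∈ range o k, (e i - s.arr aL i) := Finset.sum_le_sum fun i hi => by
        have := kL i hi
        rw [gL] at this
        omega
      simp only [searchBound, List.length_cons, List.length_append, List.length_nil] at hlen ⊢
      omega
    · simp only [Expr.eval, h₂.stack.depth] at heq
      obtain rfl := List.length_eq_zero_iff.1 heq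
      refine ⟨by simp [Expr.cost, hcost]; omega, A, [], ?_, List.Sublist.refl _,
        fun i _ => by rw [setVar_arr, gL], .inr ⟨?_, gL, rfl, rfl, rfl, j, hj, hend⟩⟩
      · exact h₂.setVar (by cases o <;> decide) (by decide)
      · simp [Expr.eval]

theorem runs_extend (hc : Ctx S k w s) (he : ∀ i ∈ range o k, e i ≤ S.length + 1)
    (hsum : ∑ i ∈ range o k, (e i - s.arr aL i) ≤ S.length + 1)
    (hB : Stack S (range o k) e B s) (hC : Common S (range o k) (s.arr aL) e B) :
    Runs w (extend o) s fun t s' => t ≤ (S.length + 1) * (1800 * (k * lg S.length)) ∧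
      (∀ i ∉ range o k, s'.arr aL i = s.arr aL i) ∧
      ∃ A, Holds (lenVar o) (strArr o) A s' ∧ B.Sublist A ∧
        Search S (range o k) (s.arr aL) e (lastIdx k o) A [] (s'.arr aL) ∧
        ∀ Y, A.Sublist Y → Common S (range o k) (s.arr aL) e Y → Y = A := by
  have hkl : 1 ≤ k * lg S.length := Nat.mul_pos hc.pos (one_le_lg _)
  have hw0 : 0 % 2 ^ w = 0 := Nat.zero_mod _
  have hneD : vD ≠ lenVar o := by cases o <;> decide
  have hneG : vGo ≠ lenVar o := by cases o <;> decide
  unfold extend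
  refine runs_seq (runs_assign (runs_seq (runs_assign ?_)))
  simp only [Expr.eval, hc.one_mod, hw0, Expr.cost]
  set s₀ := (s.setVar vGo 1).setVar (lenVar o) 0 with hs₀
  have hc₀ : Ctx S k w s₀ := (hc.setVar (by omega)).setVar (by cases o <;> decide)
  refine (runs_loop (fun s' => s'.var vGo ≤ 1 ∧ (∀ i ∉ range o k, s'.arr aL i = s.arr aL i) ∧
      ∃ A B', SearchMem S k o (s.arr aL) e A B' s' ∧ B.Sublist (A ++ B') ∧
        (s'.var vGo = 0 → B' = [] ∧ ∃ j ∈ range o k, ¬ Emb S [] (s'.arr aL j + 1) (e j)))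
    (fun s' => (searchBound S k o e (s'.arr aL) (s'.var (lenVar o)) (s'.var vD) + s'.var vGo) *
      (410 * (k * lg S.length))) ?_ ?_).mono ?_
  · refine ⟨by simp [hs₀, hneG], fun i _ => rfl, [], B, ⟨⟨by simp [hs₀], by simp⟩, ?_, ?_⟩,
      by simp, ?_⟩
    · exact hB.frame (by simp [hs₀, hneD]) rfl
    · exact Search.start hC
    · simp [hs₀, hneG]
  · rintro s₁ hf ⟨h₁, h₂, A, B', h₃, h₄, h₅⟩ hne
    simp only [Expr.eval] at hne
    have hgo : s₁.var vGo = 1 := by omega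
    have hc₁ : Ctx S k w s₁ := hc₀.frame (by cases o <;> rfl) hf
    refine (runs_searchStep hc₁ he h₃).mono ?_
    rintro t s₂ hf₂ ⟨ht, A₂, B₂, h₆, h₇, h₈, h₉⟩
    -- The final step leaves the search bound unchanged and is paid for by `vGo` falling from `1` to
    -- `0`.
    have hdec : searchBound S k o e (s₂.arr aL) (s₂.var (lenVar o)) (s₂.var vD) + s₂.var vGo <
        searchBound S k o e (s₁.arr aL) (s₁.var (lenVar o)) (s₁.var vD) + s₁.var vGo := by
      rw [h₆.holds.len, h₆.stack.depth, h₃.holds.len, h₃.stack.depth]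
      rcases h₉ with ⟨g₁, g₂⟩ | ⟨g₁, g₂, rfl, rfl, rfl, -⟩
      · omega
      · rw [g₂]; omega
    have hmul := Nat.mul_le_mul_right (410 * (k * lg S.length)) (Nat.succ_le_of_lt hdec)
    rw [Nat.succ_mul] at hmul
    refine ⟨⟨?_, fun i hi => (h₈ i hi).trans (h₂ i hi), A₂, B₂, h₆, h₄.trans h₇, fun hg => ?_⟩,
      ?_, ?_⟩
    · rcases h₉ with ⟨g₁, -⟩ | ⟨g₁, -⟩ <;> omega
    · rcases h₉ with ⟨g₁, -⟩ | ⟨-, -, -, g₁, -, g₂⟩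
      · omega
      · exact ⟨g₁, g₂⟩
    · simp only [Expr.cost]
      omega
    · omega
  · rintro t s' hf ⟨⟨-, h₂, A, B', h₃, h₄, h₅⟩, hend, ht⟩
    obtain ⟨rfl, j, hj, hE⟩ := h₅ hend
    rw [List.append_nil] at h₄
    refine ⟨?_, h₂, A, h₃.holds, h₄, h₃.search, fun Y hY hCY => h₃.search.maximal hj hE hY hCY⟩
    have hlen := length_le_of_common hc.pos he hC
    -- The windows contribute at most `n + 1`, the two length terms at most `2 * n`, and `vGo`
    -- contributes `1`.
    have hbound : searchBound S k o e (s₀.arr aL) (s₀.var (lenVar o)) (s₀.var vD) + s₀.var vGo ≤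
        (S.length + 1) * 4 := by
      have hD : s₀.var vD = B.length := by rw [← hB.depth]; simp [hs₀, hneD]
      have hL : s₀.var (lenVar o) = 0 := by simp [hs₀]
      have hG : s₀.var vGo = 1 := by simp [hs₀, hneG]
      have hLL : s₀.arr aL = s.arr aL := rfl
      rw [hD, hL, hG, hLL, searchBound]
      omega
    have hmul := Nat.mul_le_mul_right (410 * (k * lg S.length)) hbound
    have hring : (S.length + 1) * 4 * (410 * (k * lg S.length)) + 160 * ((S.length + 1) *
        (k * lg S.length)) = (S.length + 1) * (1800 * (k * lg S.length)) := by ring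
    have hpos : 1 ≤ (S.length + 1) * (k * lg S.length) := Nat.mul_pos (by omega) hkl
    simp only [Expr.cost] at ht
    omega

end WordRAM

namespace WordRAM

/-! ### Processing one choice of cuts -/

/-- Compute the cuts for the current tuple. -/
def setCuts : Cmd :=
  .store aP (.const 0) (.const 0) ;;
  .for vZ 0 vK (.store aP (.var vZ +ₑ .const 1) (.load aOc (.var vT +ₑ
    (.var vZ *ₑ .var vM +ₑ .load aTup (.var vZ) +ₑ .const 1)))) ;;
  .store aP (.var vK1) (.var vN +ₑ .const 1)

/-- Put the left ends of all intervals at the cuts. -/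
def setLeft : Cmd := .for vZ 0 vK1 (.store aL (.var vZ) (.load aP (.var vZ)))

/-- Put the right ends of all intervals at the cuts. -/
def setEnds : Cmd :=
  .for vZ 0 vK1 (.store aR (cellExpr (.var vZ) (.const 0)) (.load aP (.var vZ +ₑ .const 1)))

/-- Put the right ends of the intervals between two cuts at the tops of the stacks. -/
def setTops : Cmd :=
  .for vZ 1 vK (.store aR (cellExpr (.var vZ) (.const 0)) (.load aR (cellExpr (.var vZ) (.var vD))))

/-- Extend the stored pair of strings until it cannot be extended for the cuts given by the
current tuple. -/
def processTuple : Cmd :=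
  setCuts ;; setLeft ;; setEnds ;; loadStr false ;;
  .cond (.var vFail) .skip
    (setTops ;; loadStr true ;;
     .cond (.var vFail) .skip (extend true ;; setEnds ;; loadStr false ;; extend false))

variable {S : List ℕ} {k w : ℕ} {s : Memory}

theorem runs_setCuts (hc : Ctx S k w s) {σ m D : ℕ} (hm : s.var vM = m)
    (hT : s.var vT = s.arr aF σ * (S.length + 2)) (hr : IsTuple k D (s.arr aTup))
    (hm1 : 1 ≤ m) (hD : k * m + D ≤ S.count σ) :
    Runs w setCuts s fun t s' =>
      (∀ j ≤ k + 1, s'.arr aP j = cuts S (fun q => s.arr aOc (s.arr aF σ * (S.length + 2) + q))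
        k m (s.arr aTup) j) ∧ t ≤ 40 * k + 40 := by
  have hlen := hc.le
  have h1 := hc.one_mod
  have hw0 : 0 % 2 ^ w = 0 := Nat.zero_mod _
  have hcnt : S.count σ ≤ S.length := List.count_le_length
  unfold setCuts
  refine runs_seq (runs_store (runs_seq ((runs_for (fun i s' => s'.arr aP 0 = 0 ∧
    ∀ j, 1 ≤ j → j ≤ i → s'.arr aP j = cuts S (fun q => s.arr aOc (s.arr aF σ * (S.length + 2) + q))
        k m (s.arr aTup) j) 20 rfl rfl (by decide) (Nat.zero_le _) ?_ ?_ ?_).mono ?_)))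
  · simp only [setArr_var, hc.pow]
    exact small_lt hc.word (by omega)
  · simp [Expr.eval]
    omega
  · simp only [setArr_var, hc.pow]
    rintro i s' - hik hxi hf ⟨i₁, i₂⟩
    have hc' : Ctx S k w s' := (hc.setArr (by omega)).frame rfl hf
    have fM := hf.var vM rfl
    have fT := hf.var vT rfl
    have fO := hf.arr aOc rfl
    have fTup := hf.arr aTup rfl
    simp [hm, hT] at fM fT fO fTup
    have hb : i * m + s.arr aTup i + 1 ≤ S.count σ := by
      have h₁ := hr.2 i hik
      have h₂ : (i + 1) * m ≤ k * m := Nat.mul_le_mul_right m hik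
      rw [Nat.add_mul] at h₂
      omega
    have m₁ := hc.small (i := i + 1) (by omega)
    have m₂ := hc.small (i := i * m) (by omega)
    have m₃ := hc.small (i := i * m + s.arr aTup i) (by omega)
    have m₄ := hc.small (i := i * m + s.arr aTup i + 1) (by omega)
    have m₅ := Nat.mod_eq_of_lt (index_lt hc.word (hc.num_le σ)
      (show i * m + s.arr aTup i + 1 ≤ S.length + 1 by omega))
    refine runs_store ?_
    simp only [Expr.eval, BinOp.eval, hxi, h1, m₁, fM, fT, fO, fTup, m₂, m₃, m₄, m₅]
    refine ⟨⟨?_, fun j hj hji => ?_⟩, by simp [Expr.cost]⟩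
    · simpa using i₁
    · simp only [setVar_arr, setArr_arr, if_true]
      rcases Nat.lt_or_eq_of_le hji with hlt | rfl
      · rw [Function.update_of_ne (by omega)]
        exact i₂ j hj (by omega)
      · rw [Function.update_self]
        simp [cuts, Nat.succ_le_of_lt hik]
  · simp only [setArr_var, hc.pow]
    rintro t s' hf ⟨⟨i₁, i₂⟩, ht⟩
    have hc' : Ctx S k w s' := (hc.setArr (by omega)).frame rfl hf
    refine runs_store ?_
    have m₁ := hc.small (i := S.length + 1) (by omega)
    simp only [Expr.eval, BinOp.eval, hc'.succ, hc'.len, h1, m₁]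
    refine ⟨fun j hj => ?_, by simp [Expr.cost]; omega⟩
    simp only [setArr_arr, if_true]
    rcases Nat.lt_or_eq_of_le hj with hlt | rfl
    · rw [Function.update_of_ne (by omega)]
      rcases Nat.eq_zero_or_pos j with rfl | hj0
      · rw [i₁]; simp [cuts]
      · exact i₂ j hj0 (by omega)
    · rw [Function.update_self]
      simp [cuts]

theorem runs_setLeft (hc : Ctx S k w s) :
    Runs w setLeft s fun t s' => (∀ j ≤ k, s'.arr aL j = s.arr aP j) ∧ t ≤ 40 * k + 40 := by
  have hlen := hc.le
  have h1 := hc.one_mod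
  unfold setLeft
  refine (runs_for (fun i s' => ∀ j < i, s'.arr aL j = s.arr aP j) 20 rfl rfl (by decide)
    (Nat.zero_le _) ?_ ?_ ?_).mono ?_
  · rw [hc.succ]
    exact small_lt hc.word (by omega)
  · simp
  · rintro i s' - hik hxi hf hI
    have fP := hf.arr aP rfl
    refine runs_store ?_
    simp only [Expr.eval, hxi, fP]
    refine ⟨fun j hj => ?_, by simp [Expr.cost]⟩
    simp only [setVar_arr, setArr_arr, if_true]
    rcases Nat.lt_succ_iff_lt_or_eq.1 hj with hlt | rfl
    · rw [Function.update_of_ne (by omega)]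
      exact hI j hlt
    · rw [Function.update_self]
  · rw [hc.succ]
    rintro t s' hf ⟨hI, ht⟩
    exact ⟨fun j hj => hI j (by omega), by omega⟩

theorem runs_setEnds (hc : Ctx S k w s) :
    Runs w setEnds s fun t s' => (∀ j ≤ k, s'.arr aR (cell S j 0) = s.arr aP (j + 1)) ∧
      t ≤ 40 * k + 40 := by
  have hlen := hc.le
  have h1 := hc.one_mod
  have hw0 : 0 % 2 ^ w = 0 := Nat.zero_mod _
  unfold setEnds
  refine (runs_for (fun i s' => ∀ j < i, s'.arr aR (cell S j 0) = s.arr aP (j + 1)) 20 rfl rfl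
    (by decide) (Nat.zero_le _) ?_ ?_ ?_).mono ?_
  · rw [hc.succ]
    exact small_lt hc.word (by omega)
  · simp
  · rw [hc.succ]
    rintro i s' - hik hxi hf hI
    have hc' : Ctx S k w s' := hc.frame rfl hf
    have fP := hf.arr aP rfl
    have m₁ := hc.small (i := i + 1) (by omega)
    refine runs_store ?_
    rw [hc'.cellExpr_eval (by simp [Expr.eval, hxi]; omega) (by simp [Expr.eval])]
    simp only [Expr.eval, BinOp.eval, hxi, fP, h1, m₁, hw0]
    refine ⟨fun j hj => ?_, by simp [Expr.cost, cellExpr]⟩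
    simp only [setVar_arr, setArr_arr, if_true]
    rcases Nat.lt_succ_iff_lt_or_eq.1 hj with hlt | rfl
    · rw [Function.update_of_ne (by rw [Ne, cell_inj (by omega) (by omega)]; omega)]
      exact hI j hlt
    · rw [Function.update_self]
  · rw [hc.succ]
    rintro t s' hf ⟨hI, ht⟩
    exact ⟨fun j hj => hI j (by omega), by omega⟩

theorem runs_setTops (hc : Ctx S k w s) (hd : s.var vD ≤ S.length) :
    Runs w setTops s fun t s' =>
      (∀ j, 1 ≤ j → j < k → s'.arr aR (cell S j 0) = s.arr aR (cell S j (s.var vD))) ∧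
      s'.arr aR (cell S k 0) = s.arr aR (cell S k 0) ∧ t ≤ 40 * k + 40 := by
  have hlen := hc.le
  have h1 := hc.one_mod
  have hw0 : 0 % 2 ^ w = 0 := Nat.zero_mod _
  unfold setTops
  refine (runs_for (fun i s' =>
    (∀ j, 1 ≤ j → j < i → s'.arr aR (cell S j 0) = s.arr aR (cell S j (s.var vD))) ∧
    ∀ j t, t ≤ S.length + 1 → i ≤ j → s'.arr aR (cell S j t) = s.arr aR (cell S j t)) 30 rfl rfl
    (by decide) ?_ ?_ ?_ ?_).mono ?_
  · rw [hc.pow]; exact hc.pos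
  · rw [hc.pow]
    exact small_lt hc.word (by omega)
  · exact ⟨fun j h₁ h₂ => by omega, fun _ _ _ _ => rfl⟩
  · rw [hc.pow]
    rintro i s' hi hik hxi hf ⟨i₁, i₂⟩
    have hc' : Ctx S k w s' := hc.frame rfl hf
    have fD := hf.var vD rfl
    refine runs_store ?_
    have hev : (Expr.load aR (cellExpr (.var vZ) (.var vD))).eval w s' =
        s'.arr aR (cell S i (s.var vD)) := by
      rw [Expr.eval, hc'.cellExpr_eval (by simp [Expr.eval, hxi]; omega)
        (by simp [Expr.eval, fD]; omega)]
      simp only [Expr.eval, hxi, fD]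
    rw [hc'.cellExpr_eval (by simp [Expr.eval, hxi]; omega) (by simp [Expr.eval]), hev]
    simp only [Expr.eval, hxi, hw0, i₂ i (s.var vD) (by omega) le_rfl]
    refine ⟨⟨fun j hj hji => ?_, fun j t ht hij => ?_⟩, by simp [Expr.cost, cellExpr]⟩
    · simp only [setVar_arr, setArr_arr, if_true]
      rcases Nat.lt_succ_iff_lt_or_eq.1 hji with hlt | rfl
      · rw [Function.update_of_ne (by rw [Ne, cell_inj (by omega) (by omega)]; omega)]
        exact i₁ j hj hlt
      · rw [Function.update_self]
    · simp only [setVar_arr, setArr_arr, if_true]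
      rw [Function.update_of_ne (by rw [Ne, cell_inj (by omega) (by omega)]; omega)]
      exact i₂ j t ht (by omega)
  · rw [hc.pow]
    rintro t s' hf ⟨⟨i₁, i₂⟩, ht⟩
    exact ⟨i₁, i₂ k 0 (by omega) le_rfl, by omega⟩

/-- The intervals between cuts are disjoint, so their lengths telescope; this keeps an extra factor
`k` out of the number of search steps. -/
theorem sum_Ico_sub_eq {P : ℕ → ℕ} {a b : ℕ} (hab : a ≤ b)
    (hP : ∀ i, a ≤ i → i < b → P i ≤ P (i + 1)) :
    ∑ i ∈ Finset.Ico a b, (P (i + 1) - P i) + P a = P b := by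
  induction b, hab using Nat.le_induction with
  | base => simp
  | succ b hab ih =>
    have h₁ := ih fun i hi hib => hP i hi (by omega)
    have h₂ := hP b hab (by omega)
    rw [Finset.sum_Ico_succ_top hab]
    omega

theorem runs_processTuple (hc : Ctx S k w s) {σ m D : ℕ} {H T : List ℕ} {P : ℕ → ℕ}
    (hm : s.var vM = m)
    (hT : s.var vT = s.arr aF σ * (S.length + 2)) (hr : IsTuple k D (s.arr aTup))
    (hm1 : 1 ≤ m) (hD : k * m + D ≤ S.count σ)
    (hP : P = cuts S (fun q => s.arr aOc (s.arr aF σ * (S.length + 2) + q)) k m (s.arr aTup))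
    (hH : Holds vHl aH H s) (hT' : Holds vTl aT T s)
    (hHlen : H.length ≤ S.length) (hTlen : T.length ≤ S.length) :
    Runs w processTuple s fun t s' => t ≤ (S.length + 1) * (5000 * (k * lg S.length)) ∧
      ∃ H' T', Holds vHl aH H' s' ∧ Holds vTl aT T' s' ∧ H.Sublist H' ∧ T.Sublist T' ∧
        Inextensible S k P H' T' ∧ (Valid S k P H' T' ∨ (H' = H ∧ T' = T)) := by
  set K := k * lg S.length with hK
  have hkK : k ≤ K := Nat.le_mul_of_pos_right _ (one_le_lg _)
  have hk1 := hc.pos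
  have hPlt : ∀ j ≤ k, P j < P (j + 1) := fun j hj => by
    rw [hP]; exact (cuts_lt (hc.table σ) hr hm1 hD hj).1
  have hP0 : P 0 = 0 := by rw [hP]; rfl
  have hPk : P (k + 1) = S.length + 1 := by rw [hP]; simp [cuts]
  have hPmono : ∀ i, i ≤ k + 1 → P i ≤ S.length + 1 := by
    intro i hi
    have := sum_Ico_sub_eq (P := P) hi fun j _ hj => (hPlt j (by omega)).le
    omega
  have hprod : ∀ c, c ≤ S.length → (c + 1) * (150 * K) ≤ 150 * ((S.length + 1) * K) := by
    intro c hcl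
    have e₁ : 150 * ((S.length + 1) * K) = (S.length + 1) * (150 * K) := by ring
    rw [e₁]
    exact Nat.mul_le_mul_right _ (by omega)
  have hprod' : (S.length + 1) * (1800 * K) = 1800 * ((S.length + 1) * K) := by ring
  have hprod'' : (S.length + 1) * (5000 * K) = 5000 * ((S.length + 1) * K) := by ring
  have hKprod : K ≤ (S.length + 1) * K := Nat.le_mul_of_pos_left _ (by omega)
  have hHl := hprod _ hHlen
  have hTl := hprod _ hTlen
  rw [hprod'']
  unfold processTuple
  refine runs_seq ((runs_setCuts hc hm hT hr hm1 hD).mono ?_)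
  rintro t₁ s₁ f₁ ⟨p₁, ht₁⟩
  rw [← hP] at p₁
  have hc₁ : Ctx S k w s₁ := hc.frame rfl f₁
  refine runs_seq ((runs_setLeft hc₁).mono ?_)
  rintro t₂ s₂ f₂ ⟨p₂, ht₂⟩
  have hc₂ : Ctx S k w s₂ := hc₁.frame rfl f₂
  have gP₂ : s₂.arr aP = s₁.arr aP := f₂.arr aP rfl
  refine runs_seq ((runs_setEnds hc₂).mono ?_)
  rintro t₃ s₃ f₃ ⟨p₃, ht₃⟩
  have hc₃ : Ctx S k w s₃ := hc₂.frame rfl f₃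
  have hL₃ : ∀ j ≤ k, s₃.arr aL j = P j := fun j hj => by
    rw [f₃.arr aL rfl, p₂ j hj, p₁ j (by omega)]
  have hR₃ : ∀ j ≤ k, s₃.arr aR (cell S j 0) = P (j + 1) := fun j hj => by
    rw [p₃ j hj, gP₂, p₁ _ (by omega)]
  have hP₃ : ∀ j ≤ k + 1, s₃.arr aP j = P j := fun j hj => by
    rw [f₃.arr aP rfl, gP₂, p₁ j hj]
  have hH₃ : Holds vHl aH H s₃ :=
    ((hH.frame (f₁.var _ rfl) (f₁.arr _ rfl)).frame (f₂.var _ rfl) (f₂.arr _ rfl)).frame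
      (f₃.var _ rfl) (f₃.arr _ rfl)
  have hT₃ : Holds vTl aT T s₃ :=
    ((hT'.frame (f₁.var _ rfl) (f₁.arr _ rfl)).frame (f₂.var _ rfl) (f₂.arr _ rfl)).frame
      (f₃.var _ rfl) (f₃.arr _ rfl)
  have hrF : ∀ i, i ∈ range false k ↔ i < k := fun i => by simp [mem_range, firstIdx]
  have hrT : ∀ i, i ∈ range true k ↔ 1 ≤ i ∧ i ≤ k := fun i => by
    simp [mem_range, firstIdx]; omega
  -- Loading `H` into the full intervals computes its rightmost starts, the right ends for the pass
  -- over `T`. If `H` does not fit, the pair is not valid and there is nothing to extend.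
  have hcomF : Common S (range false k) (s₃.arr aL) (fun i => P (i + 1)) H ↔
      ∀ j < k, Emb S H (P j) (P (j + 1)) := by
    constructor
    · intro h j hj
      rw [← hL₃ j hj.le]; exact h j ((hrF j).2 hj)
    · intro h j hj
      rw [hrF] at hj
      rw [hL₃ j hj.le]; exact h j hj
  refine runs_seq ((runs_loadStr hc₃ false (e := fun i => P (i + 1)) hH₃ hHlen
    fun i hi => ?_).mono ?_)
  · rw [hrF] at hi
    rw [hR₃ i hi.le, hL₃ i hi.le]
    exact ⟨rfl, hPlt i hi.le⟩
  rintro t₄ s₄ f₄ ⟨p₄, q₄, ht₄⟩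
  rw [← hK] at ht₄
  have hc₄ : Ctx S k w s₄ := hc₃.frame rfl f₄
  have hH₄ : Holds vHl aH H s₄ := hH₃.frame (f₄.var _ rfl) (f₄.arr _ rfl)
  have hT₄ : Holds vTl aT T s₄ := hT₃.frame (f₄.var _ rfl) (f₄.arr _ rfl)
  rcases p₄ with ⟨e₄, st₄, com₄⟩ | ⟨e₄, com₄⟩
  swap
  · refine runs_cond_true (by simp [Expr.eval, e₄]) (runs_skip ⟨?_, H, T, hH₄, hT₄,
      .refl _, .refl _, inextensible_of_not_valid fun hv => com₄ (hcomF.2 fun j hj => ?_),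
      .inr ⟨rfl, rfl⟩⟩)
    · simp only [Expr.cost]; omega
    · rcases Nat.eq_zero_or_pos j with rfl | hj0
      · rw [hP0]; exact hv.1
      · exact (hv.2.1 j hj0 hj).sublist (List.sublist_append_right _ _)
  rw [hcomF] at com₄
  refine runs_cond_false (by simpa [Expr.eval] using e₄)
    (runs_seq ((runs_setTops hc₄ (by rw [st₄.depth]; exact hHlen)).mono ?_))
  rintro t₅ s₅ f₅ ⟨p₅, q₅, ht₅⟩
  have hc₅ : Ctx S k w s₅ := hc₄.frame rfl f₅
  have hH₅ : Holds vHl aH H s₅ := hH₄.frame (f₅.var _ rfl) (f₅.arr _ rfl)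
  have hT₅ : Holds vTl aT T s₅ := hT₄.frame (f₅.var _ rfl) (f₅.arr _ rfl)
  set e' : ℕ → ℕ := fun j => if j = k then S.length + 1 else rightmost S (P (j + 1)) H with he'
  have he'k : e' k = S.length + 1 := by simp [he']
  have he'j : ∀ j, 1 ≤ j → j < k → e' j = rightmost S (P (j + 1)) H := fun j _ hj => by
    simp [he', hj.ne]
  have hL₅ : ∀ j ≤ k, s₅.arr aL j = P j := fun j hj => by
    rw [f₅.arr aL rfl, f₄.arr aL rfl, hL₃ j hj]
  have hP₅ : ∀ j ≤ k + 1, s₅.arr aP j = P j := fun j hj => by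
    rw [f₅.arr aP rfl, f₄.arr aP rfl, hP₃ j hj]
  have hR₅ : ∀ j, 1 ≤ j → j ≤ k → s₅.arr aR (cell S j 0) = e' j ∧ P j < e' j := by
    intro j hj hjk
    rcases Nat.lt_or_eq_of_le hjk with hlt | rfl
    · rw [p₅ j hj hlt, st₄.depth, st₄.top ((hrF j).2 hlt), he'j j hj hlt]
      exact ⟨rfl, emb_iff.1 (com₄ j hlt)⟩
    -- Interval `k` takes no part in the loading of `H`, so its right end is still the end of the
    -- string.
    · rw [q₅, q₄ _ (by rw [hrF]; omega) 0 (by omega), hR₃ _ le_rfl, he'k, hPk]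
      exact ⟨rfl, hPk ▸ hPlt _ le_rfl⟩
  have hv₁ : ∀ X, Valid S k P H X ↔ Common S (range true k) (s₅.arr aL) e' X := by
    intro X
    rw [valid_iff_common_right (e := e') hk1 (hP0 ▸ com₄ 0 hk1) he'j he'k]
    exact forall₂_congr fun i hi => by
      rw [hL₅ i (by have := (Finset.mem_Ico.1 hi).2; omega)]
  refine runs_seq ((runs_loadStr hc₅ true (e := e') hT₅ hTlen fun i hi => ?_).mono ?_)
  · rw [hrT] at hi
    rw [hL₅ i hi.2]
    exact hR₅ i hi.1 hi.2
  rintro t₆ s₆ f₆ ⟨p₆, -, ht₆⟩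
  rw [← hK] at ht₆
  have hc₆ : Ctx S k w s₆ := hc₅.frame rfl f₆
  have hH₆ : Holds vHl aH H s₆ := hH₅.frame (f₆.var _ rfl) (f₆.arr _ rfl)
  have hT₆ : Holds vTl aT T s₆ := hT₅.frame (f₆.var _ rfl) (f₆.arr _ rfl)
  rcases p₆ with ⟨e₆, st₆, com₆⟩ | ⟨e₆, com₆⟩
  swap
  · refine runs_cond_true (by simp [Expr.eval, e₆]) (runs_skip ⟨?_, H, T, hH₆, hT₆,
      .refl _, .refl _, inextensible_of_not_valid fun hv => com₆ ((hv₁ T).1 hv),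
      .inr ⟨rfl, rfl⟩⟩)
    simp only [Expr.cost]; omega
  have gL₆ : s₆.arr aL = s₅.arr aL := f₆.arr aL rfl
  have he'le : ∀ i ∈ range true k, e' i ≤ P (i + 1) := by
    intro i hi
    rw [hrT] at hi
    rcases Nat.lt_or_eq_of_le hi.2 with hlt | rfl
    · rw [he'j i hi.1 hlt]; exact rightmost_le
    · rw [he'k, hPk]
  refine runs_cond_false (by simpa [Expr.eval] using e₆)
    (runs_seq ((runs_extend hc₆ (o := true) (e := e') (B := T) ?_ ?_ st₆
      (by rw [gL₆]; exact com₆)).mono ?_))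
  · intro i hi
    have h₁ := he'le i hi
    have h₂ := hPmono (i + 1) (by rw [hrT] at hi; omega)
    omega
  · have h₁ : ∑ i ∈ range true k, (e' i - s₆.arr aL i) ≤
        ∑ i ∈ range true k, (P (i + 1) - P i) := Finset.sum_le_sum fun i hi => by
      rw [gL₆, hL₅ i (by rw [hrT] at hi; omega)]
      exact Nat.sub_le_sub_right (he'le i hi) _
    have h₂ := sum_Ico_sub_eq (P := P) (show 1 ≤ 1 + k by omega)
      fun i _ hi => (hPlt i (by omega)).le
    rw [Nat.add_comm 1 k, hPk] at h₂
    have h₃ : ∑ i ∈ range true k, (P (i + 1) - P i) =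
      ∑ i ∈ Finset.Ico 1 (k + 1), (P (i + 1) - P i) := by
      rw [range, firstIdx, Nat.add_comm 1 k]
    omega
  rintro t₇ s₇ f₇ ⟨ht₇, q₇, T', hT'₇, hTT', hsearch, hmax₁⟩
  have hc₇ : Ctx S k w s₇ := hc₆.frame rfl f₇
  have hH₇ : Holds vHl aH H s₇ := hH₆.frame (f₇.var _ rfl) (f₇.arr _ rfl)
  rw [gL₆] at hsearch hmax₁
  have hval₁ : Valid S k P H T' := (hv₁ T').2 (by simpa using hsearch.common)
  -- The pass over `T` runs through intervals `1` to `k` and leaves interval `0` at its start.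
  have hL₇0 : s₇.arr aL 0 = 0 := by
    rw [q₇ 0 (by rw [hrT]; omega), gL₆, hL₅ 0 (by omega), hP0]
  have hleft : ∀ j, 1 ≤ j → j < k → Emb S T' (P j) (s₇.arr aL j + 1) := fun j hj hjk => by
    have := hsearch.left j ((hrT j).2 ⟨hj, hjk.le⟩)
    rwa [hL₅ j hjk.le] at this
  -- Only interval `k` was searched after `T'` was complete. In the others the reached position is
  -- the leftmost end of `T'`, as the pass over `H` requires.
  have hv₂ : ∀ X, Valid S k P X T' ↔
      Common S (range false k) (s₇.arr aL) (fun j => P (j + 1)) X := fun X =>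
    valid_iff_common_left hk1 hL₇0 hleft (fun j hj hjk m hE =>
      hsearch.leftmost rfl j ((hrT j).2 ⟨hj, hjk.le⟩) (by simp [lastIdx]; omega) m
        (by rwa [hL₅ j hjk.le])) hval₁.2.2
  have hcom₇ := (hv₂ H).1 hval₁
  refine runs_seq ((runs_setEnds hc₇).mono ?_)
  rintro t₈ s₈ f₈ ⟨p₈, ht₈⟩
  have hc₈ : Ctx S k w s₈ := hc₇.frame rfl f₈
  have gL₈ : s₈.arr aL = s₇.arr aL := f₈.arr aL rfl
  have hH₈ : Holds vHl aH H s₈ := hH₇.frame (f₈.var _ rfl) (f₈.arr _ rfl)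
  have hT₈ : Holds vTl aT T' s₈ := hT'₇.frame (f₈.var _ rfl) (f₈.arr _ rfl)
  refine runs_seq ((runs_loadStr hc₈ false (e := fun i => P (i + 1)) hH₈ hHlen
    fun i hi => ?_).mono ?_)
  · refine ⟨?_, ?_⟩
    · rw [hrF] at hi
      rw [p₈ i hi.le, f₇.arr aP rfl, f₆.arr aP rfl, hP₅ _ (by omega)]
    · rw [gL₈]; exact (hcom₇ i hi).lt
  rintro t₉ s₉ f₉ ⟨p₉, -, ht₉⟩
  rw [← hK] at ht₉
  have hc₉ : Ctx S k w s₉ := hc₈.frame rfl f₉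
  have hT₉ : Holds vTl aT T' s₉ := hT₈.frame (f₉.var _ rfl) (f₉.arr _ rfl)
  have gL₉ : s₉.arr aL = s₇.arr aL := (f₉.arr aL rfl).trans gL₈
  -- The old `H` is valid together with `T'`, so reloading it cannot fail.
  obtain ⟨e₉, st₉, com₉⟩ := p₉.resolve_right fun h => h.2 (by rw [gL₈]; exact hcom₇)
  refine (runs_extend hc₉ (o := false) (e := fun i => P (i + 1)) (B := H) ?_ ?_ st₉
      (by rw [gL₉]; exact hcom₇)).mono ?_
  · intro i hi
    rw [hrF] at hi
    exact hPmono (i + 1) (by omega)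
  · have h₁ : ∑ i ∈ range false k, (P (i + 1) - s₉.arr aL i) ≤
        ∑ i ∈ range false k, (P (i + 1) - P i) := Finset.sum_le_sum fun i hi => by
      rw [hrF] at hi
      refine Nat.sub_le_sub_left ?_ _
      rcases Nat.eq_zero_or_pos i with rfl | hi0
      · rw [hP0]; exact Nat.zero_le _
      · rw [gL₉]
        have := (hleft i hi0 hi).lt
        omega
    have h₂ := sum_Ico_sub_eq (P := P) (show 0 ≤ 0 + k by omega)
      fun i _ hi => (hPlt i (by omega)).le
    have h₃ := hPmono (0 + k) (by omega)
    have h₄ : ∑ i ∈ range false k, (P (i + 1) - P i) =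
      ∑ i ∈ Finset.Ico 0 (0 + k), (P (i + 1) - P i) := rfl
    omega
  rintro t₁₀ s₁₀ f₁₀ ⟨ht₁₀, -, H', hH'₁₀, hHH', hsearch₂, hmax₂⟩
  rw [gL₉] at hsearch₂ hmax₂
  have hT₁₀ : Holds vTl aT T' s₁₀ := hT₉.frame (f₁₀.var _ rfl) (f₁₀.arr _ rfl)
  have hval₂ : Valid S k P H' T' := (hv₂ H').2 (by simpa using hsearch₂.common)
  refine ⟨?_, H', T', hH'₁₀, hT₁₀, hHH', hTT', fun H'' T'' hH'' hT'' hv => ?_, .inl hval₂⟩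
  · simp only [Expr.cost]
    rw [hprod'] at ht₇ ht₁₀
    omega
  · have e₁ : T'' = T' := hmax₁ T'' hT''
      ((hv₁ T'').1 (hv.sublist (hHH'.trans hH'') (.refl _)))
    subst e₁
    exact ⟨hmax₂ H'' hH'' ((hv₂ H'').1 hv), rfl⟩

end WordRAM

namespace WordRAM

/-! ### The loop over all choices of cuts -/

/-- Replace the current tuple by the next one, or clear `vMore` if there is none. -/
def advanceTuple : Cmd :=
  .assign vZ (.const 0) ;;
  .loop ((.var vZ <ₑ .var vK) *ₑ (.load aTup (.var vZ) =ₑ .load aTup (.var vZ +ₑ .const 1)))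
    (.assign vZ (.var vZ +ₑ .const 1)) ;;
  .cond (.var vZ <ₑ .var vK)
    (.store aTup (.var vZ) (.load aTup (.var vZ) +ₑ .const 1) ;;
     .for vX 0 vZ (.store aTup (.var vX) (.const 0)))
    (.assign vMore (.const 0))

/-- Process all choices of cuts. -/
def mainLoop : Cmd :=
  .assign vMore (.const 1) ;; .loop (.var vMore) (processTuple ;; advanceTuple)

variable {S : List ℕ} {k w : ℕ} {s : Memory}

theorem runs_advanceTuple (hc : Ctx S k w s) {D : ℕ} (hr : IsTuple k D (s.arr aTup))
    (hD : s.arr aTup k = D) (hDn : D ≤ S.length) :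
    Runs w advanceTuple s fun t s' => t ≤ 60 * k + 60 ∧
      ((s'.var vMore = s.var vMore ∧ ∃ i < k, s.arr aTup i < s.arr aTup (i + 1) ∧
          (∀ j < i, s.arr aTup j = s.arr aTup i) ∧ s'.arr aTup = nextTuple i (s.arr aTup)) ∨
        (s'.var vMore = 0 ∧ (∀ j < k, s.arr aTup j = D) ∧ s'.arr aTup = s.arr aTup)) := by
  have hlen := hc.le
  have h1 := hc.one_mod
  have hw0 : 0 % 2 ^ w = 0 := Nat.zero_mod _
  set r := s.arr aTup with hrdef
  unfold advanceTuple
  refine runs_seq (runs_assign (runs_seq ((runs_loop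
    (fun s' => s'.var vZ ≤ k ∧ ∀ j < s'.var vZ, r j = r (s'.var vZ))
    (fun s' => (k - s'.var vZ) * 20) ?_ ?_).mono ?_)))
  · simp [Expr.eval]
  · rintro s' hf ⟨i₁, i₂⟩ hne
    have fK := hf.var vK rfl
    have fT := hf.arr aTup rfl
    simp [hc.pow, ← hrdef] at fK fT
    have m₁ := hc.small (i := s'.var vZ + 1) (by omega)
    simp only [Expr.eval, BinOp.eval, fK, fT, h1, m₁] at hne
    have hlt : s'.var vZ < k := by
      by_contra hcon
      simp [hcon] at hne
    have heq : r (s'.var vZ) = r (s'.var vZ + 1) := by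
      by_contra hcon
      simp [hcon] at hne
    refine runs_assign ?_
    simp only [Expr.eval, BinOp.eval, h1, m₁, setVar_var, if_true]
    refine ⟨⟨by omega, fun j hj => ?_⟩, ?_, ?_⟩
    · rcases Nat.lt_succ_iff_lt_or_eq.1 hj with hj | rfl
      · rw [i₂ j hj, heq]
      · exact heq
    · simp [Expr.cost]; omega
    · omega
  · rintro t s' hf ⟨⟨i₁, i₂⟩, hend, ht⟩
    have fK := hf.var vK rfl
    have fM := hf.var vMore rfl
    have fT := hf.arr aTup rfl
    simp [hc.pow, ← hrdef] at fK fM fT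
    have hc' : Ctx S k w s' := (hc.setVar (by omega)).frame rfl hf
    have m₁ := hc.small (i := s'.var vZ + 1) (by omega)
    simp only [Expr.eval, BinOp.eval, fK, fT, h1, m₁] at hend
    simp only [Expr.cost, setVar_var, if_true, Expr.eval, hw0] at ht
    set i := s'.var vZ with hi
    refine runs_cond (fun hlt => runs_seq (runs_store ?_)) (fun hge => runs_assign ?_)
    · simp only [Expr.eval, BinOp.eval, ← hi, fK, ne_eq, hc.test, not_not] at hlt
      have hne : r i ≠ r (i + 1) := by
        intro heq
        simp [hlt, heq, h1] at hend
      -- The loop stopped at the first change of value; at the last index the comparison is with the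
      -- sentinel `D`.
      have hri : r i < r (i + 1) := by
        refine lt_of_le_of_ne ?_ hne
        rcases (show i + 1 = k ∨ i + 1 < k by omega) with hk | hk
        · rw [hk, hD]; exact hr.2 i hlt
        · exact hr.1 i (i + 1) (by omega) hk
      have hriD := hr.2 i hlt
      have m₂ := hc.small (i := r i + 1) (by omega)
      simp only [Expr.eval, BinOp.eval, ← hi, fT, h1, m₂]
      refine (runs_for (fun x s₁ => s₁.arr aTup = fun j =>
        if j < x then 0 else if j = i then r i + 1 else r j) 20 rfl rfl (by decide)
        (Nat.zero_le _) ?_ ?_ ?_).mono ?_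
      · simp only [setArr_var, ← hi]
        exact small_lt hc.word (by omega)
      · funext j
        simp [fT, Function.update_apply]
      · simp only [setArr_var, ← hi]
        rintro x s₁ - hx hxx hf₁ hI
        refine runs_store ?_
        simp only [Expr.eval, hxx, hw0]
        refine ⟨?_, by simp [Expr.cost]⟩
        simp only [setVar_arr, setArr_arr, if_true, hI]
        funext j
        rw [Function.update_apply]
        split_ifs <;> first | rfl | omega
      · simp only [setArr_var, ← hi]
        rintro t' s₁ hf₁ ⟨hI, ht'⟩
        have gM := hf₁.var vMore rfl
        refine ⟨?_, .inl ⟨by rw [gM]; simpa using fM, i, hlt, hri, i₂, ?_⟩⟩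
        · simp [Expr.cost]; omega
        · rw [hI]; rfl
    · simp only [Expr.eval, BinOp.eval, ← hi, fK, hc.test] at hge
      have hik : i = k := by omega
      refine ⟨?_, .inr ⟨by simp [Expr.eval], fun j hj => ?_, fT⟩⟩
      · simp [Expr.cost]; omega
      · rw [← hD, ← hik]; exact i₂ j (by omega)

theorem cuts_congr {pos : ℕ → ℕ} {m : ℕ} {r r' : ℕ → ℕ} (h : ∀ j < k, r j = r' j) :
    cuts S pos k m r = cuts S pos k m r' := by
  funext j
  unfold cuts
  split_ifs with h₁ h₂
  · rfl
  · rw [h (j - 1) (by omega)]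
  · rfl

theorem runs_mainLoop (hc : Ctx S k w s) {σ : ℕ} {pos : ℕ → ℕ} {H T : List ℕ}
    (hpos : pos = fun q => s.arr aOc (s.arr aF σ * (S.length + 2) + q))
    (hcount : k ≤ S.count σ) (hm : s.var vM = S.count σ / k)
    (hT : s.var vT = s.arr aF σ * (S.length + 2))
    (hr : ∀ j < k, s.arr aTup j = 0) (hrk : s.arr aTup k = S.count σ % k)
    (hH : Holds vHl aH H s) (hT' : Holds vTl aT T s)
    (hTσ : (List.replicate (S.count σ / k - 1) σ).Sublist T)
    (hX : (List.replicate k (H ++ σ :: T)).flatten.Sublist S) :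
    Runs w mainLoop s fun t s' =>
      t ≤ (2 * k - 1).choose k * ((S.length + 1) * (5200 * (k * lg S.length))) + 10 ∧
      ∃ H' T', Holds vHl aH H' s' ∧ Holds vTl aT T' s' ∧
        (List.replicate (S.count σ / k - 1) σ).Sublist T' ∧
        IsMaximalKRepeating k S (H' ++ σ :: T') := by
  set m := S.count σ / k with hmdef
  set D := S.count σ % k with hDdef
  have hk1 := hc.pos
  have hDk : D < k := Nat.mod_lt _ hk1
  have hlen := hc.le
  have hm1 : 1 ≤ m := Nat.div_pos hcount hk1
  have hDm : k * m + D ≤ S.count σ := (Nat.div_add_mod _ _).le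
  have hkl : 1 ≤ (S.length + 1) * (k * lg S.length) :=
    Nat.mul_pos (by omega) (Nat.mul_pos hk1 (one_le_lg _))
  have hkl' : k ≤ (S.length + 1) * (k * lg S.length) :=
    (Nat.le_mul_of_pos_right _ (one_le_lg _)).trans (Nat.le_mul_of_pos_left _ (by omega))
  have e₁ : (S.length + 1) * (5000 * (k * lg S.length)) =
    5000 * ((S.length + 1) * (k * lg S.length)) := by ring
  have e₂ : (S.length + 1) * (5200 * (k * lg S.length)) =
    5200 * ((S.length + 1) * (k * lg S.length)) := by ring
  have hlenX : ∀ {H T : List ℕ}, (List.replicate k (H ++ σ :: T)).flatten.Sublist S →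
      H.length ≤ S.length ∧ T.length ≤ S.length := by
    intro H T h
    have := (isKRepeating_of_power hk1 h).1.length_le
    simp only [List.length_append, List.length_cons] at this
    omega
  have hpos' : IsOccTable S σ pos := by rw [hpos]; exact hc.table σ
  unfold mainLoop
  -- The pair is inextensible for all tuples of rank below the current one, and for all tuples once
  -- `vMore` is `0`.
  refine runs_seq (runs_assign ((runs_loop (fun s' => s'.var vMore ≤ 1 ∧
      IsTuple k D (s'.arr aTup) ∧ s'.arr aTup k = D ∧
      ∃ H T, Holds vHl aH H s' ∧ Holds vTl aT T s' ∧ (List.replicate (m - 1) σ).Sublist T ∧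
        (List.replicate k (H ++ σ :: T)).flatten.Sublist S ∧
        ∀ r, IsTuple k D r → (s'.var vMore = 1 → tupleRank k r < tupleRank k (s'.arr aTup)) →
          Inextensible S k (cuts S pos k m r) H T)
    (fun s' => ((D + k).choose k - 1 - tupleRank k (s'.arr aTup) + s'.var vMore) *
      ((S.length + 1) * (5200 * (k * lg S.length)))) ?_ ?_).mono ?_))
  · refine ⟨by simp [Expr.eval, hc.one_mod], ⟨fun i j hij hj => ?_, fun j hj => ?_⟩, hrk, H, T,
      ?_, ?_, hTσ, hX, fun r _ h => ?_⟩
    · simp [hr i (by omega)]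
    · simp [hr j hj]
    · exact hH.frame (by simp) rfl
    · exact hT'.frame (by simp) rfl
    · have h₀ := h (by simp [Expr.eval, hc.one_mod])
      have h₁ : tupleRank k (s.arr aTup) = 0 := Finset.sum_eq_zero fun j hj => by
        rw [hr j (Finset.mem_range.1 hj)]
        simp
      simp [h₁] at h₀
  · rintro s₁ hf ⟨i₁, i₂, i₃, H₁, T₁, hH₁, hT₁, hσ₁, hX₁, hmax₁⟩ hne
    simp only [Expr.eval] at hne
    have hmore : s₁.var vMore = 1 := by omega
    have hc₁ : Ctx S k w s₁ := (hc.setVar (by omega)).frame rfl hf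
    have fM := hf.var vM rfl
    have fT := hf.var vT rfl
    have fO := hf.arr aOc rfl
    have fF := hf.arr aF rfl
    simp [hm, hT] at fM fT fO fF
    rw [← fF] at fT
    obtain ⟨l₁, l₂⟩ := hlenX hX₁
    refine runs_seq ((runs_processTuple hc₁ (P := cuts S pos k m (s₁.arr aTup)) fM fT i₂ hm1 hDm
      (by rw [hpos, fO, fF]) hH₁ hT₁ l₁ l₂).mono ?_)
    rintro t₁ s₂ f₂ ⟨ht₁, H₂, T₂, hH₂, hT₂, hHH, hTT, hmax₂, hval⟩
    have hc₂ : Ctx S k w s₂ := hc₁.frame rfl f₂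
    have gT : s₂.arr aTup = s₁.arr aTup := f₂.arr aTup rfl
    have gM : s₂.var vMore = 1 := (f₂.var vMore rfl).trans hmore
    have hX₂ : (List.replicate k (H₂ ++ σ :: T₂)).flatten.Sublist S := by
      -- The power still embeds: either along the current cuts, or because the pair was left alone.
      rcases hval with hv | ⟨rfl, rfl⟩
      · exact hv.sublist_power hk1 fun j hj hjk => (cuts_lt hpos' i₂ hm1 hDm hjk).2 hj
      · exact hX₁
    have hall : ∀ r, IsTuple k D r → tupleRank k r ≤ tupleRank k (s₁.arr aTup) →
        Inextensible S k (cuts S pos k m r) H₂ T₂ := by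
      intro r hr hle
      rcases Nat.lt_or_eq_of_le hle with hlt | heq
      · exact (hmax₁ r hr fun _ => hlt).mono hHH hTT
      · rw [cuts_congr (tupleRank_injective hr i₂ heq)]
        exact hmax₂
    refine (runs_advanceTuple hc₂ (D := D) (by rw [gT]; exact i₂) (by rw [gT]; exact i₃)
      (by omega)).mono ?_
    rintro t₂ s₃ f₃ ⟨ht₂, hcase⟩
    rw [gT, gM] at hcase
    have hH₃ : Holds vHl aH H₂ s₃ := hH₂.frame (f₃.var _ rfl) (f₃.arr _ rfl)
    have hT₃ : Holds vTl aT T₂ s₃ := hT₂.frame (f₃.var _ rfl) (f₃.arr _ rfl)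
    have hrank := tupleRank_lt i₂
    rw [e₁] at ht₁
    have hfin : ∀ x y, x < y → (Expr.var vMore).cost + 1 + (t₁ + t₂) +
        x * ((S.length + 1) * (5200 * (k * lg S.length))) ≤
        y * ((S.length + 1) * (5200 * (k * lg S.length))) := by
      intro x y hxy
      have h₁ := Nat.mul_le_mul_right ((S.length + 1) * (5200 * (k * lg S.length)))
        (Nat.succ_le_of_lt hxy)
      rw [Nat.succ_mul] at h₁
      refine le_trans ?_ h₁
      rw [e₂]
      simp only [Expr.cost]
      omega
    have hpos5 : 0 < (S.length + 1) * (5200 * (k * lg S.length)) := by rw [e₂]; omega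
    rw [hmore]
    rcases hcase with ⟨gM₃, i, hik, hlt, hcst, hnext⟩ | ⟨gM₃, hcst, hsame⟩
    · have hrk' : tupleRank k (s₃.arr aTup) = tupleRank k (s₁.arr aTup) + 1 := by
        rw [hnext, tupleRank_next hik hcst]
      have htup : IsTuple k D (s₃.arr aTup) := by
        rw [hnext]; exact i₂.next i₃ hik hlt
      have hrank' := tupleRank_lt htup
      refine ⟨⟨gM₃.le, htup, ?_, H₂, T₂, hH₃, hT₃, hσ₁.trans hTT, hX₂, fun r hr h => ?_⟩, ?_, ?_⟩
      · rw [hnext, nextTuple, if_neg (by omega), if_neg (by omega)]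
        exact i₃
      · have := h gM₃
        exact hall r hr (by omega)
      · rw [gM₃, hrk']
        exact hfin _ _ (by omega)
      · rw [gM₃, hrk']
        exact Nat.mul_lt_mul_of_pos_right (by omega) hpos5
    · refine ⟨⟨by omega, by rw [hsame]; exact i₂, by rw [hsame]; exact i₃, H₂, T₂, hH₃, hT₃,
        hσ₁.trans hTT, hX₂, fun r hr _ => hall r hr ?_⟩, ?_, ?_⟩
      -- The tuple with all entries `D` has the largest possible rank, so every tuple has been
      -- processed.
      · have h₁ := tupleRank_const k D hcst
        have h₂ := tupleRank_lt hr
        omega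
      · rw [gM₃, hsame]
        exact hfin _ _ (by omega)
      · rw [gM₃, hsame]
        exact Nat.mul_lt_mul_of_pos_right (by omega) hpos5
  · rintro t s' hf ⟨⟨-, -, -, H₁, T₁, hH₁, hT₁, hσ₁, hX₁, hmax₁⟩, hend, ht⟩
    simp only [Expr.eval] at hend
    refine ⟨?_, H₁, T₁, hH₁, hT₁, hσ₁, isMaximalKRepeating hk1 hpos' hcount hσ₁ hX₁
      fun r hr => hmax₁ r hr fun h => by omega⟩
    -- Here `D ≤ k - 1`, since `D` is a remainder modulo `k`.
    have hch : (D + k).choose k ≤ (2 * k - 1).choose k := Nat.choose_le_choose _ (by omega)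
    have hpos1 : 0 < (D + k).choose k := Nat.choose_pos (by omega)
    have h₁ : (D + k).choose k - 1 - tupleRank k ((s.setVar vMore
        ((Expr.const 1).eval w s)).arr aTup) + (s.setVar vMore ((Expr.const 1).eval w s)).var vMore ≤
        (2 * k - 1).choose k := by
      simp only [setVar_var, if_true, Expr.eval, hc.one_mod]
      omega
    have h₂ := Nat.mul_le_mul_right ((S.length + 1) * (5200 * (k * lg S.length))) h₁
    simp only [Expr.cost] at ht ⊢
    omega

end WordRAM

namespace WordRAM

/-! ### Preprocessing, output and the whole program -/

/-- Build the table of occurrences and find a letter that occurs at least `vK` times. -/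
def preprocess : Cmd :=
  .assign vW (.var vN +ₑ .const 2) ;;
  .for vP 0 vN
    (.assign vC (.load aS (.var vP)) ;;
     .cond (.load aF (.var vC)) .skip (.store aF (.var vC) (.var vP +ₑ .const 1)) ;;
     .assign vId (.load aF (.var vC)) ;;
     .store aCn (.var vId) (.load aCn (.var vId) +ₑ .const 1) ;;
     .store aOc (cellExpr (.var vId) (.load aCn (.var vId))) (.var vP +ₑ .const 1) ;;
     .cond (.load aCn (.var vId) <ₑ .var vK) .skip
       (.assign vSig (.var vC) ;; .assign vFound (.const 1)))

/-- Set up the variables of the main phase. -/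
def prepare : Cmd :=
  .assign vK1 (.var vK +ₑ .const 1) ;;
  .assign vT (.load aCn (.load aF (.var vSig))) ;;
  .assign vM (.var vT /ₑ .var vK) ;;
  .store aTup (.var vK) (.var vT -ₑ .var vK *ₑ .var vM) ;;
  .assign vT (.load aF (.var vSig) *ₑ .var vW) ;;
  .assign vTl (.var vM -ₑ .const 1) ;;
  .for vX 0 vTl (.store aT (.var vX) (.var vSig))

/-- Write the string before the distinguished letter, this letter, and the string after it. -/
def writeOutput : Cmd :=
  .for vX 0 vHl (.store aOut (.var vX) (.load aH (.var vX))) ;;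
  .store aOut (.var vHl) (.var vSig) ;;
  .for vX 0 vTl (.store aOut (.var vHl +ₑ .const 1 +ₑ .var vX) (.load aT (.var vX))) ;;
  .assign vN (.var vHl +ₑ .const 1 +ₑ .var vTl)

/-- The program that computes a maximal `k`-repeating subsequence. -/
def program : Cmd :=
  preprocess ;;
  .cond (.var vFound) (prepare ;; mainLoop ;; writeOutput) (.assign vN (.const 0))

/-- The tables `F`, `Cn`, `Oc` describe the first `i` letters of `S`. -/
structure TableInv (S : List ℕ) (i : ℕ) (F Cn Oc : ℕ → ℕ) : Prop where
  le : ∀ c, F c ≤ i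
  mem : ∀ c, F c ≠ 0 ↔ c ∈ S.take i
  inj : ∀ c c', F c ≠ 0 → F c = F c' → c = c'
  cnt : ∀ c, Cn (F c) = (S.take i).count c
  fresh : ∀ v, i < v → Cn v = 0
  zero : ∀ v, Oc (cell S v 0) = 0
  occ : ∀ c q, 1 ≤ q → q ≤ (S.take i).count c →
    At S (Oc (cell S (F c) q)) c ∧ (S.take (Oc (cell S (F c) q))).count c = q

theorem take_succ_getD {S : List ℕ} {i : ℕ} (hi : i < S.length) :
    S.take (i + 1) = S.take i ++ [S.getD i 0] := by
  rw [List.take_add_one, List.getD, List.getElem?_eq_getElem hi]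
  rfl

/-- A letter is numbered by the position of its first occurrence. The number `i + 1` exceeds all
earlier ones, so its row and counter are unused. Number `0` is kept for absent letters, whose
counter stays `0`. -/
theorem TableInv.step {S : List ℕ} {i c : ℕ} {F F' Cn Oc : ℕ → ℕ} (h : TableInv S i F Cn Oc)
    (hi : i < S.length) (hc : c = S.getD i 0)
    (hF : F' = if F c = 0 then Function.update F c (i + 1) else F) :
    Cn (F' c) = (S.take i).count c ∧
    TableInv S (i + 1) F' (Function.update Cn (F' c) (Cn (F' c) + 1))
      (Function.update Oc (cell S (F' c) (Cn (F' c) + 1)) (i + 1)) := by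
  have hne : ∀ c', c' ≠ c → F' c' = F c' := by
    intro c' hc'
    rw [hF]
    split_ifs
    · rw [Function.update_of_ne hc']
    · rfl
  have hself : F' c = if F c = 0 then i + 1 else F c := by
    rw [hF]
    split_ifs <;> simp
  have hle : ∀ c', F' c' ≤ i + 1 := by
    intro c'
    have := h.le c'
    by_cases hc' : c' = c
    · rw [hc', hself]
      rw [hc'] at this
      split_ifs <;> omega
    · rw [hne c' hc']; omega
  have hF'c : F' c ≠ 0 := by rw [hself]; split_ifs <;> omega
  have hinj : ∀ c', F' c = F' c' → c' = c := by
    intro c' heq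
    by_contra hc'
    rw [hne c' hc', hself] at heq
    split_ifs at heq with h0
    · have := h.le c'
      omega
    · exact hc' (h.inj c c' h0 heq).symm
  have hcnt : Cn (F' c) = (S.take i).count c := by
    rw [hself]
    split_ifs with h0
    · rw [h.fresh _ (by omega), List.count_eq_zero.2 fun hm => (h.mem c).2 hm h0]
    · exact h.cnt c
  have htake : ∀ c', (S.take (i + 1)).count c' = (S.take i).count c' + if c' = c then 1 else 0 := by
    intro c'
    rw [take_succ_getD hi, ← hc, List.count_append, List.count_singleton]
    by_cases hc' : c' = c
    · subst hc'; simp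
    · simp [hc', Ne.symm hc']
  have hcl : (S.take i).count c ≤ i := List.count_le_length.trans (List.length_take_le _ _)
  refine ⟨hcnt, hle, fun c' => ?_, fun c₁ c₂ h₁ h₂ => ?_, fun c' => ?_, fun v hv => ?_,
    fun v => ?_, fun c' q hq hqc => ?_⟩
  · rw [take_succ_getD hi, ← hc, List.mem_append, List.mem_singleton]
    by_cases hc' : c' = c
    · subst hc'; simp [hF'c]
    · rw [hne c' hc', h.mem c']; simp [hc']
  · by_cases hc₁ : c₁ = c
    · rw [hc₁] at h₂ ⊢
      exact (hinj c₂ h₂).symm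
    · by_cases hc₂ : c₂ = c
      · rw [hc₂] at h₂ ⊢
        exact hinj c₁ h₂.symm
      · rw [hne c₁ hc₁] at h₁
        rw [hne c₁ hc₁, hne c₂ hc₂] at h₂
        exact h.inj c₁ c₂ h₁ h₂
  · rw [htake]
    by_cases hc' : c' = c
    · subst hc'; simp [hcnt]
    · rw [Function.update_of_ne fun hh => hc' (hinj c' hh.symm), hne c' hc', h.cnt c']
      simp [hc']
  · have h₁ := hle c
    rw [Function.update_of_ne (by omega)]
    exact h.fresh v (by omega)
  · rw [Function.update_of_ne (by rw [Ne, cell_inj (by omega) (by omega)]; omega)]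
    exact h.zero v
  · have hq' : q ≤ S.length := hqc.trans (List.count_le_length.trans (by simp))
    rw [htake] at hqc
    by_cases hc' : c' = c
    · subst hc'
      simp only [if_true] at hqc
      rcases Nat.lt_or_eq_of_le hqc with hlt | rfl
      · have hF0 : F c' ≠ 0 := (h.mem c').2 (List.count_pos_iff.1 (by omega))
        rw [Function.update_of_ne (by rw [Ne, cell_inj (by omega) (by omega)]; omega),
          hself, if_neg hF0]
        exact h.occ c' q hq (by omega)
      · rw [hcnt, Function.update_self]
        refine ⟨hc ▸ at_getD hi, ?_⟩
        rw [htake]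
        simp
    · simp only [hc', if_false, add_zero] at hqc
      rw [Function.update_of_ne (by
        rw [Ne, cell_inj (by omega) (by omega)]; exact fun hh => hc' (hinj c' hh.1.symm)),
        hne c' hc']
      exact h.occ c' q hq hqc

variable {S : List ℕ} {k w : ℕ} {s : Memory}

theorem runs_preprocess (hk : 1 ≤ k) (hw : (S.length + 2) * (S.length + 2) ≤ 2 ^ w) :
    Runs w preprocess (input S k) fun t s' => t ≤ 100 * (S.length + 1) ∧ Env S k s' ∧
      ((s'.var vFound = 0 ∧ ∀ c, S.count c < k) ∨
        (s'.var vFound = 1 ∧ k ≤ S.count (s'.var vSig))) := by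
  have hsmall : ∀ i ≤ 2 * S.length + 3, i % 2 ^ w = i := fun i hi =>
    Nat.mod_eq_of_lt (small_lt hw hi)
  have h1 := hsmall 1 (by omega)
  have h2 := hsmall 2 (by omega)
  have hW := hsmall (S.length + 2) (by omega)
  have hN : (input S k).var vN = S.length := rfl
  unfold preprocess
  refine runs_seq (runs_assign ?_)
  simp only [Expr.eval, BinOp.eval, hN, h2, hW]
  refine (runs_for (fun i s' => TableInv S i (s'.arr aF) (s'.arr aCn) (s'.arr aOc) ∧
      ((s'.var vFound = 0 ∧ ∀ c, (S.take i).count c < k) ∨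
        (s'.var vFound = 1 ∧ k ≤ (S.take i).count (s'.var vSig)))) 70 rfl rfl (by decide)
      (Nat.zero_le _) ?_ ?_ ?_).mono ?_
  · simp only [setVar_var, hN]
    exact small_lt hw (by simp; omega)
  · refine ⟨⟨fun c => le_rfl, by simp [input], by simp [input], by simp [input],
      fun v _ => rfl, fun v => rfl, fun c q hq hqc => ?_⟩, .inl ⟨rfl, fun c => ?_⟩⟩
    · simp at hqc; omega
    · simp; omega
  · have hNN : ((input S k).setVar vW (S.length + 2)).var vN = S.length := by simp [hN]
    rw [hNN]
    rintro i s' - hi hxi hf ⟨htab, hfound⟩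
    have fW := hf.var vW rfl
    have fK := hf.var vK rfl
    have fS := hf.arr aS rfl
    simp at fW
    have fK' : s'.var vK = k := fK
    have fS' : s'.arr aS i = S.getD i 0 := by rw [fS]; rfl
    set c := S.getD i 0 with hcdef
    have m₁ := hsmall (i + 1) (by omega)
    obtain ⟨hcnt, hstep⟩ := htab.step hi hcdef rfl
    set F' := (if s'.arr aF c = 0 then Function.update (s'.arr aF) c (i + 1) else s'.arr aF)
      with hF'
    have hF'le : F' c ≤ i + 1 := hstep.le c
    have hcl : (S.take i).count c ≤ i := List.count_le_length.trans (List.length_take_le _ _)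
    have htake : ∀ c', (S.take (i + 1)).count c' =
        (S.take i).count c' + if c' = c then 1 else 0 := by
      intro c'
      rw [take_succ_getD hi, ← hcdef, List.count_append, List.count_singleton]
      by_cases hc' : c' = c
      · subst hc'; simp
      · simp [hc', Ne.symm hc']
    refine runs_seq (runs_assign (runs_seq ?_))
    simp only [Expr.eval, hxi, fS', Expr.cost]
    -- the number of the letter
    have hnum : Runs w (.cond (.load aF (.var vC)) .skip
        (.store aF (.var vC) (.var vP +ₑ .const 1))) (s'.setVar vC c) fun t s₁ =>
        t ≤ 10 ∧ s₁.arr aF = F' ∧ s₁.var vC = c ∧ s₁.var = (s'.setVar vC c).var ∧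
          s₁.arr aCn = s'.arr aCn ∧ s₁.arr aOc = s'.arr aOc := by
      refine runs_cond (fun hne => runs_skip ?_) (fun heq => runs_store ?_)
      · simp [Expr.eval] at hne
        simp [hF', hne, Expr.cost]
      · simp [Expr.eval] at heq
        simp [hF', heq, Expr.cost, Expr.eval, BinOp.eval, hxi, h1, m₁]
    refine hnum.mono ?_
    rintro t₁ s₁ - ⟨ht₁, gF, gC, gv, gCn, gOc⟩
    have m₂ := hsmall ((S.take i).count c + 1) (by omega)
    refine runs_seq (runs_assign (runs_seq (runs_store (runs_seq (runs_store ?_)))))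
    simp only [Expr.eval, BinOp.eval, gC, gF, setVar_var, setVar_arr, setArr_var,
      if_true, gCn, hcnt, h1, m₂]
    set s₂ := (s₁.setVar vId (F' c)).setArr aCn (F' c) ((S.take i).count c + 1) with hs₂
    have kW : s₂.var vW = S.length + 2 := by
      rw [hs₂, setArr_var, setVar_var, if_neg (by decide), gv]; simpa using fW
    have kId : s₂.var vId = F' c := by simp [hs₂]
    have kK : s₂.var vK = k := by
      rw [hs₂, setArr_var, setVar_var, if_neg (by decide), gv]; simpa using fK'
    have kC : s₂.var vC = c := by simp [hs₂, gC]
    have kFo : s₂.var vFound = s'.var vFound := by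
      rw [hs₂, setArr_var, setVar_var, if_neg (by decide), gv]; simp
    have kSi : s₂.var vSig = s'.var vSig := by
      rw [hs₂, setArr_var, setVar_var, if_neg (by decide), gv]; simp
    have kCn : s₂.arr aCn = Function.update (s'.arr aCn) (F' c) ((S.take i).count c + 1) := by
      simp [hs₂, gCn]
    have kF : s₂.arr aF = F' := by simp [hs₂, gF]
    have kOc : s₂.arr aOc = s'.arr aOc := by simp [hs₂, gOc]
    clear_value s₂
    have hidx : (cellExpr (.var vId) (.load aCn (.var vId))).eval w s₂ =
        cell S (F' c) ((S.take i).count c + 1) := by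
      have b₁ := Nat.mod_eq_of_lt (index_lt (i := F' c) (d := (S.take i).count c + 1) hw
        (by omega) (by omega))
      have b₂ := Nat.mod_eq_of_lt (index_lt (i := F' c) (d := 0) hw (by omega) (by omega))
      simp only [Nat.add_zero] at b₂
      simp only [cellExpr, Expr.eval, BinOp.eval, kId, kW, kCn, Function.update_self, b₁, b₂, cell]
    have hcost : (cellExpr (.var vId) (.load aCn (.var vId))).cost = 6 := rfl
    have hif : (if vP = vId then F' c else s₁.var vP) = i := by
      rw [if_neg (by decide), gv]; simpa using hxi
    rw [hidx, hif, m₁]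
    rw [hcnt] at hstep
    refine runs_cond (fun hlt => runs_skip ?_) (fun hge => runs_seq (runs_assign
      (runs_assign ?_)))
    · simp [Expr.eval, BinOp.eval, kId, kCn, kK, test_eq_zero (small_lt (i := 1) hw (by omega))]
        at hlt
      simp [kF, kCn, kOc, kFo, kSi]
      refine ⟨⟨hstep, ?_⟩, by simp [Expr.cost, hcost]; omega⟩
      rcases hfound with ⟨f₁, f₂⟩ | ⟨f₁, f₂⟩
      · refine .inl ⟨f₁, fun c' => ?_⟩
        rw [htake]
        have := f₂ c'
        split_ifs with hc'
        · subst hc'; omega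
        · omega
      · refine .inr ⟨f₁, ?_⟩
        rw [htake]; omega
    · simp [Expr.eval, BinOp.eval, kId, kCn, kK, test_eq_zero (small_lt (i := 1) hw (by omega))]
        at hge
      simp [kF, kCn, kOc, kC, Expr.eval, h1]
      refine ⟨⟨hstep, ?_⟩, by simp [Expr.cost, hcost]; omega⟩
      rw [htake]; simpa using hge
  · have hNN : ((input S k).setVar vW (S.length + 2)).var vN = S.length := by simp [hN]
    rw [hNN]
    rintro t s' hf ⟨⟨htab, hfound⟩, ht⟩
    have fW := hf.var vW rfl
    have fK : s'.var vK = k := hf.var vK rfl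
    have fN : s'.var vN = S.length := hf.var vN rfl
    have fS : s'.arr aS = fun i => S.getD i 0 := hf.arr aS rfl
    simp at fW
    refine ⟨by simp [Expr.cost]; omega, ⟨fN, fK, fW, fS, htab.le, ?_, fun c => ⟨?_, ?_⟩⟩, ?_⟩
    · simpa using htab.cnt
    · exact htab.zero _
    · have := htab.occ c
      rw [List.take_length] at this
      exact this
    · simpa only [List.take_length] using hfound

end WordRAM

/-! ### Initialization, output and assembly of the program -/

namespace WordRAM

variable {S : List ℕ} {k w : ℕ} {s : Memory}

theorem runs_prepare (he : Env S k s) (hw : (S.length + 2) * (S.length + 2) ≤ 2 ^ w)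
    (hk : 1 ≤ k) {σ : ℕ} (hσ : s.var vSig = σ) (hcount : k ≤ S.count σ)
    (hTup : ∀ j, s.arr aTup j = 0) (hHl : s.var vHl = 0) :
    Runs w prepare s fun t s' => t ≤ 40 * (S.length + 1) ∧ Ctx S k w s' ∧
      s'.var vSig = σ ∧ s'.var vM = S.count σ / k ∧
      s'.var vT = s'.arr aF σ * (S.length + 2) ∧ (∀ j < k, s'.arr aTup j = 0) ∧
      s'.arr aTup k = S.count σ % k ∧ Holds vHl aH [] s' ∧
      Holds vTl aT (List.replicate (S.count σ / k - 1) σ) s' := by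
  have hcl : S.count σ ≤ S.length := List.count_le_length
  have hsmall : ∀ i ≤ 2 * S.length + 3, i % 2 ^ w = i := fun i hi =>
    Nat.mod_eq_of_lt (small_lt hw hi)
  have h1 := hsmall 1 (by omega)
  have m₁ := hsmall (k + 1) (by omega)
  have hdiv : S.count σ / k ≤ S.count σ := Nat.div_le_self _ _
  have m₂ := hsmall (S.count σ / k) (by omega)
  have hmul : k * (S.count σ / k) ≤ S.count σ := Nat.mul_div_le _ _
  have m₃ := hsmall (k * (S.count σ / k)) (by omega)
  have hmod : S.count σ - k * (S.count σ / k) = S.count σ % k := by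
    have := Nat.div_add_mod (S.count σ) k
    omega
  have m₄ := hsmall (S.count σ % k) ((Nat.mod_le _ _).trans (by omega))
  have m₅ := Nat.mod_eq_of_lt (index_lt (d := 0) hw (he.num_le σ) (by omega))
  simp only [Nat.add_zero] at m₅
  have m₆ := hsmall (S.count σ / k - 1) (by omega)
  unfold prepare
  refine runs_seq (runs_assign (runs_seq (runs_assign (runs_seq (runs_assign (runs_seq (runs_store
    (runs_seq (runs_assign (runs_seq (runs_assign ?_)))))))))))
  simp [Expr.eval, BinOp.eval, Expr.cost, he.pow, he.count, he.width, hσ, h1, m₁, m₂, m₃, hmod, m₄,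
    m₅, m₆]
  set s₀ := ((((((s.setVar vK1 (k + 1)).setVar vT (S.count σ)).setVar vM (S.count σ / k)).setArr
    aTup k (S.count σ % k)).setVar vT (s.arr aF σ * (S.length + 2))).setVar vTl
    (S.count σ / k - 1)) with hs₀
  have hc₀ : Ctx S k w s₀ := by
    refine ⟨he.frame ⟨?_, ?_, ?_⟩ ⟨?_, ?_, ?_, ?_⟩, ?_, hw, hk, hcount.trans hcl⟩ <;> simp [hs₀]
  have q₁ : s₀.var vTl = S.count σ / k - 1 := by simp [hs₀]
  have q₂ : s₀.var vSig = σ := by simp [hs₀, hσ]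
  have q₃ : s₀.var vM = S.count σ / k := by simp [hs₀]
  have q₄ : s₀.var vT = s.arr aF σ * (S.length + 2) := by simp [hs₀]
  have q₅ : s₀.arr aTup = Function.update (s.arr aTup) k (S.count σ % k) := by simp [hs₀]
  have q₆ : s₀.var vHl = 0 := by simp [hs₀, hHl]
  have q₇ : s₀.arr aF = s.arr aF := by simp [hs₀]
  clear_value s₀
  refine (runs_for (fun i s' => ∀ j < i, s'.arr aT j = σ) 10 rfl rfl (by decide)
    (Nat.zero_le _) ?_ ?_ ?_).mono ?_
  · rw [q₁]
    exact small_lt hw (by omega)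
  · simp
  · rintro i s' - hi hxi hf hI
    have fS := hf.var vSig rfl
    refine runs_store ?_
    simp only [Expr.eval, hxi, fS, q₂]
    refine ⟨fun j hj => ?_, by simp [Expr.cost]⟩
    simp only [setVar_arr, setArr_arr, if_true]
    rcases Nat.lt_succ_iff_lt_or_eq.1 hj with hlt | rfl
    · rw [Function.update_of_ne (by omega)]
      exact hI j hlt
    · rw [Function.update_self]
  · rintro t s' hf ⟨hI, ht⟩
    rw [q₁] at hI ht
    have f₁ : s'.arr aTup = _ := (hf.arr aTup rfl).trans q₅
    refine ⟨by omega, hc₀.frame rfl hf, (hf.var _ rfl).trans q₂, (hf.var _ rfl).trans q₃, ?_,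
      fun j hj => ?_, ?_, ⟨(hf.var _ rfl).trans q₆, by simp⟩, ⟨?_, ?_⟩⟩
    · rw [hf.var vT rfl, hf.arr aF rfl, q₄, q₇]
    · rw [f₁, Function.update_of_ne hj.ne, hTup]
    · rw [f₁, Function.update_self]
    · rw [hf.var vTl rfl, q₁, List.length_replicate]
    · intro i hi
      rw [List.length_replicate] at hi
      rw [hI i hi, List.getElem_replicate]

theorem output_eq {X : List ℕ} (hl : s.var 0 = X.length) (hx : ∀ i (h : i < X.length),
    s.arr 1 i = X[i]) : s.output = X := by
  refine List.ext_getElem (by simp [Memory.output, hl]) fun i h₁ h₂ => ?_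
  simp [Memory.output, hx i h₂]

theorem runs_writeOutput (hc : Ctx S k w s) {σ : ℕ} (hσ : s.var vSig = σ) {H T : List ℕ}
    (hH : Holds vHl aH H s) (hT : Holds vTl aT T s)
    (hlen : (H ++ σ :: T).length ≤ S.length) :
    Runs w writeOutput s fun t s' => t ≤ 60 * (S.length + 1) ∧ s'.output = H ++ σ :: T := by
  simp only [List.length_append, List.length_cons] at hlen
  have h1 := hc.one_mod
  have m₁ := hc.small (i := H.length + 1) (by omega)
  unfold writeOutput
  refine runs_seq ((runs_for (fun i s' => ∀ j < i, s'.arr aOut j = s.arr aH j) 20 rfl rfl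
    (by decide) (Nat.zero_le _) ?_ ?_ ?_).mono ?_)
  · rw [hH.len]
    exact small_lt hc.word (by omega)
  · simp
  · rintro i s' - hi hxi hf hI
    have fH := hf.arr aH rfl
    refine runs_store ?_
    simp only [Expr.eval, hxi, fH]
    refine ⟨fun j hj => ?_, by simp [Expr.cost]⟩
    simp only [setVar_arr, setArr_arr, if_true]
    rcases Nat.lt_succ_iff_lt_or_eq.1 hj with hlt | rfl
    · rw [Function.update_of_ne (by omega)]
      exact hI j hlt
    · rw [Function.update_self]
  rintro t s₁ f₁ ⟨p₁, ht⟩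
  rw [hH.len] at p₁ ht
  have g₁ : s₁.var vHl = H.length := (f₁.var _ rfl).trans hH.len
  have g₂ : s₁.var vSig = σ := (f₁.var _ rfl).trans hσ
  have g₃ : s₁.var vTl = T.length := (f₁.var _ rfl).trans hT.len
  have g₄ : s₁.arr aT = s.arr aT := f₁.arr _ rfl
  refine runs_seq (runs_store (runs_seq ((runs_for (fun i s' =>
    (∀ j < H.length, s'.arr aOut j = s.arr aH j) ∧ s'.arr aOut H.length = σ ∧
      ∀ j < i, s'.arr aOut (H.length + 1 + j) = s.arr aT j) 30 rfl rfl (by decide)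
    (Nat.zero_le _) ?_ ?_ ?_).mono ?_)))
  · rw [setArr_var, g₃]
    exact small_lt hc.word (by omega)
  · simp only [Expr.eval, g₁, g₂, setVar_arr, setArr_arr, if_true, Function.update_self]
    refine ⟨fun j hj => ?_, trivial, by simp⟩
    rw [Function.update_of_ne hj.ne, p₁ j hj]
  · rw [setArr_var, g₃]
    rintro i s' - hi hxi hf ⟨i₁, i₂, i₃⟩
    have fH := hf.var vHl rfl
    have fT := hf.arr aT rfl
    rw [setArr_var, g₁] at fH
    have fT' : s'.arr aT = s.arr aT := by rw [fT]; simp [g₄]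
    have m₂ := hc.small (i := H.length + 1 + i) (by omega)
    refine runs_store ?_
    simp only [Expr.eval, BinOp.eval, hxi, fH, fT', h1, m₁, m₂, setVar_arr, setArr_arr, if_true]
    refine ⟨⟨fun j hj => ?_, ?_, fun j hj => ?_⟩, by simp [Expr.cost]⟩
    · rw [Function.update_of_ne (by omega), i₁ j hj]
    · rw [Function.update_of_ne (by omega), i₂]
    · rcases Nat.lt_succ_iff_lt_or_eq.1 hj with hlt | rfl
      · rw [Function.update_of_ne (by omega)]
        exact i₃ j hlt
      · rw [Function.update_self]
  · rw [setArr_var, g₃]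
    rintro t' s₂ hf ⟨⟨i₁, i₂, i₃⟩, ht'⟩
    have k₁ : s₂.var vHl = H.length := (hf.var _ rfl).trans g₁
    have k₂ : s₂.var vTl = T.length := (hf.var _ rfl).trans g₃
    have m₂ := hc.small (i := H.length + 1 + T.length) (by omega)
    refine runs_assign ?_
    simp only [Expr.eval, BinOp.eval, k₁, k₂, h1, m₁, m₂]
    refine ⟨by simp [Expr.cost]; omega, output_eq ?_ fun i hi => ?_⟩
    · simp
      omega
    · simp only [setVar_arr]
      rcases Nat.lt_trichotomy i H.length with hlt | rfl | hlt
      · rw [i₁ i hlt, hH.get i hlt, List.getElem_append_left hlt]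
      · rw [i₂]
        simp
      · obtain ⟨j, rfl⟩ : ∃ j, i = H.length + 1 + j := ⟨i - (H.length + 1), by omega⟩
        simp only [List.length_append, List.length_cons] at hi
        rw [i₃ j (by omega), hT.get j (by omega), List.getElem_append_right (by omega)]
        simp [show H.length + 1 + j - H.length = j + 1 by omega]

/-- The bound on the running time of the program. -/
def timeBound (n k : ℕ) : ℕ :=
  (2 * k - 1).choose k * ((n + 1) * (5200 * (k * lg n))) + 300 * (n + 1)

theorem runs_program (hk : 1 ≤ k) (hw : (S.length + 2) * (S.length + 2) ≤ 2 ^ w) :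
    Runs w program (input S k) fun t s' =>
      (t ≤ 300 * (S.length + 1) ∨ (k ≤ S.length ∧ t ≤ timeBound S.length k)) ∧
      IsMaximalKRepeating k S s'.output ∧
      ((∀ σ, S.count σ < k) → s'.output = []) ∧
      ((∃ σ, k ≤ S.count σ) →
        ∃ σ, k ≤ S.count σ ∧ (List.replicate (S.count σ / k) σ).Sublist s'.output) := by
  unfold program
  refine runs_seq ((runs_preprocess hk hw).mono ?_)
  rintro t₁ s₁ f₁ ⟨ht₁, henv, hfound⟩
  rcases hfound with ⟨e₁, hnone⟩ | ⟨e₁, hcount⟩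
  · refine runs_cond_false (by simpa [Expr.eval] using e₁) (runs_assign ?_)
    have hout : (s₁.setVar vN ((Expr.const 0).eval w s₁)).output = [] :=
      output_eq (by simp [Expr.eval]) (by simp)
    rw [hout]
    refine ⟨.inl (by simp [Expr.cost]; omega), isMaximalKRepeating_nil hnone, fun _ => rfl, ?_⟩
    rintro ⟨σ, hσ⟩
    exact absurd (hnone σ) (not_lt.2 hσ)
  · set σ := s₁.var vSig with hσ
    have hcl : S.count σ ≤ S.length := List.count_le_length
    have hm1 : 1 ≤ S.count σ / k := Nat.div_pos hcount hk
    refine runs_cond_true (by simp [Expr.eval, e₁]) (runs_seq ((runs_prepare henv hw hk hσ.symm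
      hcount (fun j => by rw [f₁.arr aTup rfl]; rfl) (by rw [f₁.var vHl rfl]; rfl)).mono ?_))
    rintro t₂ s₂ f₂ ⟨ht₂, hc₂, p₁, p₂, p₃, p₄, p₅, p₆, p₇⟩
    have hpow : σ :: List.replicate (S.count σ / k - 1) σ = List.replicate (S.count σ / k) σ := by
      rw [← List.replicate_succ, Nat.sub_add_cancel hm1]
    refine runs_seq ((runs_mainLoop hc₂ rfl hcount p₂ p₃ p₄ p₅ p₆ p₇ (.refl _) ?_).mono ?_)
    · rw [List.nil_append, hpow]
      exact replicate_power_sublist σ k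
    rintro t₃ s₃ f₃ ⟨ht₃, H, T, hH, hT, hTσ, hmax⟩
    refine (runs_writeOutput (hc₂.frame rfl f₃) ((f₃.var vSig rfl).trans p₁) hH hT
      hmax.1.1.length_le).mono ?_
    rintro t₄ s₄ - ⟨ht₄, hout⟩
    rw [hout]
    refine ⟨.inr ⟨hcount.trans hcl, ?_⟩, hmax, fun h => absurd (h σ) (not_lt.2 hcount),
      fun _ => ⟨σ, hcount, ?_⟩⟩
    · simp only [timeBound, Expr.cost]
      omega
    · rw [← hpow]
      exact (hTσ.cons_cons σ).trans (List.sublist_append_right _ _)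

/-! ### The bound on the running time -/

/-- For `n ≥ 2` the rounds number at most `log₂ n + 2 ≤ 3 * log₂ n`, and `3 / log 2 < 6`. -/
theorem lg_le_log {n : ℕ} (hn : 2 ≤ n) : (lg n : ℝ) ≤ 6 * Real.log n := by
  have h2 : (0.6931471803 : ℝ) < Real.log 2 := Real.log_two_gt_d9
  have hlog : Real.log 2 ≤ Real.log n :=
    Real.log_le_log (by norm_num) (by exact_mod_cast hn)
  have h₁ : lg n ≤ Nat.log 2 n + 2 := by
    have : Nat.clog 2 (n + 1) ≤ Nat.log 2 n + 1 :=
      Nat.clog_le_of_le_pow (Nat.lt_pow_succ_log_self (by norm_num) n)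
    unfold lg
    omega
  have h₂ : (Nat.log 2 n : ℝ) * Real.log 2 ≤ Real.log n := by
    rw [← Real.log_pow]
    refine Real.log_le_log (by positivity) ?_
    exact_mod_cast Nat.pow_log_le_self 2 (by omega)
  have h₃ : (lg n : ℝ) ≤ Nat.log 2 n + 2 := by exact_mod_cast h₁
  have h₄ : (0 : ℝ) ≤ Nat.log 2 n := Nat.cast_nonneg _
  nlinarith

/-- At `n = 1` the main term on the right vanishes, so `k` must be bounded by `n` for the constant
to suffice. From `n = 2` on, `n + 1` and `(n + 1) * lg n` are at most `12 * (n * log n)`. -/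
theorem timeBound_le {n k : ℕ} (hk : 1 ≤ k) (hkn : k ≤ n) :
    (timeBound n k : ℝ) ≤
      100000 * ((k : ℝ) * ((2 * k - 1).choose k : ℝ) * ((n : ℝ) * Real.log n) + 1) := by
  rcases (show n = 1 ∨ 2 ≤ n by omega) with rfl | hn
  · obtain rfl : k = 1 := by omega
    have : lg 1 = 2 := by simp only [lg, Nat.reduceAdd]; rw [show Nat.clog 2 2 = 1 from Nat.clog_eq_one (le_refl 2) (le_refl 2)]
    simp [timeBound, this]
    norm_num
  · have hlg := lg_le_log hn
    have hB : (1 : ℝ) ≤ ((2 * k - 1).choose k : ℝ) := by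
      exact_mod_cast Nat.choose_pos (show k ≤ 2 * k - 1 by omega)
    have hk' : (1 : ℝ) ≤ (k : ℝ) := by exact_mod_cast hk
    have hn' : (2 : ℝ) ≤ (n : ℝ) := by exact_mod_cast hn
    have hl : (1 : ℝ) ≤ lg n := by exact_mod_cast one_le_lg n
    have hkB : (1 : ℝ) ≤ k * ((2 * k - 1).choose k : ℝ) := one_le_mul_of_one_le_of_one_le hk' hB
    set B : ℝ := ((2 * k - 1).choose k : ℝ)
    set x : ℝ := (n : ℝ) * Real.log n with hx
    have h₁ : ((n : ℝ) + 1) * lg n ≤ 12 * x := by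
      have : ((n : ℝ) + 1) * lg n ≤ (2 * n) * (6 * Real.log n) :=
        mul_le_mul (by linarith) hlg (by linarith) (by linarith)
      rw [hx]; linarith
    have h₂ : ((n : ℝ) + 1) ≤ 12 * x := le_trans (by nlinarith) h₁
    have hx0 : 0 ≤ x := by linarith
    have h₃ : k * B * (((n : ℝ) + 1) * lg n) ≤ k * B * (12 * x) :=
      mul_le_mul_of_nonneg_left h₁ (by linarith)
    have h₄ : x ≤ k * B * x := le_mul_of_one_le_left hx0 hkB
    have h₅ : (timeBound n k : ℝ) = 5200 * (k * B * (((n : ℝ) + 1) * lg n)) +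
        300 * ((n : ℝ) + 1) := by
      simp only [timeBound, B]
      push_cast
      ring
    rw [h₅]
    nlinarith

theorem linear_le {n k : ℕ} (hk : 1 ≤ k) :
    (300 * ((n : ℝ) + 1)) ≤
      100000 * ((k : ℝ) * ((2 * k - 1).choose k : ℝ) * ((n : ℝ) * Real.log n) + 1) := by
  rcases (show n ≤ 1 ∨ 2 ≤ n by omega) with hn | hn
  · interval_cases n <;> norm_num
  · have hlg := lg_le_log hn
    have hB : (1 : ℝ) ≤ ((2 * k - 1).choose k : ℝ) := by
      exact_mod_cast Nat.choose_pos (show k ≤ 2 * k - 1 by omega)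
    have hk' : (1 : ℝ) ≤ (k : ℝ) := by exact_mod_cast hk
    have hn' : (2 : ℝ) ≤ (n : ℝ) := by exact_mod_cast hn
    have hl : (1 : ℝ) ≤ lg n := by exact_mod_cast one_le_lg n
    have hkB : (1 : ℝ) ≤ k * ((2 * k - 1).choose k : ℝ) := one_le_mul_of_one_le_of_one_le hk' hB
    set x : ℝ := (n : ℝ) * Real.log n with hx
    have h₁ : (n : ℝ) ≤ 6 * x := by
      have : (n : ℝ) * 1 ≤ n * (6 * Real.log n) :=
        mul_le_mul_of_nonneg_left (by linarith) (by linarith)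
      rw [hx]; linarith
    have h₄ := le_mul_of_one_le_left (show 0 ≤ x by linarith) hkB
    linarith

theorem program_finds (hk : 1 ≤ k) (h : FitsWords 2 w k S) :
    FindsMaximalKRepeating program w k S
      (100000 * ((k : ℝ) * ((2 * k - 1).choose k : ℝ) *
        ((S.length : ℝ) * Real.log (S.length : ℝ)) + 1)) := by
  obtain ⟨t, s, hx, ht, hrest⟩ := runs_program (S := S) hk (by simpa [sq] using h.1)
  refine ⟨t, s, hx, ?_, hrest⟩
  rcases ht with ht | ⟨hkn, ht⟩
  · refine le_trans ?_ (linear_le hk)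
    exact_mod_cast ht
  · refine le_trans ?_ (timeBound_le hk hkn)
    exact_mod_cast ht

end WordRAM

theorem mainTheorem3 :
    ∃ (P : WordRAM.Cmd) (c : ℕ),
      (∃ C : ℝ, ∀ (k : ℕ) (S : List ℕ) (w : ℕ), 1 ≤ k → FitsWords c w k S →
        FindsMaximalKRepeating P w k S
          (C * ((k : ℝ) * ((2 * k - 1).choose k : ℝ) *
            ((S.length : ℝ) * Real.log (S.length : ℝ)) + 1))) ∧
      (∀ k : ℕ, 1 ≤ k → ∃ C : ℝ, ∀ (S : List ℕ) (w : ℕ), FitsWords c w k S →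
        FindsMaximalKRepeating P w k S
          (C * ((S.length : ℝ) * Real.log (S.length : ℝ) + 1))) := by
  refine ⟨WordRAM.program, 2, ⟨100000, fun k S w hk h => WordRAM.program_finds hk h⟩,
    fun k hk => ⟨100000 * ((k : ℝ) * ((2 * k - 1).choose k : ℝ)), fun S w h => ?_⟩⟩
  obtain ⟨t, s, hx, ht, hrest⟩ := WordRAM.program_finds hk h
  refine ⟨t, s, hx, ht.trans ?_, hrest⟩
  -- For fixed `k` the factor `k * (2 * k - 1).choose k` goes into the constant; being at least `1`,
  -- it also dominates the additive term.
  have hk' : (1 : ℝ) ≤ (k : ℝ) := by exact_mod_cast hk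
  have hB : (1 : ℝ) ≤ ((2 * k - 1).choose k : ℝ) := by
    exact_mod_cast Nat.choose_pos (show k ≤ 2 * k - 1 by omega)
  have hkB := one_le_mul_of_one_le_of_one_le hk' hB
  nlinarith
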